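/- Let $1\le m<n$, $R_1=\{1,\dots,m\}$, $R_2=\{m+1,\dots,n\}$, $M=\{1,\dots,n\}\times\mathbb R$. For $i\ne j$ let $q_{ij}:\mathbb R\to[0,\infty)$ be continuous, with $q_{ij}(z)>0$ for $z<0$ and, for $z\ge 0$, $q_{ij}(z)>0$ if and only if $i,j$ belong to the same class $R_k$. Suppose there are constants $\overline q_{ij}>0$ and functions $\varphi:(-\infty,0)\to(0,\infty)$, $\beta_{ij}:(-\infty,0)\to\mathbb R$ with $\varphi(z)\to0$, $\beta_{ij}(z)\to0$ as $z\uparrow0$ and $$q_{ij}(z)-q_{ij}(0)=\overline q_{ij}\,\varphi(z)(1+\beta_{ij}(z)),\qquad z<0,\ i\neq j.$$ Let $v(i,\cdot)$, $1\le i\le n$, be Lipschitz continuous and positive on $\mathbb R$. Suppose that there is $C>0$ such that each $q_{ij}$ is constant on $(-\infty,-C]$ and constant on $[C,\infty)$, and that $v(i,z)=\overline v^\infty$ for all $i$ and all $|z|\ge C$, with a constant $\overline v^\infty$. For $\varepsilon>0$ and $x=(i,z)\in M$ let $X^{x,\varepsilon}_t=(\xi_t,z_t)$ be the process on $M$ started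 at $x$ and defined as follows. With $\xi_t=i$ fixed, $z_t$ solves $\dot z_t=v(i,z_t)$ until the time $\sigma$ at which $\varepsilon^{-1}\int_0^{t}Q_i(z_s)\,ds$, $Q_i=\sum_{j\ne i}q_{ij}$, first reaches an independent exponential variable of mean one ($\sigma=\infty$ if it never does); at time $\sigma$ the process jumps to $(j,z_\sigma)$, $j\neq i$, with probability $q_{ij}(z_\sigma)/Q_i(z_\sigma)$; and it then starts afresh from this point, independently of the past. Then the following holds. For each $z<0$ the Markov chain with rates $q_{ij}(z)$ has a unique invariant distribution $\mu(z)$, and the limits $\pi_i=\lim_{z\uparrow0}\mu_i(z)$ exist. Put $\overline\pi_k=\sum_{i\in R_k}\pi_i$; for $z\ge0$ let $\mu(z)$ be the (unique) invariant distribution of the chain with rates $q_{ij}(z)$ for which $\sum_{i\in R_k}\mu_i(z)=\overline\pi_k$, $k=1,2$. Then each $\mu_i$ is continuous on $\mathbb R$. Let $\overline v_0(z)=\sum_i v(i,z)\mu_i(z)$ for $z<0$, $\overline v_k(z)=\overline\pi_k^{-1}\sum_{i\in R_k}v(i,z)\mu_i(z)$ for $z\ge0$, $k=1,2$, and $$p_k=\frac{\sum_{i\in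 R_k}\pi_i v(i,0)}{\sum_{i=1}^n\pi_i v(i,0)},\qquad k=1,2.$$ Let $S$ be the graph obtained from $I_0=\{0\}\times(-\infty,0]$, $I_1=\{1\}\times[0,\infty)$, $I_2=\{2\}\times[0,\infty)$ by identifying the three end points to one vertex $O$, and let $h:M\to S$ be given by $h(i,z)=(0,z)$ for $z\le0$ and $h(i,z)=(k,z)$ for $z\ge0$, $i\in R_k$. Let $Y^y_t$ be the process on $S$ with $Y^y_0=y$ that moves deterministically with speed $\overline v_l$ along each $I_l$ and, when it is at $O$ (coming from $I_0$ or started there), proceeds to $I_1$ with probability $p_1$ and to $I_2$ with probability $p_2$. For each $x\in M$ and $\varepsilon>0$ the process $h(X^{x,\varepsilon}_t)$ has almost surely continuous trajectories. For each $x=(i,z)\in M$ with $z\ne0$, the measures induced by $h(X^{x,\varepsilon}_t)$ on $C([0,\infty),S)$ converge weakly, as $\varepsilon\downarrow0$, to the measure induced by $Y^{h(x)}_t$. For $x=(i,0)$ with $i\in R_k$, they converge weakly to the law of the deterministic motion from $O$ along $I_k$ with speed $\overline v_k$. -/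

import Mathlib

open MeasureTheory ProbabilityTheory Filter Topology Set
open scoped NNReal ENNReal BoundedContinuousFunction

noncomputable section

namespace FastSlow

/-- Index of the ergodic class of a state: `0` for the first `m` states (the class `R₁`),
`1` for the remaining ones (the class `R₂`). -/
def cls {n : ℕ} (m : ℕ) (i : Fin n) : Fin 2 := if i.val < m then 0 else 1

/-- The ergodic class with index `k`. -/
def R {n : ℕ} (m : ℕ) (k : Fin 2) : Finset (Fin n) := Finset.univ.filter fun i => cls m i = k

/-- `Q_i(z) = ∑_{j ≠ i} q_{ij}(z)`. -/
def exitRate {n : ℕ} (q : Fin n → Fin n → ℝ → ℝ) (i : Fin n) (z : ℝ) : ℝ :=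
  ∑ j ∈ Finset.univ.erase i, q i j z

/-! ### The motion along a velocity field -/

/-- `ζ` moves, for `t ≥ 0`, along the line with velocity `V`, starting at `z`.  Only the right
derivative is prescribed, since `V` may have a jump; for a continuous `V` this is the ODE. -/
def IsMotion (V : ℝ → ℝ) (z : ℝ) (ζ : ℝ → ℝ) : Prop :=
  ζ 0 = z ∧ ContinuousOn ζ (Ici 0) ∧ ∀ t, 0 ≤ t → HasDerivWithinAt ζ (V (ζ t)) (Ici t) t

/-- The motion with velocity `V` started at `z`. -/
def motion (V : ℝ → ℝ) (z : ℝ) : ℝ → ℝ := Classical.epsilon (IsMotion V z)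

/-! ### The fast-slow process -/

/-- The noise space: one pair (exponential variable, uniform variable) for every jump. -/
abbrev Noise : Type := ℕ → ℝ × ℝ

instance : IsProbabilityMeasure (expMeasure 1) := isProbabilityMeasure_expMeasure one_pos

instance : IsProbabilityMeasure ((volume : Measure ℝ).restrict (Icc 0 1)) := ⟨by simp⟩

/-- The pairs are independent of each other; in each pair the first entry is exponential with
parameter one, the second is uniform on `[0,1]`, and the two are independent. -/
def noiseMeasure : Measure Noise :=
  Measure.infinitePi fun _ => (expMeasure 1).prod ((volume : Measure ℝ).restrict (Icc 0 1))

/-- The time `σ` of the jump-free motion from `(i, z)`: the first time at which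
`r(t) = ε⁻¹ ∫₀ᵗ Q_i(z_s) ds` reaches the level `e`, and `∞` if it never does. -/
def holdTime {n : ℕ} (q : Fin n → Fin n → ℝ → ℝ) (v : Fin n → ℝ → ℝ) (ε : ℝ)
    (i : Fin n) (z e : ℝ) : ℝ≥0∞ :=
  ⨅ (t : ℝ≥0) (_ : e ≤ ε⁻¹ * ∫ s in (0 : ℝ)..t, exitRate q i (motion (v i) z s)), (t : ℝ≥0∞)

/-- The state to which the process jumps from `(i, z)`.  When `u` is uniform on `[0,1]`, it is
`j ≠ i` with probability `q_{ij}(z) / Q_i(z)` (inversion of the distribution function). -/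
def jumpTarget {n : ℕ} (q : Fin n → Fin n → ℝ → ℝ) (i : Fin n) (z u : ℝ) : Fin n :=
  open Classical in
  if h : ∃ j, j ≠ i ∧ ∑ k ∈ (Finset.univ.erase i).filter (· < j), q i k z ≤ u * exitRate q i z ∧
      u * exitRate q i z < ∑ k ∈ (Finset.univ.erase i).filter (· ≤ j), q i k z
  then h.choose else i

/-- Time of the `k`-th jump (`∞` if there are fewer than `k` jumps), and the state of the fast
and of the slow component right after it; the `0`-th jump is the start at time `0`. -/
def jumpState {n : ℕ} (q : Fin n → Fin n → ℝ → ℝ) (v : Fin n → ℝ → ℝ) (ε : ℝ)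
    (x : Fin n × ℝ) (ω : Noise) : ℕ → ℝ≥0∞ × Fin n × ℝ
  | 0 => (0, x.1, x.2)
  | k + 1 =>
    let s := jumpState q v ε x ω k
    let σ := holdTime q v ε s.2.1 s.2.2 (ω k).1
    let z' := motion (v s.2.1) s.2.2 σ.toReal
    (s.1 + σ, jumpTarget q s.2.1 z' (ω k).2, z')

/-- The fast-slow process `X^{x,ε}_t = (ξ_t, z_t)`.  (Its value is set to `x` after the
accumulation time of the jumps, if there is one.) -/
def X {n : ℕ} (q : Fin n → Fin n → ℝ → ℝ) (v : Fin n → ℝ → ℝ) (ε : ℝ)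
    (x : Fin n × ℝ) (ω : Noise) (t : ℝ≥0) : Fin n × ℝ :=
  open Classical in
  if h : ∃ k, (jumpState q v ε x ω k).1 ≤ t ∧ (t : ℝ≥0∞) < (jumpState q v ε x ω (k + 1)).1 then
    let s := jumpState q v ε x ω h.choose
    (s.2.1, motion (v s.2.1) s.2.2 (t - s.1.toReal))
  else x

/-! ### The graph and its path space -/

/-- The graph `S`: three half-lines glued at their end points, realized as the union of the
half-axes `I₀ = {y₀ ≤ 0}`, `I₁ = {y₁ ≥ 0}`, `I₂ = {y₂ ≥ 0}` of `ℝ³`; the point `(l, z)` has `l`-th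
coordinate `z` and the other two equal to `0`. -/
abbrev S : Type :=
  {y : Fin 3 → ℝ // y 0 ≤ 0 ∧ 0 ≤ y 1 ∧ 0 ≤ y 2 ∧ ∀ k l, k ≠ l → y k = 0 ∨ y l = 0}

/-- The vertex. -/
def O : S := ⟨0, by simp⟩

/-- The natural parametrization of the line `I₀ ∪ I_{k+1}`: the point `(0, z)` for `z ≤ 0`, the
point `(k + 1, z)` for `z ≥ 0`. -/
def branch (k : Fin 2) (z : ℝ) : S :=
  ⟨fun l => if l = 0 then min z 0 else if l = k.succ then max z 0 else 0, by
    refine ⟨by simp, ?_, ?_, ?_⟩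
    · fin_cases k <;> simp
    · fin_cases k <;> simp
    · intro a b hab
      rcases le_total z 0 with hz | hz <;> fin_cases k <;> fin_cases a <;> fin_cases b <;>
        simp_all⟩

/-- The projection `h : {1,…,n} × ℝ → S`. -/
def h {n : ℕ} (m : ℕ) (x : Fin n × ℝ) : S := branch (cls m x.1) x.2

/-- Continuous paths in the graph, with the topology of locally uniform convergence. -/
abbrev PathSpace : Type := C(ℝ≥0, S)

instance : MeasurableSpace PathSpace := borel _

instance : BorelSpace PathSpace := ⟨rfl⟩

/-- A continuous function as an element of the path space (a discontinuous one is replaced by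
the constant path at the vertex). -/
def toPath (f : ℝ≥0 → S) : PathSpace :=
  open Classical in if hf : Continuous f then ⟨f, hf⟩ else ContinuousMap.const _ O

/-- The measure on the path space induced by `h(X^{x,ε}_t)`. -/
def projectedLaw {n : ℕ} (m : ℕ) (q : Fin n → Fin n → ℝ → ℝ) (v : Fin n → ℝ → ℝ)
    (x : Fin n × ℝ) (ε : ℝ) : Measure PathSpace :=
  noiseMeasure.map fun ω => toPath fun t => h m (X q v ε x ω t)

/-- The probability measures `law ε` converge weakly to the probability measure `ν` as `ε ↓ 0`. -/
def ConvergesWeakly (law : ℝ → Measure PathSpace) (ν : Measure PathSpace) : Prop :=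
  (∀ ε, 0 < ε → IsProbabilityMeasure (law ε)) ∧ IsProbabilityMeasure ν ∧
    ∀ F : PathSpace →ᵇ ℝ,
      Tendsto (fun ε => ∫ y, F y ∂(law ε)) (𝓝[>] 0) (𝓝 (∫ y, F y ∂ν))

/-! ### Invariant distributions, averaged speeds and the limiting process -/

/-- `μ` is an invariant probability distribution of the chain with the rates `q_{ij}(z)`. -/
def IsInvariant {n : ℕ} (q : Fin n → Fin n → ℝ → ℝ) (z : ℝ) (μ : Fin n → ℝ) : Prop :=
  (∀ i, 0 ≤ μ i) ∧ ∑ i, μ i = 1 ∧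
    ∀ j, ∑ i ∈ Finset.univ.erase j, μ i * q i j z = μ j * exitRate q j z

/-- The invariant distribution where it is unique, that is, for `z < 0`. -/
def muNeg {n : ℕ} (q : Fin n → Fin n → ℝ → ℝ) (z : ℝ) : Fin n → ℝ :=
  Classical.epsilon (IsInvariant q z)

/-- `π_i`, the limit of `μ_i(z)` as `z ↑ 0`. -/
def piLim {n : ℕ} (q : Fin n → Fin n → ℝ → ℝ) (i : Fin n) : ℝ :=
  limUnder (𝓝[<] (0 : ℝ)) fun z => muNeg q z i

/-- The total mass that `π` gives to a class. -/
def piBar {n : ℕ} (m : ℕ) (q : Fin n → Fin n → ℝ → ℝ) (k : Fin 2) : ℝ :=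
  ∑ i ∈ R m k, piLim q i

/-- The invariant distribution `μ(z)`; for `z ≥ 0`, among the invariant distributions, the one
which gives the two classes the same masses as `π`. -/
def mu {n : ℕ} (m : ℕ) (q : Fin n → Fin n → ℝ → ℝ) (z : ℝ) : Fin n → ℝ :=
  open Classical in
  if z < 0 then muNeg q z
  else Classical.epsilon fun μ => IsInvariant q z μ ∧ ∀ k, ∑ i ∈ R m k, μ i = piBar m q k

/-- The averaged speed along the line `I₀ ∪ I_{k+1}`: `v̄₀` for `z < 0` and `v̄_{k+1}` for
`z ≥ 0`. -/
def avgSpeed {n : ℕ} (m : ℕ) (q : Fin n → Fin n → ℝ → ℝ) (v : Fin n → ℝ → ℝ) (k : Fin 2)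
    (z : ℝ) : ℝ :=
  open Classical in
  if z < 0 then ∑ i, v i z * mu m q z i
  else (piBar m q k)⁻¹ * ∑ i ∈ R m k, v i z * mu m q z i

/-- The probability `p_{k+1}` of proceeding to `I_{k+1}` at the vertex. -/
def exitProb {n : ℕ} (m : ℕ) (q : Fin n → Fin n → ℝ → ℝ) (v : Fin n → ℝ → ℝ) (k : Fin 2) : ℝ :=
  (∑ i ∈ R m k, piLim q i * v i 0) / ∑ i, piLim q i * v i 0

/-- The law of the deterministic motion with the averaged speeds along `I₀ ∪ I_{k+1}`, from the
point with coordinate `z`. -/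
def branchLaw {n : ℕ} (m : ℕ) (q : Fin n → Fin n → ℝ → ℝ) (v : Fin n → ℝ → ℝ) (k : Fin 2)
    (z : ℝ) : Measure PathSpace :=
  Measure.dirac (toPath fun t => branch k (motion (avgSpeed m q v k) z t))

/-- The law of the limiting process `Y^y`: deterministic motion along its edge if `y` lies in the
interior of `I₁` or `I₂`; for `y ∈ I₀` (including the vertex) the process moves to the vertex
and proceeds from there to `I₁` or `I₂` with probabilities `p₁` and `p₂`. -/
def limitLaw {n : ℕ} (m : ℕ) (q : Fin n → Fin n → ℝ → ℝ) (v : Fin n → ℝ → ℝ) (y : S) :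
    Measure PathSpace :=
  open Classical in
  if 0 < y.1 1 then branchLaw m q v 0 (y.1 1)
  else if 0 < y.1 2 then branchLaw m q v 1 (y.1 2)
  else ∑ k : Fin 2, ENNReal.ofReal (exitProb m q v k) • branchLaw m q v k (y.1 0)

end FastSlow

end

/-! All speeds lie between two positive constants, so the slow variable increases, passes each level
`r` above its start exactly once, and can serve as the time of the fast chain. In this time the
rates out of `i` are `ε⁻¹ q i j / v i`. The whole theorem is read off from one kind of estimate:
upper bounds, asymptotic as `ε ↓ 0`, for the expectation of `exp (-θ τ)` on the event that the fast
variable is in class `k` at the passage time `τ` of `r`.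

Such bounds come from supersolutions. If `u` is a supersolution of the backward equation on `[x.2,
r]` and dominates `g` at `r`, the expected discounted reward `g` at the passage of `r` is at most `u
x.1 x.2`. This holds for one jump (`lintegral_step_le`) and telescopes along the jump chain
(`lintegral_sum_reward_le`).

Upper bounds are enough. With `θ = 0` the bounds for the two classes add up to one, so the class
probabilities converge (`exit_class_tendsto`). With `θ = 1` and `θ = -1` together they bound the
expectation of `2 cosh (τ - T)` by `2` times the limiting mass, and since `cosh` has its strict
minimum `1` at `0`, `τ` concentrates at `T` (`passage_time_tendsto`). Passage times of a finite grid
of levels determine a trajectory up to the mesh because the speeds are bounded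
(`abs_sub_motion_le`); this gives weak convergence (`convergesWeakly`).

The supersolutions are glued from three pieces (`upperBound_concat`). Away from the vertex they are
perturbed test functions `exp (-θ (T r - T z)) (1 + ε χ)`, where `T` is the clock of the averaged
speed and the corrector `χ` solves, up to a small error, a Poisson equation for the fast chain
(`upperBound_average`). For `z < 0` that chain is irreducible; for `z ≥ 0` each class is averaged
separately.

On `[-δ, 0]` the rates between the classes are of order `φ / ε` while those inside a class are of
order `1 / ε` (`upperBound_vertex`). In the slow time the limiting rates at the vertex are `q i j 0
/ v i 0`, which leave `π i * v i 0` invariant. The induced two-state chain of classes has stationary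
probabilities proportional to `∑ i ∈ R k, π i * v i 0`, and this is why the speeds enter the exit
probabilities. The deviation of the class indicator from its stationary probability is damped by
`exp (-ε⁻¹ κ ∫ φ)`, which vanishes over any `[-δ, 0]` as `ε ↓ 0`, whatever the rate at which `φ`
vanishes. The inhomogeneity inside the classes is removed by a corrector that solves a linear fast
equation and is bounded by a multiple of `sup φ`, uniformly in `ε` (`IsNull.exists_relaxation`).

The existence of `π` is a compactness argument: every limit point of `μ z` is invariant at `0`, and
its split between the classes is fixed by the balance of flow between them, divided by `φ z` before
the limit (`exists_limit`). -/

noncomputable section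

namespace FastSlow

/-! ### Motions with a positive speed -/

/-- A right-continuous speed, bounded and bounded away from zero. -/
structure IsSpeed (V : ℝ → ℝ) (a b : ℝ) : Prop where
  pos : 0 < a
  lower : ∀ z, a ≤ V z
  upper : ∀ z, V z ≤ b
  meas : Measurable V
  right : ∀ z, ContinuousWithinAt V (Ici z) z

/-- The time needed to get from `0` to `z` with the speed `V`. -/
def clock (V : ℝ → ℝ) (z : ℝ) : ℝ := ∫ y in (0 : ℝ)..z, (V y)⁻¹

namespace IsSpeed

variable {V : ℝ → ℝ} {a b : ℝ}

theorem speed_pos (hV : IsSpeed V a b) (z : ℝ) : 0 < V z := hV.pos.trans_le (hV.lower z)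

theorem upper_pos (hV : IsSpeed V a b) : 0 < b := (hV.speed_pos 0).trans_le (hV.upper 0)

theorem inv_le (hV : IsSpeed V a b) (z : ℝ) : (V z)⁻¹ ≤ a⁻¹ :=
  inv_anti₀ hV.pos (hV.lower z)

theorem le_inv (hV : IsSpeed V a b) (z : ℝ) : b⁻¹ ≤ (V z)⁻¹ :=
  inv_anti₀ (hV.speed_pos z) (hV.upper z)

theorem intervalIntegrable_inv (hV : IsSpeed V a b) (z w : ℝ) :
    IntervalIntegrable (fun y => (V y)⁻¹) volume z w := by
  refine (intervalIntegrable_const (c := a⁻¹)).mono_fun hV.meas.inv.aestronglyMeasurable ?_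
  refine Eventually.of_forall fun y => ?_
  have h1 := hV.inv_le y
  have h2 := inv_pos.2 (hV.speed_pos y)
  simp only [Real.norm_eq_abs]
  rw [abs_of_pos h2, abs_of_pos (inv_pos.2 hV.pos)]
  exact h1

theorem clock_sub (hV : IsSpeed V a b) (z w : ℝ) :
    clock V w - clock V z = ∫ y in z..w, (V y)⁻¹ :=
  intervalIntegral.integral_interval_sub_left (hV.intervalIntegrable_inv _ _)
    (hV.intervalIntegrable_inv _ _)

theorem clock_sub_le (hV : IsSpeed V a b) {z w : ℝ} (h : z ≤ w) :
    clock V w - clock V z ≤ a⁻¹ * (w - z) := by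
  rw [hV.clock_sub]
  have := intervalIntegral.integral_mono_on h (hV.intervalIntegrable_inv z w)
    (intervalIntegrable_const (c := a⁻¹)) fun y _ => hV.inv_le y
  simpa [mul_comm] using this

theorem le_clock_sub (hV : IsSpeed V a b) {z w : ℝ} (h : z ≤ w) :
    b⁻¹ * (w - z) ≤ clock V w - clock V z := by
  rw [hV.clock_sub]
  have := intervalIntegral.integral_mono_on h (intervalIntegrable_const (c := b⁻¹))
    (hV.intervalIntegrable_inv z w) fun y _ => hV.le_inv y
  simpa [mul_comm] using this

theorem clock_strictMono (hV : IsSpeed V a b) : StrictMono (clock V) := by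
  intro z w h
  have h1 := hV.le_clock_sub h.le
  have h2 : 0 < b⁻¹ * (w - z) := mul_pos (inv_pos.2 hV.upper_pos) (sub_pos.2 h)
  linarith

theorem clock_continuous (hV : IsSpeed V a b) : Continuous (clock V) :=
  intervalIntegral.continuous_primitive (fun z w => hV.intervalIntegrable_inv z w) 0

@[simp] theorem clock_zero (V : ℝ → ℝ) : clock V 0 = 0 := by simp [clock]

theorem clock_surjective (hV : IsSpeed V a b) : Function.Surjective (clock V) := by
  have hb := inv_pos.2 hV.upper_pos
  refine hV.clock_continuous.surjective ?_ ?_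
  · refine tendsto_atTop_mono' atTop ?_ (tendsto_id.const_mul_atTop hb)
    filter_upwards [eventually_ge_atTop 0] with z hz
    have := hV.le_clock_sub hz
    simp at this ⊢
    linarith
  · refine tendsto_atBot_mono' atBot ?_ (tendsto_id.const_mul_atBot hb)
    filter_upwards [eventually_le_atBot 0] with z hz
    have := hV.le_clock_sub hz
    simp at this ⊢
    linarith

/-- The clock as a homeomorphism. -/
def clockIso (hV : IsSpeed V a b) : ℝ ≃o ℝ :=
  hV.clock_strictMono.orderIsoOfSurjective _ hV.clock_surjective

theorem clock_symm (hV : IsSpeed V a b) (t : ℝ) : clock V (hV.clockIso.symm t) = t :=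
  hV.clockIso.apply_symm_apply t

theorem symm_clock (hV : IsSpeed V a b) (z : ℝ) : hV.clockIso.symm (clock V z) = z :=
  hV.clockIso.symm_apply_apply z

theorem symm_continuous (hV : IsSpeed V a b) : Continuous hV.clockIso.symm :=
  hV.clockIso.symm.continuous

/-- One-sided on purpose: the averaged speed may jump at the vertex, where it is only
right-continuous. -/
theorem hasDerivWithinAt_clock (hV : IsSpeed V a b) (z : ℝ) :
    HasDerivWithinAt (clock V) (V z)⁻¹ (Ici z) z := by
  refine intervalIntegral.integral_hasDerivWithinAt_right (hV.intervalIntegrable_inv 0 z)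
    (t := Ioi z) ?_ ?_
  · exact hV.meas.inv.stronglyMeasurable.stronglyMeasurableAtFilter
  · exact ((hV.right z).mono Ioi_subset_Ici_self).inv₀ (hV.speed_pos z).ne'

/-- The inverse function rule on half-lines. It applies because the inverse is continuous and
monotone, so that it maps `[t, ∞)` into the half-line on which the clock is differentiated. -/
theorem hasDerivWithinAt_symm (hV : IsSpeed V a b) (t : ℝ) :
    HasDerivWithinAt hV.clockIso.symm (V (hV.clockIso.symm t)) (Ici t) t := by
  have hne := inv_ne_zero (hV.speed_pos (hV.clockIso.symm t)).ne'
  have h1 := (hV.hasDerivWithinAt_clock (hV.clockIso.symm t)).hasFDerivWithinAt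
  have h2 : HasFDerivWithinAt (clock V)
      (ContinuousLinearEquiv.unitsEquivAut ℝ (Units.mk0 _ hne) : ℝ →L[ℝ] ℝ)
      (Ici (hV.clockIso.symm t)) (hV.clockIso.symm t) := by
    have e : (ContinuousLinearEquiv.unitsEquivAut ℝ (Units.mk0 _ hne) : ℝ →L[ℝ] ℝ) =
        ContinuousLinearMap.toSpanSingleton ℝ (V (hV.clockIso.symm t))⁻¹ := by
      ext
      simp
    exact e ▸ h1
  have h3 := h2.of_local_left_inverse (g := hV.clockIso.symm) (s := Ici t) ?_ self_mem_Ici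
    (Eventually.of_forall hV.clock_symm)
  · have := h3.hasDerivWithinAt
    simpa using this
  · refine tendsto_nhdsWithin_iff.2 ⟨hV.symm_continuous.continuousAt.continuousWithinAt, ?_⟩
    filter_upwards [self_mem_nhdsWithin] with s hs
    exact hV.clockIso.symm.monotone hs

theorem exists_isMotion (hV : IsSpeed V a b) (z : ℝ) : ∃ ζ, IsMotion V z ζ := by
  refine ⟨fun t => hV.clockIso.symm (clock V z + t), ?_, ?_, ?_⟩
  · simp [hV.symm_clock]
  · exact (hV.symm_continuous.comp (by fun_prop)).continuousOn
  · intro t _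
    have h := (hV.hasDerivWithinAt_symm (clock V z + t)).scomp (h := fun s => clock V z + s)
      (h' := 1) (s := Ici t) t (((hasDerivAt_id t).const_add _).hasDerivWithinAt) ?_
    · simpa [Function.comp_def] using h
    · intro s hs
      exact add_le_add_right (mem_Ici.1 hs) _

theorem motion_isMotion (hV : IsSpeed V a b) (z : ℝ) : IsMotion V z (motion V z) :=
  Classical.epsilon_spec (hV.exists_isMotion z)

theorem monotone_of_isMotion (hV : IsSpeed V a b) {z : ℝ} {ζ : ℝ → ℝ} (hζ : IsMotion V z ζ)
    {s t : ℝ} (hs : 0 ≤ s) (hst : s ≤ t) : ζ s ≤ ζ t := by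
  refine image_le_of_deriv_right_le_deriv_boundary (f := fun _ => ζ s) (f' := fun _ => 0)
    (B := ζ) (B' := fun r => V (ζ r)) (a := s) (b := t) continuousOn_const
    (fun _ _ => hasDerivWithinAt_const _ _ _) le_rfl
    (hζ.2.1.mono fun r hr => hs.trans hr.1) (fun r hr => hζ.2.2 r (hs.trans hr.1))
    (fun r _ => (hV.speed_pos _).le) ⟨hst, le_rfl⟩

theorem hasDerivWithinAt_comp_isMotion (hV : IsSpeed V a b) {z : ℝ} {ζ : ℝ → ℝ}
    (hζ : IsMotion V z ζ) {f : ℝ → ℝ} {f' t : ℝ} (ht : 0 ≤ t)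
    (hf : HasDerivWithinAt f f' (Ici (ζ t)) (ζ t)) :
    HasDerivWithinAt (fun s => f (ζ s)) (f' * V (ζ t)) (Ici t) t :=
  hf.comp t (hζ.2.2 t ht) fun _ hs => hV.monotone_of_isMotion hζ ht hs

/-- The difference between the clock along the motion and `t` has right derivative zero, hence is
constant. This yields uniqueness without any Lipschitz condition on the speed, and with it the
explicit form of the motion chosen by `Classical.epsilon`. -/
theorem clock_of_isMotion (hV : IsSpeed V a b) {z : ℝ} {ζ : ℝ → ℝ} (hζ : IsMotion V z ζ)
    {t : ℝ} (ht : 0 ≤ t) : clock V (ζ t) = clock V z + t := by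
  have hc : ContinuousOn (fun s => clock V (ζ s) - s) (Icc 0 t) :=
    ((hV.clock_continuous.comp_continuousOn hζ.2.1).mono fun r hr => hr.1).sub continuousOn_id
  have := constant_of_has_deriv_right_zero hc (fun s hs => ?_) t ⟨ht, le_rfl⟩
  · simp only [hζ.1] at this
    linarith
  · have h := (hV.hasDerivWithinAt_comp_isMotion hζ hs.1 (hV.hasDerivWithinAt_clock (ζ s))).sub
      (hasDerivWithinAt_id s (Ici s))
    rw [inv_mul_cancel₀ (hV.speed_pos _).ne', sub_self] at h
    exact h

theorem clock_motion (hV : IsSpeed V a b) (z : ℝ) {t : ℝ} (ht : 0 ≤ t) :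
    clock V (motion V z t) = clock V z + t :=
  hV.clock_of_isMotion (hV.motion_isMotion z) ht

theorem motion_eq (hV : IsSpeed V a b) (z : ℝ) {t : ℝ} (ht : 0 ≤ t) :
    motion V z t = hV.clockIso.symm (clock V z + t) := by
  rw [← hV.clock_motion z ht, hV.symm_clock]

@[simp] theorem motion_zero (hV : IsSpeed V a b) (z : ℝ) : motion V z 0 = z :=
  (hV.motion_isMotion z).1

theorem motion_clock_sub (hV : IsSpeed V a b) {z w : ℝ} (h : z ≤ w) :
    motion V z (clock V w - clock V z) = w := by
  rw [hV.motion_eq z (sub_nonneg.2 (hV.clock_strictMono.monotone h)), add_sub_cancel, hV.symm_clock]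

theorem motion_le_iff (hV : IsSpeed V a b) {z w t : ℝ} (ht : 0 ≤ t) :
    motion V z t ≤ w ↔ t ≤ clock V w - clock V z := by
  rw [← hV.clock_strictMono.le_iff_le, hV.clock_motion z ht, le_sub_iff_add_le']

theorem motion_mono (hV : IsSpeed V a b) (z : ℝ) {s t : ℝ} (hs : 0 ≤ s) (hst : s ≤ t) :
    motion V z s ≤ motion V z t :=
  hV.monotone_of_isMotion (hV.motion_isMotion z) hs hst

theorem le_motion_sub (hV : IsSpeed V a b) (z : ℝ) {s t : ℝ} (hs : 0 ≤ s) (hst : s ≤ t) :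
    a * (t - s) ≤ motion V z t - motion V z s := by
  have h := hV.clock_sub_le (hV.motion_mono z hs hst)
  rw [hV.clock_motion z hs, hV.clock_motion z (hs.trans hst)] at h
  have := mul_le_mul_of_nonneg_left h hV.pos.le
  rw [← mul_assoc, mul_inv_cancel₀ hV.pos.ne'] at this
  linarith

theorem motion_sub_le (hV : IsSpeed V a b) (z : ℝ) {s t : ℝ} (hs : 0 ≤ s) (hst : s ≤ t) :
    motion V z t - motion V z s ≤ b * (t - s) := by
  have h := hV.le_clock_sub (hV.motion_mono z hs hst)
  rw [hV.clock_motion z hs, hV.clock_motion z (hs.trans hst)] at h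
  have := mul_le_mul_of_nonneg_left h hV.upper_pos.le
  rw [← mul_assoc, mul_inv_cancel₀ hV.upper_pos.ne'] at this
  linarith

theorem continuous_motion (hV : IsSpeed V a b) :
    Continuous fun p : ℝ × ℝ≥0 => motion V p.1 p.2 := by
  have : (fun p : ℝ × ℝ≥0 => motion V p.1 p.2) =
      fun p : ℝ × ℝ≥0 => hV.clockIso.symm (clock V p.1 + p.2) := by
    ext p
    exact hV.motion_eq p.1 p.2.2
  rw [this]
  exact hV.symm_continuous.comp
    ((hV.clock_continuous.comp continuous_fst).add (NNReal.continuous_coe.comp continuous_snd))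

end IsSpeed

end FastSlow

end

noncomputable section

namespace FastSlow

/-! ### Finite Markov chains with several ergodic classes -/

section Chain

set_option linter.unusedSectionVars false

variable {ι κ : Type*} [Fintype ι] [DecidableEq ι] [DecidableEq κ]

/-- `d` is in balance with respect to the rates `a`. -/
def IsNull (a : ι → ι → ℝ) (d : ι → ℝ) : Prop := ∀ j, ∑ i, (d i * a i j - d j * a j i) = 0

/-- The rates `a` connect two states if and only if these are in the same class. -/
structure HasClasses (a : ι → ι → ℝ) (c : ι → κ) : Prop where
  nonneg : ∀ i j, 0 ≤ a i j
  pos : ∀ i j, i ≠ j → c i = c j → 0 < a i j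
  zero : ∀ i j, c i ≠ c j → a i j = 0

variable {a : ι → ι → ℝ} {c : ι → κ} {d w : ι → ℝ}

theorem IsNull.sum_eq_zero (hw : IsNull a w) (g : ι → ℝ) :
    ∑ i, w i * ∑ j, a i j * (g j - g i) = 0 := by
  have h1 : ∑ i, w i * ∑ j, a i j * (g j - g i) =
      ∑ i, ∑ j, w i * a i j * g j - ∑ i, ∑ j, w i * a i j * g i := by
    rw [← Finset.sum_sub_distrib]
    refine Finset.sum_congr rfl fun i _ => ?_
    rw [← Finset.sum_sub_distrib, Finset.mul_sum]
    refine Finset.sum_congr rfl fun j _ => ?_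
    ring
  rw [h1, Finset.sum_comm, ← Finset.sum_sub_distrib]
  refine Finset.sum_eq_zero fun j _ => ?_
  rw [← Finset.sum_sub_distrib]
  have := hw j
  calc ∑ i, (w i * a i j * g j - w j * a j i * g j)
      = (∑ i, (w i * a i j - w j * a j i)) * g j := by
        rw [Finset.sum_mul]
        exact Finset.sum_congr rfl fun i _ => by ring
    _ = 0 := by rw [this, zero_mul]

/-- The Dirichlet form of a chain that need not be reversible: invariance applied to `g ^ 2`
supplies the symmetrization that detailed balance would give. -/
theorem IsNull.sum_mul_eq (hw : IsNull a w) (g : ι → ℝ) :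
    ∑ i, w i * (g i * ∑ j, a i j * (g j - g i)) =
      -(1 / 2) * ∑ i, ∑ j, w i * a i j * (g j - g i) ^ 2 := by
  have h := hw.sum_eq_zero fun i => g i ^ 2
  have h2 : ∑ i, w i * (g i * ∑ j, a i j * (g j - g i)) =
      (1 / 2) * ∑ i, w i * ∑ j, a i j * (g j ^ 2 - g i ^ 2) +
      -(1 / 2) * ∑ i, ∑ j, w i * a i j * (g j - g i) ^ 2 := by
    rw [Finset.mul_sum, Finset.mul_sum, ← Finset.sum_add_distrib]
    refine Finset.sum_congr rfl fun i _ => ?_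
    simp only [Finset.mul_sum]
    rw [← Finset.sum_add_distrib]
    refine Finset.sum_congr rfl fun j _ => ?_
    ring
  rw [h2, h]
  ring

/-- Summing the balance over `P` leaves the flow across the boundary of `P`, since the flow inside
`P` is antisymmetric. -/
theorem IsNull.cut (hd : IsNull a d) (P : Finset ι) :
    ∑ j ∈ P, ∑ i ∈ Pᶜ, (d i * a i j - d j * a j i) = 0 := by
  have h1 : ∑ j ∈ P, ∑ i, (d i * a i j - d j * a j i) = 0 :=
    Finset.sum_eq_zero fun j _ => hd j
  have h2 : ∑ j ∈ P, ∑ i ∈ P, (d i * a i j - d j * a j i) = 0 := by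
    simp only [Finset.sum_sub_distrib]
    rw [Finset.sum_comm, sub_self]
  have h3 : ∑ j ∈ P, ∑ i, (d i * a i j - d j * a j i) =
      ∑ j ∈ P, ∑ i ∈ P, (d i * a i j - d j * a j i) +
      ∑ j ∈ P, ∑ i ∈ Pᶜ, (d i * a i j - d j * a j i) := by
    rw [← Finset.sum_add_distrib]
    exact Finset.sum_congr rfl fun j _ => (Finset.sum_add_sum_compl P _).symm
  linarith

/-- A positive entry forces a negative one in the same class, the class sum being zero. Across the
cut around the positive entries of this class every term of the net inflow is then nonpositive, and
the term joining the two chosen states is strictly negative, which contradicts the balance across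
the cut. -/
theorem IsNull.nonpos (hd : IsNull a d) (ha : HasClasses a c)
    (hs : ∀ k, ∑ i with c i = k, d i = 0) (i₀ : ι) : d i₀ ≤ 0 := by
  by_contra! h0
  obtain ⟨i₁, hi₁, hneg⟩ : ∃ i ∈ Finset.univ.filter (fun i => c i = c i₀), d i < 0 := by
    by_contra! hcon
    have := (Finset.sum_eq_zero_iff_of_nonneg hcon).1 (hs (c i₀)) i₀ (by simp)
    linarith
  simp only [Finset.mem_filter, Finset.mem_univ, true_and] at hi₁
  set P : Finset ι := Finset.univ.filter fun i => c i = c i₀ ∧ 0 < d i with hP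
  have hcut := hd.cut P
  have hterm : ∀ j ∈ P, ∀ i ∈ Pᶜ, d i * a i j - d j * a j i ≤ 0 := by
    intro j hj i hi
    simp only [hP, Finset.mem_filter, Finset.mem_univ, true_and, Finset.mem_compl, not_and,
      not_lt] at hj hi
    by_cases hc : c i = c i₀
    · have h1 := mul_nonneg (neg_nonneg.2 (hi hc)) (ha.nonneg i j)
      have h2 := mul_nonneg hj.2.le (ha.nonneg j i)
      linarith
    · have hij : c i ≠ c j := by rw [hj.1]; exact hc
      rw [ha.zero i j hij, ha.zero j i hij.symm]
      simp
  have hlt : ∑ j ∈ P, ∑ i ∈ Pᶜ, (d i * a i j - d j * a j i) < 0 := by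
    refine Finset.sum_neg' (fun j hj => Finset.sum_nonpos (hterm j hj)) ⟨i₀, by simp [hP, h0], ?_⟩
    have hi₀ : i₀ ∈ P := by simp [hP, h0]
    refine Finset.sum_neg' (hterm i₀ hi₀) ⟨i₁, by simp [hP, hi₁, hneg.le], ?_⟩
    have hne : i₀ ≠ i₁ := by rintro rfl; linarith
    have h1 := mul_pos (neg_pos.2 hneg) (ha.pos i₁ i₀ hne.symm hi₁)
    have h2 := mul_pos h0 (ha.pos i₀ i₁ hne hi₁.symm)
    linarith
  linarith

theorem IsNull.eq_zero (hd : IsNull a d) (ha : HasClasses a c)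
    (hs : ∀ k, ∑ i with c i = k, d i = 0) : d = 0 := by
  have hneg : IsNull a (-d) := by
    intro j
    have := hd j
    rw [← neg_eq_zero, ← Finset.sum_neg_distrib]
    rw [← this]
    exact Finset.sum_congr rfl fun i _ => by simp; ring
  funext i
  have h1 := hd.nonpos ha hs i
  have h2 := hneg.nonpos ha (fun k => by simp [hs k]) i
  simp only [Pi.neg_apply] at h2
  exact le_antisymm h1 (by simpa using h2)

theorem IsNull.add (hd : IsNull a d) (hw : IsNull a w) : IsNull a fun i => d i + w i := by
  intro j
  have h1 := hd j
  have h2 := hw j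
  rw [← add_zero (0 : ℝ)]
  nth_rewrite 1 [← h1]
  rw [← h2, ← Finset.sum_add_distrib]
  exact Finset.sum_congr rfl fun i _ => by ring

theorem IsNull.smul (hd : IsNull a d) (s : ℝ) : IsNull a fun i => s * d i := by
  intro j
  have h1 := hd j
  rw [← mul_zero s, ← h1, Finset.mul_sum]
  exact Finset.sum_congr rfl fun i _ => by ring

/-- Perron–Frobenius by hand: a left null vector of the generator exists because the determinant
vanishes, and its entrywise absolute value is again invariant. -/
theorem exists_isNull (ha : HasClasses a c) (i₀ : ι) :
    ∃ μ : ι → ℝ, (∀ i, 0 ≤ μ i) ∧ ∑ i, μ i = 1 ∧ IsNull a μ ∧ ∀ i, c i ≠ c i₀ → μ i = 0 := by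
  classical
  -- Generator rows inside the class of `i₀`, identity rows outside. The class indicator is a right
  -- null vector, and the identity rows force any left null vector to vanish off the class.
  set M : Matrix ι ι ℝ := fun i j =>
    if c i = c i₀ then a i j - (if i = j then ∑ l, a i l else 0) else if i = j then 1 else 0 with hM
  have hdet : M.det = 0 := by
    rw [← Matrix.exists_mulVec_eq_zero_iff]
    refine ⟨fun i => if c i = c i₀ then 1 else 0, fun h => by simpa using congrFun h i₀, ?_⟩
    funext i
    simp only [Matrix.mulVec, dotProduct, Pi.zero_apply, hM]
    by_cases hi : c i = c i₀
    · simp only [hi, if_true, sub_mul, Finset.sum_sub_distrib, ite_mul, zero_mul,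
        Finset.sum_ite_eq, Finset.mem_univ, mul_one]
      rw [sub_eq_zero]
      refine Finset.sum_congr rfl fun j _ => ?_
      by_cases hj : c j = c i₀
      · simp [hj]
      · simp [hj, ha.zero i j (by rw [hi]; exact fun h => hj h.symm)]
    · simp only [hi, if_false]
      refine Finset.sum_eq_zero fun j _ => ?_
      by_cases hij : i = j
      · simp [← hij, hi]
      · simp [hij]
  obtain ⟨x, hx0, hx⟩ := Matrix.exists_vecMul_eq_zero_iff.2 hdet
  have hx' : ∀ j, ∑ i, x i * M i j = 0 := fun j => by
    simpa [Matrix.vecMul, dotProduct] using congrFun hx j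
  have hout : ∀ j, c j ≠ c i₀ → x j = 0 := by
    intro j hj
    rw [← hx' j]
    rw [Finset.sum_eq_single j]
    · simp [hM, hj]
    · intro i _ hij
      by_cases hi : c i = c i₀
      · simp [hM, hi, hij, ha.zero i j (by rw [hi]; exact fun h => hj h.symm)]
      · simp [hM, hi, hij]
    · simp
  have hnull : ∀ j, x j * ∑ l, a j l = ∑ i, x i * a i j := by
    intro j
    by_cases hj : c j = c i₀
    · have h := hx' j
      have h2 : ∀ i, x i * M i j = x i * a i j - (if i = j then x j * ∑ l, a j l else 0) := by
        intro i
        by_cases hi : c i = c i₀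
        · by_cases hij : i = j
          · subst hij
            simp [hM, hi, mul_sub]
          · simp [hM, hi, hij]
        · have : i ≠ j := by rintro rfl; exact hi hj
          simp [hout i hi, this]
      rw [Finset.sum_congr rfl fun i _ => h2 i, Finset.sum_sub_distrib] at h
      simp at h
      linarith
    · rw [hout j hj, zero_mul]
      symm
      refine Finset.sum_eq_zero fun i _ => ?_
      by_cases hi : c i = c i₀
      · rw [ha.zero i j (by rw [hi]; exact fun h => hj h.symm), mul_zero]
      · rw [hout i hi, zero_mul]
  -- By the triangle inequality `|x|` has nonnegative net inflow at every state. The total net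
  -- inflow is zero, so each of them vanishes.
  have habs : ∀ j, 0 ≤ ∑ i, (|x i| * a i j - |x j| * a j i) := by
    intro j
    rw [Finset.sum_sub_distrib, ← Finset.mul_sum, sub_nonneg]
    have h1 : |x j| * ∑ l, a j l = |∑ i, x i * a i j| := by
      rw [← hnull j, abs_mul, abs_of_nonneg (Finset.sum_nonneg fun l _ => ha.nonneg j l)]
    rw [h1]
    refine (Finset.abs_sum_le_sum_abs _ _).trans (le_of_eq ?_)
    exact Finset.sum_congr rfl fun i _ => by rw [abs_mul, abs_of_nonneg (ha.nonneg i j)]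
  have hnull' : IsNull a fun i => |x i| := by
    have hsum : ∑ j, ∑ i, (|x i| * a i j - |x j| * a j i) = 0 := by
      simp only [Finset.sum_sub_distrib]
      rw [Finset.sum_comm, sub_self]
    intro j
    exact (Finset.sum_eq_zero_iff_of_nonneg fun j _ => habs j).1 hsum j (Finset.mem_univ j)
  have hpos : 0 < ∑ i, |x i| := by
    obtain ⟨i, hi⟩ := Function.ne_iff.1 hx0
    exact Finset.sum_pos' (fun i _ => abs_nonneg _) ⟨i, Finset.mem_univ i, abs_pos.2 hi⟩
  refine ⟨fun i => (∑ i, |x i|)⁻¹ * |x i|, fun i => by positivity, ?_, hnull'.smul _, ?_⟩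
  · rw [← Finset.mul_sum, inv_mul_cancel₀ hpos.ne']
  · intro i hi
    simp [hout i hi]

/-- If `w i` vanished, the inflow to `i` would vanish too, hence the weight of every state connected
to `i`, and so the mass of the class. -/
theorem IsNull.pos (hw : IsNull a w) (ha : HasClasses a c) (h0 : ∀ i, 0 ≤ w i) (i : ι)
    (hs : 0 < ∑ j with c j = c i, w j) : 0 < w i := by
  refine (h0 i).lt_of_ne' fun hi => ?_
  have h1 := hw i
  simp only [hi, zero_mul, sub_zero] at h1
  have h2 := (Finset.sum_eq_zero_iff_of_nonneg fun j _ => mul_nonneg (h0 j) (ha.nonneg j i)).1 h1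
  refine hs.ne' (Finset.sum_eq_zero fun j hj => ?_)
  simp only [Finset.mem_filter, Finset.mem_univ, true_and] at hj
  by_cases hji : j = i
  · rw [hji, hi]
  · have := h2 j (Finset.mem_univ j)
    exact (mul_eq_zero.1 this).resolve_right (ha.pos j i hji hj).ne'

theorem IsNull.sum_class_eq_zero (hw : IsNull a w) (ha : HasClasses a c) (g : ι → ℝ) (k : κ) :
    ∑ i with c i = k, w i * ∑ j, a i j * (g j - g i) = 0 := by
  have := hw.sum_eq_zero fun i => if c i = k then g i else 0
  rw [← this, Finset.sum_filter]
  refine Finset.sum_congr rfl fun i _ => ?_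
  by_cases hi : c i = k
  · simp only [hi, if_true]
    congr 1
    refine Finset.sum_congr rfl fun j _ => ?_
    by_cases hj : c j = k
    · simp [hj]
    · rw [ha.zero i j (by rw [hi]; exact fun h => hj h.symm)]
      simp
  · simp only [hi, if_false]
    symm
    refine mul_eq_zero_of_right _ (Finset.sum_eq_zero fun j _ => ?_)
    by_cases hj : c j = k
    · rw [ha.zero i j (by rw [hj]; exact hi)]
      simp
    · simp [hj]

/-- The Fredholm alternative: the right-hand side has to be orthogonal to `w` on each class, and
this suffices. -/
theorem IsNull.exists_poisson (hw : IsNull a w) (ha : HasClasses a c) (hpos : ∀ i, 0 < w i)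
    {g : ι → ℝ} (hg : ∀ k, ∑ i with c i = k, w i * g i = 0) :
    ∃ χ : ι → ℝ, ∀ i, ∑ j, a i j * (χ j - χ i) = g i := by
  -- Subtracting the class means removes the kernel of the generator, which consists of the
  -- functions constant on classes. The modified operator is injective, hence surjective, and for a
  -- centred right-hand side the subtracted means turn out to be zero.
  let T : (ι → ℝ) →ₗ[ℝ] (ι → ℝ) :=
    { toFun := fun χ i => ∑ j, a i j * (χ j - χ i) - ∑ j with c j = c i, w j * χ j
      map_add' := by
        intro x y
        funext i
        simp only [Pi.add_apply, mul_add, mul_sub, Finset.sum_add_distrib, Finset.sum_sub_distrib]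
        ring
      map_smul' := by
        intro s x
        funext i
        simp only [Pi.smul_apply, smul_eq_mul, RingHom.id_apply, mul_sub, Finset.mul_sum,
          Finset.sum_sub_distrib]
        simp only [mul_left_comm] }
  have hT : ∀ χ i, T χ i = ∑ j, a i j * (χ j - χ i) - ∑ j with c j = c i, w j * χ j :=
    fun _ _ => rfl
  have hmass : ∀ i, 0 < ∑ j with c j = c i, w j := fun i =>
    Finset.sum_pos (fun j _ => hpos j) ⟨i, by simp⟩
  have hmean : ∀ χ, (∀ k, ∑ i with c i = k, w i * T χ i = 0) →
      ∀ i, ∑ j with c j = c i, w j * χ j = 0 := by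
    intro χ h i
    have h1 := h (c i)
    have h2 : ∑ l with c l = c i, w l * T χ l =
        ∑ l with c l = c i, w l * ∑ j, a l j * (χ j - χ l) -
          (∑ l with c l = c i, w l) * ∑ j with c j = c i, w j * χ j := by
      rw [Finset.sum_mul, ← Finset.sum_sub_distrib]
      refine Finset.sum_congr rfl fun l hl => ?_
      simp only [Finset.mem_filter, Finset.mem_univ, true_and] at hl
      rw [hT, hl, mul_sub]
    rw [h2, hw.sum_class_eq_zero ha, zero_sub, neg_eq_zero] at h1
    exact (mul_eq_zero.1 h1).resolve_left (hmass i).ne'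
  have hinj : Function.Injective T := by
    rw [← LinearMap.ker_eq_bot, LinearMap.ker_eq_bot']
    intro χ hχ
    have hm := hmean χ (by simp [hχ])
    have hL : ∀ i, ∑ j, a i j * (χ j - χ i) = 0 := by
      intro i
      have := congrFun hχ i
      rw [hT, hm i] at this
      simpa using this
    have hD := hw.sum_mul_eq χ
    simp only [hL, mul_zero, Finset.sum_const_zero] at hD
    have hD0 : ∑ i, ∑ j, w i * a i j * (χ j - χ i) ^ 2 = 0 := by linarith
    have hterm : ∀ i j, 0 ≤ w i * a i j * (χ j - χ i) ^ 2 := fun i j =>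
      mul_nonneg (mul_nonneg (hpos i).le (ha.nonneg i j)) (sq_nonneg _)
    have hD1 : ∀ i j, w i * a i j * (χ j - χ i) ^ 2 = 0 := by
      intro i j
      have h1 := (Finset.sum_eq_zero_iff_of_nonneg
        fun i _ => Finset.sum_nonneg fun j _ => hterm i j).1 hD0 i (Finset.mem_univ i)
      exact (Finset.sum_eq_zero_iff_of_nonneg fun j _ => hterm i j).1 h1 j (Finset.mem_univ j)
    have heq : ∀ i j, c j = c i → χ j = χ i := by
      intro i j hij
      by_cases h : i = j
      · rw [h]
      · have h1 := hD1 i j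
        have h2 : w i * a i j ≠ 0 := (mul_pos (hpos i) (ha.pos i j h hij.symm)).ne'
        have h3 := (mul_eq_zero.1 h1).resolve_left h2
        have := pow_eq_zero_iff (two_ne_zero) |>.1 h3
        linarith
    funext i
    have h1 := hm i
    rw [Finset.sum_congr rfl (g := fun j => w j * χ i) fun j hj => by
      simp only [Finset.mem_filter, Finset.mem_univ, true_and] at hj
      rw [heq i j hj], ← Finset.sum_mul] at h1
    exact (mul_eq_zero.1 h1).resolve_left (hmass i).ne'
  obtain ⟨χ, hχ⟩ := LinearMap.injective_iff_surjective.1 hinj g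
  refine ⟨χ, fun i => ?_⟩
  have hm := hmean χ (by rw [hχ]; exact hg) i
  have := congrFun hχ i
  rw [hT, hm, sub_zero] at this
  exact this

end Chain

end FastSlow

end

noncomputable section

namespace FastSlow

/-! ### The invariant distributions -/

/-- The hypotheses on the coefficients, with a normalized function `φ` that is continuous up to
the vertex. -/
structure IsModel {n : ℕ} (m : ℕ) (q : Fin n → Fin n → ℝ → ℝ) (v : Fin n → ℝ → ℝ)
    (qbar : Fin n → Fin n → ℝ) (φ : ℝ → ℝ) (a b Q : ℝ) : Prop where
  m_pos : 0 < m
  m_lt : m < n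
  nonneg : ∀ i j, i ≠ j → ∀ z, 0 ≤ q i j z
  cont : ∀ i j, i ≠ j → Continuous (q i j)
  neg : ∀ i j, i ≠ j → ∀ z, z < 0 → 0 < q i j z
  pos : ∀ i j, i ≠ j → ∀ z, 0 ≤ z → (0 < q i j z ↔ cls m i = cls m j)
  qbar_pos : ∀ i j, i ≠ j → 0 < qbar i j
  φ_cont : Continuous φ
  φ_pos : ∀ z, z < 0 → 0 < φ z
  φ_zero : φ 0 = 0
  degen : ∀ i j, i ≠ j → Tendsto (fun z => (q i j z - q i j 0) / φ z) (𝓝[<] 0) (𝓝 (qbar i j))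
  speed : ∀ i, IsSpeed (v i) a b
  v_cont : ∀ i, Continuous (v i)
  Q_pos : 0 < Q
  exit_le : ∀ i z, exitRate q i z ≤ Q

/-- The jump rates, set to zero on the diagonal. -/
def rate {n : ℕ} (q : Fin n → Fin n → ℝ → ℝ) (z : ℝ) (i j : Fin n) : ℝ :=
  if i = j then 0 else q i j z

theorem exitRate_eq {n : ℕ} (q : Fin n → Fin n → ℝ → ℝ) (i : Fin n) (z : ℝ) :
    exitRate q i z = ∑ j, rate q z i j := by
  rw [exitRate, ← Finset.add_sum_erase _ _ (Finset.mem_univ i)]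
  simp only [rate, if_true, zero_add]
  exact Finset.sum_congr rfl fun j hj => by rw [if_neg (Finset.ne_of_mem_erase hj).symm]

theorem isInvariant_iff {n : ℕ} {q : Fin n → Fin n → ℝ → ℝ} {z : ℝ} {μ : Fin n → ℝ} :
    IsInvariant q z μ ↔ (∀ i, 0 ≤ μ i) ∧ ∑ i, μ i = 1 ∧ IsNull (rate q z) μ := by
  unfold IsInvariant IsNull
  refine and_congr_right fun _ => and_congr_right fun _ => forall_congr' fun j => ?_
  have h : ∑ i ∈ Finset.univ.erase j, μ i * q i j z = ∑ i, μ i * rate q z i j := by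
    rw [← Finset.add_sum_erase _ _ (Finset.mem_univ j)]
    simp only [rate, if_true, mul_zero, zero_add]
    exact Finset.sum_congr rfl fun i hi => by rw [if_neg (Finset.ne_of_mem_erase hi)]
  rw [h, exitRate_eq, Finset.sum_sub_distrib, ← Finset.mul_sum, sub_eq_zero]

/-- Compactness of the simplex: identifying all limit points proves convergence. -/
theorem tendsto_of_unique_limit {n : ℕ} {l : Filter ℝ} {f : ℝ → Fin n → ℝ} {y : Fin n → ℝ}
    (hf : ∀ᶠ z in l, (∀ i, 0 ≤ f z i) ∧ ∑ i, f z i = 1)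
    (h : ∀ U : Ultrafilter ℝ, ↑U ≤ l → ∀ y', (∀ i, 0 ≤ y' i) → ∑ i, y' i = 1 →
      (∀ i, Tendsto (fun z => f z i) U (𝓝 (y' i))) → y' = y) : Tendsto f l (𝓝 y) := by
  rw [tendsto_iff_ultrafilter]
  intro U hU
  obtain ⟨y', hy', hle⟩ := (isCompact_stdSimplex ℝ (Fin n)).ultrafilter_le_nhds (U.map f) (by
    rw [le_principal_iff]
    exact hU hf)
  have := h U hU y' hy'.1 hy'.2 (fun i => ((continuous_apply i).tendsto y').comp hle)
  rw [← this]
  exact hle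

theorem mem_cls_of_ne {k l : Fin 2} (h : k ≠ l) (j : Fin 2) : j = k ∨ j = l := by
  omega

variable {n m : ℕ} {q : Fin n → Fin n → ℝ → ℝ} {v : Fin n → ℝ → ℝ} {qbar : Fin n → Fin n → ℝ}
  {φ : ℝ → ℝ} {a b Q : ℝ}

theorem sum_univ_eq_sum_R (m : ℕ) (f : Fin n → ℝ) :
    ∑ i, f i = ∑ i ∈ R m 0, f i + ∑ i ∈ R m 1, f i := by
  rw [← Finset.sum_fiberwise Finset.univ (cls m) f, Fin.sum_univ_two]
  rfl

namespace IsModel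

theorem exists_cls (M : IsModel m q v qbar φ a b Q) (k : Fin 2) : ∃ i : Fin n, cls m i = k := by
  have h1 := M.m_pos
  have h2 := M.m_lt
  fin_cases k
  · exact ⟨⟨0, by omega⟩, by simp [cls, h1]⟩
  · exact ⟨⟨m, h2⟩, by simp [cls]⟩

theorem rate_nonneg (M : IsModel m q v qbar φ a b Q) (z : ℝ) (i j : Fin n) :
    0 ≤ rate q z i j := by
  unfold rate
  split_ifs with h
  · exact le_rfl
  · exact M.nonneg i j h z

theorem rate_continuous (M : IsModel m q v qbar φ a b Q) (i j : Fin n) :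
    Continuous fun z => rate q z i j := by
  unfold rate
  split_ifs with h
  · exact continuous_const
  · exact M.cont i j h

theorem exit_continuous (M : IsModel m q v qbar φ a b Q) (i : Fin n) :
    Continuous (exitRate q i) := by
  have : exitRate q i = fun z => ∑ j, rate q z i j := funext fun z => exitRate_eq q i z
  rw [this]
  exact continuous_finsetSum _ fun j _ => M.rate_continuous i j

theorem exit_nonneg (M : IsModel m q v qbar φ a b Q) (i : Fin n) (z : ℝ) : 0 ≤ exitRate q i z := by
  rw [exitRate_eq]
  exact Finset.sum_nonneg fun j _ => M.rate_nonneg z i j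

theorem hasClasses_neg (M : IsModel m q v qbar φ a b Q) {z : ℝ} (hz : z < 0) :
    HasClasses (rate q z) fun _ => () where
  nonneg := M.rate_nonneg z
  pos i j h _ := by rw [rate, if_neg h]; exact M.neg i j h z hz
  zero _ _ h := absurd rfl h

theorem hasClasses_nonneg (M : IsModel m q v qbar φ a b Q) {z : ℝ} (hz : 0 ≤ z) :
    HasClasses (rate q z) (cls m) where
  nonneg := M.rate_nonneg z
  pos i j h hc := by rw [rate, if_neg h]; exact (M.pos i j h z hz).2 hc
  zero i j h := by
    have hij : i ≠ j := by rintro rfl; exact h rfl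
    rw [rate, if_neg hij]
    refine le_antisymm (not_lt.1 fun h' => h ((M.pos i j hij z hz).1 h')) (M.nonneg i j hij z)

theorem invariant_unique_neg (M : IsModel m q v qbar φ a b Q) {z : ℝ} (hz : z < 0)
    {μ ν : Fin n → ℝ} (hμ : IsInvariant q z μ) (hν : IsInvariant q z ν) : μ = ν := by
  rw [isInvariant_iff] at hμ hν
  have h := (hμ.2.2.add (hν.2.2.smul (-1))).eq_zero (M.hasClasses_neg hz) (fun k => by
    simp [Finset.sum_add_distrib, hμ.2.1, hν.2.1])
  funext i
  have := congrFun h i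
  simp at this
  linarith

theorem invariant_unique_nonneg (M : IsModel m q v qbar φ a b Q) {z : ℝ} (hz : 0 ≤ z)
    {μ ν : Fin n → ℝ} (hμ : IsInvariant q z μ) (hν : IsInvariant q z ν)
    (h : ∀ k, ∑ i ∈ R m k, μ i = ∑ i ∈ R m k, ν i) : μ = ν := by
  rw [isInvariant_iff] at hμ hν
  have h := (hμ.2.2.add (hν.2.2.smul (-1))).eq_zero (M.hasClasses_nonneg hz) (fun k => by
    have := h k
    unfold R at this
    simp [Finset.sum_add_distrib, this])
  funext i
  have := congrFun h i
  simp at this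
  linarith

theorem muNeg_invariant (M : IsModel m q v qbar φ a b Q) {z : ℝ} (hz : z < 0) :
    IsInvariant q z (muNeg q z) := by
  refine Classical.epsilon_spec (p := IsInvariant q z) ?_
  obtain ⟨i₀, -⟩ := M.exists_cls 0
  obtain ⟨μ, h1, h2, h3, -⟩ := exists_isNull (M.hasClasses_neg hz) i₀
  exact ⟨μ, isInvariant_iff.2 ⟨h1, h2, h3⟩⟩

theorem exists_invariant_class (M : IsModel m q v qbar φ a b Q) {z : ℝ} (hz : 0 ≤ z) (k : Fin 2) :
    ∃ μ : Fin n → ℝ, IsInvariant q z μ ∧ ∀ l, ∑ i ∈ R m l, μ i = if l = k then 1 else 0 := by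
  obtain ⟨i₀, rfl⟩ := M.exists_cls k
  obtain ⟨μ, h1, h2, h3, h4⟩ := exists_isNull (M.hasClasses_nonneg hz) i₀
  have h0 : ∀ l, l ≠ cls m i₀ → ∑ i ∈ R m l, μ i = 0 := by
    intro l hl
    refine Finset.sum_eq_zero fun i hi => h4 i ?_
    simp only [R, Finset.mem_filter, Finset.mem_univ, true_and] at hi
    rw [hi]
    exact hl
  refine ⟨μ, isInvariant_iff.2 ⟨h1, h2, h3⟩, fun l => ?_⟩
  split_ifs with h
  · rw [sum_univ_eq_sum_R m] at h2
    subst h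
    generalize cls m i₀ = l at *
    fin_cases l
    · simpa [h0 1 (by decide)] using h2
    · simpa [h0 0 (by decide)] using h2
  · exact h0 l h

theorem exists_invariant_of_mass (M : IsModel m q v qbar φ a b Q) {z : ℝ} (hz : 0 ≤ z)
    {p : Fin 2 → ℝ} (hp : ∀ k, 0 ≤ p k) (hs : p 0 + p 1 = 1) :
    ∃ μ : Fin n → ℝ, IsInvariant q z μ ∧ ∀ k, ∑ i ∈ R m k, μ i = p k := by
  obtain ⟨μ, hμ, hμk⟩ := M.exists_invariant_class hz 0
  obtain ⟨ν, hν, hνk⟩ := M.exists_invariant_class hz 1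
  rw [isInvariant_iff] at hμ hν
  refine ⟨fun i => p 0 * μ i + p 1 * ν i, isInvariant_iff.2 ⟨fun i => ?_, ?_, ?_⟩, fun k => ?_⟩
  · exact add_nonneg (mul_nonneg (hp 0) (hμ.1 i)) (mul_nonneg (hp 1) (hν.1 i))
  · rw [Finset.sum_add_distrib, ← Finset.mul_sum, ← Finset.mul_sum, hμ.2.1, hν.2.1]
    simpa using hs
  · exact (hμ.2.2.smul _).add (hν.2.2.smul _)
  · rw [Finset.sum_add_distrib, ← Finset.mul_sum, ← Finset.mul_sum, hμk, hνk]
    fin_cases k <;> simp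

theorem tendsto_rate_div (M : IsModel m q v qbar φ a b Q) {i j : Fin n} (h : cls m i ≠ cls m j) :
    Tendsto (fun z => rate q z i j / φ z) (𝓝[<] 0) (𝓝 (qbar i j)) := by
  have hij : i ≠ j := by rintro rfl; exact h rfl
  have h0 := (M.hasClasses_nonneg le_rfl).zero i j h
  simp only [rate, if_neg hij] at h0 ⊢
  simpa [h0] using M.degen i j hij

/-- The balance of the limiting flows between the two classes. -/
def CrossBalance (m : ℕ) (qbar : Fin n → Fin n → ℝ) (y : Fin n → ℝ) : Prop :=
  ∑ j ∈ R m 0, ∑ i ∈ (R m 0)ᶜ, (y i * qbar i j - y j * qbar j i) = 0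

/-- Any limit point is invariant at `0`, hence a combination of the invariant distributions of the
two classes. The remaining degree of freedom, the split of mass, is determined by the flow between
the classes, which has order `φ z` and can be divided by `φ z` before passing to the limit. -/
theorem exists_limit (M : IsModel m q v qbar φ a b Q) :
    ∃ y : Fin n → ℝ, Tendsto (muNeg q) (𝓝[<] 0) (𝓝 y) ∧ IsInvariant q 0 y ∧ (∀ i, 0 < y i) ∧
      CrossBalance m qbar y := by
  obtain ⟨μ, hμ, hμk⟩ := M.exists_invariant_class le_rfl 0
  obtain ⟨ν, hν, hνk⟩ := M.exists_invariant_class le_rfl 1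
  have hμ' := isInvariant_iff.1 hμ
  have hν' := isInvariant_iff.1 hν
  have hμ0 : ∀ i, cls m i = 1 → μ i = 0 := fun i hi =>
    (Finset.sum_eq_zero_iff_of_nonneg fun i _ => hμ'.1 i).1 (hμk 1) i (by simp [R, hi])
  have hν0 : ∀ i, cls m i = 0 → ν i = 0 := fun i hi =>
    (Finset.sum_eq_zero_iff_of_nonneg fun i _ => hν'.1 i).1 (hνk 0) i (by simp [R, hi])
  have hμpos : ∀ i, cls m i = 0 → 0 < μ i := fun i hi =>
    hμ'.2.2.pos (M.hasClasses_nonneg le_rfl) hμ'.1 i (by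
      have := hμk 0
      rw [hi]
      unfold R at this
      rw [this]
      norm_num)
  have hνpos : ∀ i, cls m i = 1 → 0 < ν i := fun i hi =>
    hν'.2.2.pos (M.hasClasses_nonneg le_rfl) hν'.1 i (by
      have := hνk 1
      rw [hi]
      unfold R at this
      rw [this]
      norm_num)
  -- `f` and `g` are the rescaled flows out of the first and out of the second class, each started
  -- from its own invariant distribution. Masses `s` and `t` balance when `s * f = t * g`, which
  -- gives the weights of `y` below.
  set f := ∑ j ∈ R m 0, ∑ i ∈ (R m 0)ᶜ, μ j * qbar j i with hf
  set g := ∑ j ∈ R m 0, ∑ i ∈ (R m 0)ᶜ, ν i * qbar i j with hg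
  have hne : ∀ {i j : Fin n}, cls m j = 0 → i ∈ (R m 0)ᶜ → i ≠ j ∧ cls m i = 1 := by
    intro i j hj hi
    simp only [R, Finset.mem_compl, Finset.mem_filter, Finset.mem_univ, true_and] at hi
    exact ⟨by rintro rfl; exact hi hj, by omega⟩
  have hmemR : ∀ {i : Fin n} {k}, i ∈ R m k ↔ cls m i = k := by
    intro i k
    simp [R]
  have hmemRc : ∀ {i : Fin n}, i ∈ (R m 0)ᶜ ↔ cls m i = 1 := by
    intro i
    simp only [R, Finset.mem_compl, Finset.mem_filter, Finset.mem_univ, true_and]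
    omega
  obtain ⟨i₀, hi₀⟩ := M.exists_cls 0
  obtain ⟨i₁, hi₁⟩ := M.exists_cls 1
  have hfpos : 0 < f := Finset.sum_pos (fun j hj => Finset.sum_pos (fun i hi =>
    mul_pos (hμpos j (hmemR.1 hj)) (M.qbar_pos j i (hne (hmemR.1 hj) hi).1.symm))
    ⟨i₁, hmemRc.2 hi₁⟩) ⟨i₀, hmemR.2 hi₀⟩
  have hgpos : 0 < g := Finset.sum_pos (fun j hj => Finset.sum_pos (fun i hi =>
    mul_pos (hνpos i (hmemRc.1 hi)) (M.qbar_pos i j (hne (hmemR.1 hj) hi).1))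
    ⟨i₁, hmemRc.2 hi₁⟩) ⟨i₀, hmemR.2 hi₀⟩
  set y : Fin n → ℝ := fun i => g / (f + g) * μ i + f / (f + g) * ν i with hy
  have hflux : ∀ s t : ℝ, ∑ j ∈ R m 0, ∑ i ∈ (R m 0)ᶜ,
      ((s * μ i + t * ν i) * qbar i j - (s * μ j + t * ν j) * qbar j i) = t * g - s * f := by
    intro s t
    rw [hf, hg, Finset.mul_sum, Finset.mul_sum, ← Finset.sum_sub_distrib]
    refine Finset.sum_congr rfl fun j hj => ?_
    rw [Finset.mul_sum, Finset.mul_sum, ← Finset.sum_sub_distrib]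
    refine Finset.sum_congr rfl fun i hi => ?_
    rw [hμ0 i (hmemRc.1 hi), hν0 j (hmemR.1 hj)]
    ring
  have hne0 : f + g ≠ 0 := by positivity
  have hyinv : IsInvariant q 0 y := by
    refine isInvariant_iff.2 ⟨fun i => ?_, ?_, (hμ'.2.2.smul _).add (hν'.2.2.smul _)⟩
    · exact add_nonneg (mul_nonneg (by positivity) (hμ'.1 i))
        (mul_nonneg (by positivity) (hν'.1 i))
    · rw [hy, Finset.sum_add_distrib, ← Finset.mul_sum, ← Finset.mul_sum, hμ'.2.1, hν'.2.1]
      field_simp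
      ring
  refine ⟨y, ?_, hyinv, ?_, ?_⟩
  · refine tendsto_of_unique_limit ?_ ?_
    · filter_upwards [self_mem_nhdsWithin] with z hz
      have := isInvariant_iff.1 (M.muNeg_invariant hz)
      exact ⟨this.1, this.2.1⟩
    · intro U hU y' h0 h1 hlim
      have hU' : ↑U ≤ 𝓝 (0 : ℝ) := hU.trans nhdsWithin_le_nhds
      have hneg : ∀ᶠ z in (U : Filter ℝ), z < 0 := hU self_mem_nhdsWithin
      have hy'null : IsNull (rate q 0) y' := by
        intro j
        have ht : Tendsto (fun z => ∑ i, (muNeg q z i * rate q z i j - muNeg q z j * rate q z j i)) U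
            (𝓝 (∑ i, (y' i * rate q 0 i j - y' j * rate q 0 j i))) :=
          tendsto_finsetSum _ fun i _ =>
            ((hlim i).mul (((M.rate_continuous i j).tendsto 0).mono_left hU')).sub
              ((hlim j).mul (((M.rate_continuous j i).tendsto 0).mono_left hU'))
        refine tendsto_nhds_unique ht (tendsto_const_nhds.congr' ?_)
        filter_upwards [hneg] with z hz
        exact ((isInvariant_iff.1 (M.muNeg_invariant hz)).2.2 j).symm
      -- Only rates between different classes cross this cut, so after division by `φ z` all of them
      -- have finite limits `qbar`.
      have hcross : ∑ j ∈ R m 0, ∑ i ∈ (R m 0)ᶜ, (y' i * qbar i j - y' j * qbar j i) = 0 := by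
        have ht : Tendsto (fun z => ∑ j ∈ R m 0, ∑ i ∈ (R m 0)ᶜ,
            (muNeg q z i * (rate q z i j / φ z) - muNeg q z j * (rate q z j i / φ z))) U
            (𝓝 (∑ j ∈ R m 0, ∑ i ∈ (R m 0)ᶜ, (y' i * qbar i j - y' j * qbar j i))) := by
          refine tendsto_finsetSum _ fun j hj => tendsto_finsetSum _ fun i hi => ?_
          have hc : cls m i ≠ cls m j := by
            rw [hmemR.1 hj, hmemRc.1 hi]
            decide
          exact ((hlim i).mul ((M.tendsto_rate_div hc).mono_left hU)).sub
            ((hlim j).mul ((M.tendsto_rate_div hc.symm).mono_left hU))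
        refine tendsto_nhds_unique ht (tendsto_const_nhds.congr' ?_)
        filter_upwards [hneg] with z hz
        have h := (isInvariant_iff.1 (M.muNeg_invariant hz)).2.2.cut (R m 0)
        rw [← zero_div (φ z), ← h, Finset.sum_div]
        refine Finset.sum_congr rfl fun j _ => ?_
        rw [Finset.sum_div]
        exact Finset.sum_congr rfl fun i _ => by ring
      have hy'inv : IsInvariant q 0 y' := isInvariant_iff.2 ⟨h0, h1, hy'null⟩
      set s := ∑ i ∈ R m 0, y' i with hs
      set t := ∑ i ∈ R m 1, y' i with ht
      have hst : s + t = 1 := by rw [← h1, sum_univ_eq_sum_R m]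
      have hs0 : 0 ≤ s := Finset.sum_nonneg fun i _ => h0 i
      have ht0 : 0 ≤ t := Finset.sum_nonneg fun i _ => h0 i
      have heq : y' = fun i => s * μ i + t * ν i := by
        refine M.invariant_unique_nonneg le_rfl hy'inv
          (isInvariant_iff.2 ⟨fun i => ?_, ?_, (hμ'.2.2.smul _).add (hν'.2.2.smul _)⟩) fun k => ?_
        · exact add_nonneg (mul_nonneg hs0 (hμ'.1 i)) (mul_nonneg ht0 (hν'.1 i))
        · rw [Finset.sum_add_distrib, ← Finset.mul_sum, ← Finset.mul_sum, hμ'.2.1, hν'.2.1]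
          simpa using hst
        · rw [Finset.sum_add_distrib, ← Finset.mul_sum, ← Finset.mul_sum, hμk, hνk]
          fin_cases k <;> simp [hs, ht]
      rw [heq, hflux] at hcross
      have hs' : s = g / (f + g) := by
        rw [eq_div_iff hne0]
        have : t = 1 - s := by linarith
        rw [this] at hcross
        linarith
      have ht' : t = f / (f + g) := by
        have : t = 1 - s := by linarith
        rw [this, hs']
        field_simp
        ring
      rw [heq, hy, hs', ht']
  · intro i
    have h2 : 0 < f / (f + g) := by positivity
    have h3 : 0 < g / (f + g) := by positivity
    rcases mem_cls_of_ne (show (0 : Fin 2) ≠ 1 by decide) (cls m i) with h | h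
    · exact add_pos_of_pos_of_nonneg (mul_pos h3 (hμpos i h)) (mul_nonneg h2.le (hν'.1 i))
    · exact add_pos_of_nonneg_of_pos (mul_nonneg h3.le (hμ'.1 i)) (mul_pos h2 (hνpos i h))
  · rw [CrossBalance, hy, hflux]
    field_simp
    ring

theorem tendsto_muNeg (M : IsModel m q v qbar φ a b Q) :
    Tendsto (muNeg q) (𝓝[<] 0) (𝓝 (piLim q)) ∧ IsInvariant q 0 (piLim q) ∧ (∀ i, 0 < piLim q i) ∧
      CrossBalance m qbar (piLim q) := by
  obtain ⟨y, hy, h⟩ := M.exists_limit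
  have : piLim q = y := by
    funext i
    exact (((continuous_apply i).tendsto y).comp hy).limUnder_eq
  rw [this]
  exact ⟨hy, h⟩

theorem pi_pos (M : IsModel m q v qbar φ a b Q) (i : Fin n) : 0 < piLim q i := M.tendsto_muNeg.2.2.1 i

theorem pi_sum (M : IsModel m q v qbar φ a b Q) : ∑ i, piLim q i = 1 := M.tendsto_muNeg.2.1.2.1

theorem pi_null (M : IsModel m q v qbar φ a b Q) : IsNull (rate q 0) (piLim q) :=
  (isInvariant_iff.1 M.tendsto_muNeg.2.1).2.2

theorem piBar_pos (M : IsModel m q v qbar φ a b Q) (k : Fin 2) : 0 < piBar m q k := by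
  obtain ⟨i, hi⟩ := M.exists_cls k
  exact Finset.sum_pos (fun i _ => M.pi_pos i) ⟨i, by simp [R, hi]⟩

theorem piBar_sum (M : IsModel m q v qbar φ a b Q) : piBar m q 0 + piBar m q 1 = 1 := by
  rw [← M.pi_sum, sum_univ_eq_sum_R m]
  rfl

theorem mu_spec_nonneg (M : IsModel m q v qbar φ a b Q) {z : ℝ} (hz : 0 ≤ z) :
    IsInvariant q z (mu m q z) ∧ ∀ k, ∑ i ∈ R m k, mu m q z i = piBar m q k := by
  have h := M.exists_invariant_of_mass hz (fun k => (M.piBar_pos k).le) M.piBar_sum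
  have := Classical.epsilon_spec h
  unfold mu
  rw [if_neg (not_lt.2 hz)]
  exact this

theorem mu_invariant (M : IsModel m q v qbar φ a b Q) (z : ℝ) : IsInvariant q z (mu m q z) := by
  rcases lt_or_ge z 0 with hz | hz
  · unfold mu
    rw [if_pos hz]
    exact M.muNeg_invariant hz
  · exact (M.mu_spec_nonneg hz).1

theorem mu_unique (M : IsModel m q v qbar φ a b Q) (z : ℝ) (μ : Fin n → ℝ)
    (hμ : IsInvariant q z μ) (hm : 0 ≤ z → ∀ k, ∑ i ∈ R m k, μ i = piBar m q k) :
    μ = mu m q z := by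
  rcases lt_or_ge z 0 with hz | hz
  · exact M.invariant_unique_neg hz hμ (M.mu_invariant z)
  · exact M.invariant_unique_nonneg hz hμ (M.mu_invariant z) fun k => by
      rw [hm hz k, (M.mu_spec_nonneg hz).2 k]

theorem mu_zero (M : IsModel m q v qbar φ a b Q) : mu m q 0 = piLim q :=
  (M.mu_unique 0 _ M.tendsto_muNeg.2.1 fun _ _ => rfl).symm

theorem tendsto_mu_left (M : IsModel m q v qbar φ a b Q) :
    Tendsto (mu m q) (𝓝[<] 0) (𝓝 (piLim q)) := by
  refine M.tendsto_muNeg.1.congr' ?_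
  filter_upwards [self_mem_nhdsWithin] with z hz
  unfold mu
  rw [if_pos (mem_Iio.1 hz)]

/-- Limit points are invariant by continuity of the rates, and on the side `z ≥ 0` the prescribed
class masses also pass to the limit; uniqueness then applies. Approaching `0` from the left is
excluded here, since there the class masses are not fixed: that case is the convergence to `π`. -/
theorem tendsto_mu (M : IsModel m q v qbar φ a b Q) {z : ℝ} {l : Filter ℝ} (hl : l ≤ 𝓝 z)
    (h : (z < 0 ∧ ∀ᶠ w in l, w < 0) ∨ (0 ≤ z ∧ ∀ᶠ w in l, 0 ≤ w)) :
    Tendsto (mu m q) l (𝓝 (mu m q z)) := by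
  refine tendsto_of_unique_limit (Eventually.of_forall fun w => ?_) ?_
  · have := isInvariant_iff.1 (M.mu_invariant w)
    exact ⟨this.1, this.2.1⟩
  · intro U hU y h0 h1 hlim
    refine M.mu_unique z y (isInvariant_iff.2 ⟨h0, h1, fun j => ?_⟩) fun hz k => ?_
    · have ht : Tendsto (fun w => ∑ i, (mu m q w i * rate q w i j - mu m q w j * rate q w j i)) U
          (𝓝 (∑ i, (y i * rate q z i j - y j * rate q z j i))) :=
        tendsto_finsetSum _ fun i _ =>
          ((hlim i).mul (((M.rate_continuous i j).tendsto z).mono_left (hU.trans hl))).sub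
            ((hlim j).mul (((M.rate_continuous j i).tendsto z).mono_left (hU.trans hl)))
      refine tendsto_nhds_unique ht (tendsto_const_nhds.congr fun w => ?_)
      exact ((isInvariant_iff.1 (M.mu_invariant w)).2.2 j).symm
    · have h' : ∀ᶠ w in l, 0 ≤ w := by
        rcases h with h | h
        · exact absurd hz (not_le.2 h.1)
        · exact h.2
      have ht : Tendsto (fun w => ∑ i ∈ R m k, mu m q w i) U (𝓝 (∑ i ∈ R m k, y i)) :=
        tendsto_finsetSum _ fun i _ => hlim i
      refine tendsto_nhds_unique ht (tendsto_const_nhds.congr' ?_)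
      filter_upwards [hU h'] with w hw
      exact ((M.mu_spec_nonneg hw).2 k).symm

theorem mu_continuous (M : IsModel m q v qbar φ a b Q) : Continuous (mu m q) := by
  rw [continuous_iff_continuousAt]
  intro z
  rcases lt_trichotomy z 0 with hz | rfl | hz
  · exact M.tendsto_mu le_rfl (Or.inl ⟨hz, eventually_lt_nhds hz⟩)
  · rw [continuousAt_iff_continuous_left'_right']
    refine ⟨?_, ?_⟩
    · rw [ContinuousWithinAt, M.mu_zero]
      exact M.tendsto_mu_left
    · refine M.tendsto_mu nhdsWithin_le_nhds (Or.inr ⟨le_rfl, ?_⟩)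
      filter_upwards [self_mem_nhdsWithin] with w hw
      exact (mem_Ioi.1 hw).le
  · exact M.tendsto_mu le_rfl (Or.inr ⟨hz.le, (eventually_gt_nhds hz).mono fun w hw => hw.le⟩)

theorem mu_pos (M : IsModel m q v qbar φ a b Q) (z : ℝ) (i : Fin n) : 0 < mu m q z i := by
  have h := isInvariant_iff.1 (M.mu_invariant z)
  rcases lt_or_ge z 0 with hz | hz
  · exact h.2.2.pos (M.hasClasses_neg hz) h.1 i (by simp [h.2.1])
  · refine h.2.2.pos (M.hasClasses_nonneg hz) h.1 i ?_
    have := (M.mu_spec_nonneg hz).2 (cls m i)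
    unfold R at this
    rw [this]
    exact M.piBar_pos _

/-! ### The averaged speeds -/

theorem avgSpeed_of_neg (k : Fin 2) {z : ℝ} (hz : z < 0) :
    avgSpeed m q v k z = ∑ i, v i z * mu m q z i := by
  rw [avgSpeed, if_pos hz]

theorem avgSpeed_of_nonneg (k : Fin 2) {z : ℝ} (hz : 0 ≤ z) :
    avgSpeed m q v k z = (piBar m q k)⁻¹ * ∑ i ∈ R m k, v i z * mu m q z i := by
  rw [avgSpeed, if_neg (not_lt.2 hz)]

theorem mu_apply_continuous (M : IsModel m q v qbar φ a b Q) (i : Fin n) :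
    Continuous fun z => mu m q z i := (continuous_apply i).comp M.mu_continuous

theorem continuous_avg_neg (M : IsModel m q v qbar φ a b Q) :
    Continuous fun z => ∑ i, v i z * mu m q z i :=
  continuous_finsetSum _ fun i _ => (M.v_cont i).mul (M.mu_apply_continuous i)

theorem continuous_avg_nonneg (M : IsModel m q v qbar φ a b Q) (k : Fin 2) :
    Continuous fun z => (piBar m q k)⁻¹ * ∑ i ∈ R m k, v i z * mu m q z i :=
  continuous_const.mul
    (continuous_finsetSum _ fun i _ => (M.v_cont i).mul (M.mu_apply_continuous i))

/-- Averages of the `v i` inherit the bounds. At the vertex only right-continuity is available: the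
left limit averages over both classes, the value at `0` over one. -/
theorem avgSpeed_isSpeed (M : IsModel m q v qbar φ a b Q) (k : Fin 2) :
    IsSpeed (avgSpeed m q v k) a b := by
  have hpos : 0 < a := by
    obtain ⟨i, -⟩ := M.exists_cls 0
    exact (M.speed i).pos
  have hbound : ∀ z, a ≤ avgSpeed m q v k z ∧ avgSpeed m q v k z ≤ b := by
    intro z
    have hmu := fun i => (M.mu_pos z i).le
    rcases lt_or_ge z 0 with hz | hz
    · rw [avgSpeed_of_neg k hz]
      have h1 := (M.mu_invariant z).2.1
      constructor
      · calc a = ∑ i, a * mu m q z i := by rw [← Finset.mul_sum, h1, mul_one]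
          _ ≤ _ := Finset.sum_le_sum fun i _ =>
            mul_le_mul_of_nonneg_right ((M.speed i).lower z) (hmu i)
      · calc _ ≤ ∑ i, b * mu m q z i := Finset.sum_le_sum fun i _ =>
              mul_le_mul_of_nonneg_right ((M.speed i).upper z) (hmu i)
          _ = b := by rw [← Finset.mul_sum, h1, mul_one]
    · rw [avgSpeed_of_nonneg k hz]
      have h1 := (M.mu_spec_nonneg hz).2 k
      have hp := M.piBar_pos k
      constructor
      · rw [le_inv_mul_iff₀ hp]
        calc piBar m q k * a = ∑ i ∈ R m k, a * mu m q z i := by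
              rw [← Finset.mul_sum, h1, mul_comm]
          _ ≤ _ := Finset.sum_le_sum fun i _ =>
            mul_le_mul_of_nonneg_right ((M.speed i).lower z) (hmu i)
      · rw [inv_mul_le_iff₀ hp]
        calc _ ≤ ∑ i ∈ R m k, b * mu m q z i := Finset.sum_le_sum fun i _ =>
              mul_le_mul_of_nonneg_right ((M.speed i).upper z) (hmu i)
          _ = piBar m q k * b := by rw [← Finset.mul_sum, h1, mul_comm]
  refine ⟨hpos, fun z => (hbound z).1, fun z => (hbound z).2, ?_, fun z => ?_⟩
  · unfold avgSpeed
    exact Measurable.ite measurableSet_Iio M.continuous_avg_neg.measurable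
      (M.continuous_avg_nonneg k).measurable
  · rcases lt_or_ge z 0 with hz | hz
    · refine (M.continuous_avg_neg.continuousAt.congr ?_).continuousWithinAt
      filter_upwards [eventually_lt_nhds hz] with w hw
      rw [avgSpeed_of_neg k hw]
    · refine (M.continuous_avg_nonneg k).continuousWithinAt.congr (fun w hw => ?_) ?_
      · exact avgSpeed_of_nonneg k (hz.trans hw)
      · exact avgSpeed_of_nonneg k hz

end IsModel

end FastSlow

end

noncomputable section

namespace FastSlow

/-! ### Measurability in the path space -/

/-- The Borel sets are generated by the subbasic sets of the compact-open topology, and each of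
these is a countable combination of conditions on the values at single times. -/
theorem measurable_path {Ω : Type*} [MeasurableSpace Ω] {g : Ω → PathSpace}
    (hg : ∀ t, Measurable fun ω => g ω t) : Measurable g := by
  have hb : borel PathSpace =
      MeasurableSpace.generateFrom
        (image2 (fun K U => {f : PathSpace | MapsTo f K U}) {K | IsCompact K} {U | IsOpen U}) :=
    borel_eq_generateFrom_of_subbasis ContinuousMap.compactOpen_eq
  have hb' : Measurable[_, borel PathSpace] g ↔ Measurable g := Iff.rfl
  rw [← hb', hb]
  refine measurable_generateFrom ?_
  rintro _ ⟨K, hK, U, hU, rfl⟩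
  replace hK : IsCompact K := hK
  replace hU : IsOpen U := hU
  obtain ⟨D, hDK, hDc, hDd⟩ := TopologicalSpace.IsSeparable.exists_countable_dense_subset
    (TopologicalSpace.IsSeparable.of_separableSpace K)
  rcases (Uᶜ : Set S).eq_empty_or_nonempty with hne | hne
  · have : U = univ := by simpa using hne
    simp [this]
  -- A continuous image of the compact `K` inside the open `U` keeps a positive distance from the
  -- complement, and this can be tested on a countable dense subset of `K`. The case of an empty
  -- complement was split off because `Metric.infDist` to the empty set is zero.
  have key : g ⁻¹' {f | MapsTo f K U} =
      ⋃ N : ℕ, ⋂ t ∈ D, {ω | 1 / ((N : ℝ) + 1) ≤ Metric.infDist (g ω t) Uᶜ} := by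
    ext ω
    simp only [mem_preimage, mem_ofPred_eq, mem_iUnion, mem_iInter]
    have hcont : Continuous fun t => Metric.infDist (g ω t) Uᶜ :=
      (Metric.continuous_infDist_pt _).comp (g ω).continuous
    constructor
    · intro h
      rcases K.eq_empty_or_nonempty with hKe | hKn
      · exact ⟨0, fun t ht => absurd (hDK ht) (by simp [hKe])⟩
      · obtain ⟨t₀, ht₀, hmin⟩ := hK.exists_isMinOn hKn hcont.continuousOn
        have hpos : 0 < Metric.infDist (g ω t₀) Uᶜ :=
          (hU.isClosed_compl.notMem_iff_infDist_pos hne).1 (by simpa using h ht₀)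
        obtain ⟨N, hN⟩ := exists_nat_one_div_lt hpos
        exact ⟨N, fun t ht => hN.le.trans (hmin (hDK ht))⟩
    · rintro ⟨N, hN⟩ t ht
      have hcl : t ∈ closure D := hDd ht
      have hle : 1 / ((N : ℝ) + 1) ≤ Metric.infDist (g ω t) Uᶜ :=
        closure_minimal (s := D) (t := {t | 1 / ((N : ℝ) + 1) ≤ Metric.infDist (g ω t) Uᶜ})
          hN (isClosed_le continuous_const hcont) hcl
      have hpos : 0 < Metric.infDist (g ω t) Uᶜ := lt_of_lt_of_le (by positivity) hle
      simpa using (hU.isClosed_compl.notMem_iff_infDist_pos hne).2 hpos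
  rw [key]
  refine MeasurableSet.iUnion fun N => MeasurableSet.biInter hDc fun t _ => ?_
  exact measurableSet_le measurable_const
    ((Metric.continuous_infDist_pt _).measurable.comp (hg t))

theorem aemeasurable_toPath {Ω : Type*} [MeasurableSpace Ω] {P : Measure Ω} {f : Ω → ℝ≥0 → S}
    (hf : ∀ t, Measurable fun ω => f ω t) (hc : ∀ᵐ ω ∂P, Continuous (f ω)) :
    AEMeasurable (fun ω => toPath (f ω)) P := by
  classical
  obtain ⟨N, hsub, hN, hN0⟩ := exists_measurable_superset_of_null (ae_iff.1 hc)
  refine ⟨fun ω => if ω ∈ N then ContinuousMap.const _ O else toPath (f ω),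
    measurable_path fun t => ?_, ?_⟩
  · have : (fun ω => (if ω ∈ N then ContinuousMap.const _ O else toPath (f ω)) t) =
        fun ω => if ω ∈ N then O else f ω t := by
      funext ω
      split_ifs with h
      · rfl
      · have hcω : Continuous (f ω) := by
          by_contra h'
          exact h (hsub h')
        simp [toPath, hcω]
    rw [this]
    exact Measurable.ite hN measurable_const (hf t)
  · have : ∀ᵐ ω ∂P, ω ∉ N := measure_eq_zero_iff_ae_notMem.1 hN0
    filter_upwards [this] with ω hω
    rw [if_neg hω]

/-! ### Holding times and jump targets -/

/-- The jump rate out of `i`, integrated over the slow variable. -/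
def exitInt {n : ℕ} (q : Fin n → Fin n → ℝ → ℝ) (v : Fin n → ℝ → ℝ) (i : Fin n) (z : ℝ) : ℝ :=
  ∫ y in (0 : ℝ)..z, exitRate q i y / v i y

variable {n m : ℕ} {q : Fin n → Fin n → ℝ → ℝ} {v : Fin n → ℝ → ℝ} {qbar : Fin n → Fin n → ℝ}
  {φ : ℝ → ℝ} {a b Q : ℝ}

namespace IsModel

theorem a_pos (M : IsModel m q v qbar φ a b Q) : 0 < a := by
  obtain ⟨i, -⟩ := M.exists_cls 0
  exact (M.speed i).pos

theorem b_pos (M : IsModel m q v qbar φ a b Q) : 0 < b := by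
  obtain ⟨i, -⟩ := M.exists_cls 0
  exact (M.speed i).upper_pos

theorem continuous_exit_div (M : IsModel m q v qbar φ a b Q) (i : Fin n) :
    Continuous fun y => exitRate q i y / v i y :=
  (M.exit_continuous i).div (M.v_cont i) fun y => ((M.speed i).speed_pos y).ne'

theorem hasDerivAt_exitInt (M : IsModel m q v qbar φ a b Q) (i : Fin n) (z : ℝ) :
    HasDerivAt (exitInt q v i) (exitRate q i z / v i z) z :=
  ((M.continuous_exit_div i).integral_hasStrictDerivAt 0 z).hasDerivAt

theorem exitInt_continuous (M : IsModel m q v qbar φ a b Q) (i : Fin n) :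
    Continuous (exitInt q v i) :=
  continuous_iff_continuousAt.2 fun z => (M.hasDerivAt_exitInt i z).continuousAt

theorem exitInt_mono (M : IsModel m q v qbar φ a b Q) (i : Fin n) : Monotone (exitInt q v i) :=
  monotone_of_hasDerivAt_nonneg (fun z => M.hasDerivAt_exitInt i z)
    fun z => div_nonneg (M.exit_nonneg i z) ((M.speed i).speed_pos z).le

/-- The change of variables from time to place, which is behind the use of the slow variable as a
clock throughout. -/
theorem integral_exitRate_motion (M : IsModel m q v qbar φ a b Q) (i : Fin n) (z : ℝ) {t : ℝ}
    (ht : 0 ≤ t) : ∫ s in (0 : ℝ)..t, exitRate q i (motion (v i) z s) =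
      exitInt q v i (motion (v i) z t) - exitInt q v i z := by
  have hmot := (M.speed i).motion_isMotion z
  have hc : ContinuousOn (motion (v i) z) (uIcc 0 t) := hmot.2.1.mono fun s hs => by
    rw [uIcc_of_le ht] at hs
    exact hs.1
  have h := intervalIntegral.integral_eq_sub_of_hasDeriv_right
    (f := fun s => exitInt q v i (motion (v i) z s))
    (f' := fun s => exitRate q i (motion (v i) z s)) (a := 0) (b := t)
    ((M.exitInt_continuous i).comp_continuousOn hc) ?_ ?_
  · rw [h, (M.speed i).motion_zero]
  · intro s hs
    rw [min_eq_left ht, max_eq_right ht] at hs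
    have := (M.speed i).hasDerivWithinAt_comp_isMotion hmot hs.1.le
      (M.hasDerivAt_exitInt i (motion (v i) z s)).hasDerivWithinAt
    rw [div_mul_cancel₀ _ ((M.speed i).speed_pos _).ne'] at this
    exact this.mono Ioi_subset_Ici_self
  · exact ((M.exit_continuous i).comp_continuousOn hc).intervalIntegrable

/-- The integrated rate is continuous and nondecreasing in time. If it is below the level at `t`, it
stays below on a right neighbourhood of `t`, so the infimum is strictly larger than `t`. -/
theorem holdTime_le_iff (M : IsModel m q v qbar φ a b Q) {ε : ℝ} (hε : 0 < ε) (i : Fin n)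
    (z e : ℝ) (t : ℝ≥0) : holdTime q v ε i z e ≤ t ↔
      e ≤ ε⁻¹ * (exitInt q v i (motion (v i) z t) - exitInt q v i z) := by
  have hinv := inv_pos.2 hε
  unfold holdTime
  simp only [M.integral_exitRate_motion i z (NNReal.coe_nonneg _)]
  constructor
  · intro h
    by_contra! hlt
    have hcont : Continuous fun s : ℝ≥0 =>
        ε⁻¹ * (exitInt q v i (motion (v i) z s) - exitInt q v i z) :=
      continuous_const.mul (((M.exitInt_continuous i).comp
        ((M.speed i).continuous_motion.comp (by fun_prop : Continuous fun s : ℝ≥0 => (z, s)))).sub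
          continuous_const)
    obtain ⟨s, hts, hs⟩ : ∃ s > t, ∀ r ∈ Ico t s,
        ε⁻¹ * (exitInt q v i (motion (v i) z r) - exitInt q v i z) < e := by
      have h1 : {s : ℝ≥0 | ε⁻¹ * (exitInt q v i (motion (v i) z s) - exitInt q v i z) < e}
          ∈ 𝓝[≥] t := mem_nhdsWithin_of_mem_nhds (hcont.continuousAt.eventually_lt_const hlt)
      obtain ⟨s, hs, hsub⟩ := (mem_nhdsGE_iff_exists_Ico_subset' (lt_add_one t)).1 h1
      exact ⟨s, hs, fun r hr => hsub hr⟩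
    have hge : (s : ℝ≥0∞) ≤ ⨅ (t : ℝ≥0)
        (_ : e ≤ ε⁻¹ * (exitInt q v i (motion (v i) z t) - exitInt q v i z)), (t : ℝ≥0∞) := by
      refine le_iInf₂ fun r hr => ?_
      rw [ENNReal.coe_le_coe]
      by_contra! hrs
      rcases le_total t r with htr | hrt
      · exact absurd (hs r ⟨htr, hrs⟩) (not_lt.2 hr)
      · have h2 := M.exitInt_mono i ((M.speed i).motion_mono z r.2 (NNReal.coe_le_coe.2 hrt))
        have h3 := mul_le_mul_of_nonneg_left (sub_le_sub_right h2 (exitInt q v i z)) hinv.le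
        exact absurd (hr.trans h3) (not_le.2 hlt)
    exact absurd (hge.trans h) (not_le.2 (ENNReal.coe_lt_coe.2 hts))
  · intro h
    exact iInf₂_le t h

theorem exitInt_sub_le (M : IsModel m q v qbar φ a b Q) (i : Fin n) (z : ℝ) (t : ℝ≥0) :
    exitInt q v i (motion (v i) z t) - exitInt q v i z ≤ Q * t := by
  rw [← M.integral_exitRate_motion i z (NNReal.coe_nonneg t)]
  have hmot := (M.speed i).motion_isMotion z
  have hc : ContinuousOn (motion (v i) z) (uIcc 0 (t : ℝ)) := hmot.2.1.mono fun s hs => by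
    rw [uIcc_of_le (NNReal.coe_nonneg t)] at hs
    exact hs.1
  have := intervalIntegral.integral_mono_on (μ := volume) (NNReal.coe_nonneg t)
    ((M.exit_continuous i).comp_continuousOn hc).intervalIntegrable
    (intervalIntegrable_const (c := Q)) fun s _ => M.exit_le i _
  simpa [mul_comm] using this

theorem le_holdTime (M : IsModel m q v qbar φ a b Q) {ε : ℝ} (hε : 0 < ε) (i : Fin n) (z e : ℝ) :
    ENNReal.ofReal (ε / Q * e) ≤ holdTime q v ε i z e := by
  refine ENNReal.le_of_forall_nnreal_lt fun r hr => ?_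
  by_contra! hcon
  have h := (M.holdTime_le_iff hε i z e r).1 hcon.le
  have h1 := M.exitInt_sub_le i z r
  have h2 : e ≤ ε⁻¹ * (Q * r) := h.trans (mul_le_mul_of_nonneg_left h1 (inv_pos.2 hε).le)
  have h3 : ε / Q * e ≤ r := by
    have := mul_le_mul_of_nonneg_left h2 (div_pos hε M.Q_pos).le
    have hQ := M.Q_pos.ne'
    have e1 : ε / Q * (ε⁻¹ * (Q * r)) = r := by field_simp
    rwa [e1] at this
  have h4 : ENNReal.ofReal (ε / Q * e) ≤ r := by
    rw [← ENNReal.ofReal_coe_nnreal]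
    exact ENNReal.ofReal_le_ofReal h3
  exact absurd hr (not_lt.2 h4)

theorem holdTime_measurable (M : IsModel m q v qbar φ a b Q) {ε : ℝ} (hε : 0 < ε) :
    Measurable fun x : Fin n × ℝ × ℝ => holdTime q v ε x.1 x.2.1 x.2.2 := by
  refine measurable_from_prod_countable_right fun i => measurable_of_Iic fun t => ?_
  induction t with
  | top => simp
  | coe t =>
    have : (fun y : ℝ × ℝ => holdTime q v ε i y.1 y.2) ⁻¹' Iic (t : ℝ≥0∞) =
        {y | y.2 ≤ ε⁻¹ * (exitInt q v i (motion (v i) y.1 t) - exitInt q v i y.1)} := by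
      ext y
      exact M.holdTime_le_iff hε i y.1 y.2 t
    have hc : Continuous fun y : ℝ × ℝ => motion (v i) y.1 t :=
      (M.speed i).continuous_motion.comp (by fun_prop : Continuous fun y : ℝ × ℝ => (y.1, t))
    change MeasurableSet ((fun y : ℝ × ℝ => holdTime q v ε i y.1 y.2) ⁻¹' Iic (t : ℝ≥0∞))
    rw [this]
    exact measurableSet_le measurable_snd (continuous_const.mul
      (((M.exitInt_continuous i).comp hc).sub
        ((M.exitInt_continuous i).comp continuous_fst))).measurable

theorem motion_toReal_measurable (M : IsModel m q v qbar φ a b Q) :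
    Measurable fun x : Fin n × ℝ × ℝ≥0∞ => motion (v x.1) x.2.1 x.2.2.toReal := by
  refine measurable_from_prod_countable_right fun i => ?_
  exact (M.speed i).continuous_motion.measurable.comp
    (measurable_fst.prodMk measurable_snd.ennreal_toNNReal)

end IsModel

/-- The condition under which the process jumps from `(i, z)` to `j`. -/
def JumpsTo (q : Fin n → Fin n → ℝ → ℝ) (i : Fin n) (z u : ℝ) (j : Fin n) : Prop :=
  j ≠ i ∧ ∑ k ∈ (Finset.univ.erase i).filter (· < j), q i k z ≤ u * exitRate q i z ∧
      u * exitRate q i z < ∑ k ∈ (Finset.univ.erase i).filter (· ≤ j), q i k z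

theorem sum_filter_le_eq (q : Fin n → Fin n → ℝ → ℝ) {i j : Fin n} (h : j ≠ i) (z : ℝ) :
    ∑ k ∈ (Finset.univ.erase i).filter (· ≤ j), q i k z =
      ∑ k ∈ (Finset.univ.erase i).filter (· < j), q i k z + q i j z := by
  have : (Finset.univ.erase i).filter (· ≤ j) =
      insert j ((Finset.univ.erase i).filter (· < j)) := by
    ext k
    simp only [Finset.mem_filter, Finset.mem_erase, Finset.mem_univ, and_true, Finset.mem_insert]
    constructor
    · rintro ⟨h1, h2⟩
      rcases h2.lt_or_eq with h3 | h3
      · exact Or.inr ⟨h1, h3⟩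
      · exact Or.inl h3
    · rintro (rfl | h1)
      · exact ⟨h, le_rfl⟩
      · exact ⟨h1.1, h1.2.le⟩
  rw [this, Finset.sum_insert (by simp), add_comm]

namespace IsModel

theorem JumpsTo.unique (M : IsModel m q v qbar φ a b Q) {i j l : Fin n} {z u : ℝ}
    (hj : JumpsTo q i z u j) (hl : JumpsTo q i z u l) : j = l := by
  have key : ∀ {j l : Fin n}, JumpsTo q i z u j → JumpsTo q i z u l → ¬ j < l := by
    intro j l hj hl hlt
    have : ∑ k ∈ (Finset.univ.erase i).filter (· ≤ j), q i k z ≤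
        ∑ k ∈ (Finset.univ.erase i).filter (· < l), q i k z := by
      refine Finset.sum_le_sum_of_subset_of_nonneg ?_ ?_
      · intro k hk
        simp only [Finset.mem_filter] at hk ⊢
        exact ⟨hk.1, hk.2.trans_lt hlt⟩
      · intro k hk _
        simp only [Finset.mem_filter, Finset.mem_erase] at hk
        exact M.nonneg i k hk.1.1.symm z
    linarith [hj.2.2, hl.2.1]
  rcases lt_trichotomy j l with h | h | h
  · exact absurd h (key hj hl)
  · exact h
  · exact absurd h (key hl hj)

theorem jumpTarget_eq_iff (M : IsModel m q v qbar φ a b Q) {i j : Fin n} (hij : j ≠ i)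
    (z u : ℝ) : jumpTarget q i z u = j ↔ JumpsTo q i z u j := by
  unfold jumpTarget
  split_ifs with h
  · constructor
    · intro he
      rw [← he]
      exact h.choose_spec
    · intro hj
      exact JumpsTo.unique M h.choose_spec hj
  · constructor
    · intro he
      exact absurd he.symm hij
    · intro hj
      exact absurd ⟨j, hj⟩ h

/-- A target other than `i` is selected from a half-open interval whose length is the rate of that
jump, so the rate is positive; the default value `i` is harmless. No null set of the noise has to be
excluded. -/
theorem jumpTarget_cls (M : IsModel m q v qbar φ a b Q) (i : Fin n) {z : ℝ} (hz : 0 ≤ z)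
    (u : ℝ) : cls m (jumpTarget q i z u) = cls m i := by
  by_cases hij : jumpTarget q i z u = i
  · rw [hij]
  · have h := (M.jumpTarget_eq_iff hij z u).1 rfl
    have h2 := h.2.2
    rw [sum_filter_le_eq q h.1 z] at h2
    exact ((M.pos i _ (Ne.symm hij) z hz).1 (by linarith [h.2.1])).symm

theorem jumpsTo_measurableSet (M : IsModel m q v qbar φ a b Q) (i j : Fin n) :
    MeasurableSet {y : ℝ × ℝ | JumpsTo q i y.1 y.2 j} := by
  unfold JumpsTo
  by_cases hij : j = i
  · simp [hij]
  · simp only [ne_eq, hij, not_false_eq_true, true_and]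
    have hmeas : ∀ s : Finset (Fin n), s ⊆ Finset.univ.erase i →
        Measurable fun y : ℝ × ℝ => ∑ k ∈ s, q i k y.1 := by
      intro s hs
      refine Finset.measurable_fun_sum _ fun k hk => ?_
      exact (M.cont i k (Finset.ne_of_mem_erase (hs hk)).symm).measurable.comp measurable_fst
    have hu : Measurable fun y : ℝ × ℝ => y.2 * exitRate q i y.1 :=
      measurable_snd.mul ((M.exit_continuous i).measurable.comp measurable_fst)
    exact (measurableSet_le (hmeas _ (Finset.filter_subset _ _)) hu).inter
      (measurableSet_lt hu (hmeas _ (Finset.filter_subset _ _)))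

theorem jumpTarget_measurable (M : IsModel m q v qbar φ a b Q) :
    Measurable fun x : Fin n × ℝ × ℝ => jumpTarget q x.1 x.2.1 x.2.2 := by
  refine measurable_from_prod_countable_right fun i => ?_
  have hne : ∀ j, j ≠ i →
      MeasurableSet ((fun y : ℝ × ℝ => jumpTarget q i y.1 y.2) ⁻¹' {j}) := by
    intro j hj
    convert M.jumpsTo_measurableSet i j using 1
    ext y
    exact M.jumpTarget_eq_iff hj y.1 y.2
  refine measurable_to_countable' fun j => ?_
  by_cases hj : j = i
  -- The value `i` is only the default of the inversion formula, so its preimage is taken as the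
  -- complement of the others.
  · have : (fun y : ℝ × ℝ => jumpTarget q i y.1 y.2) ⁻¹' {j} =
        (⋃ l ∈ {l : Fin n | l ≠ i}, (fun y : ℝ × ℝ => jumpTarget q i y.1 y.2) ⁻¹' {l})ᶜ := by
      ext y
      simp only [hj, mem_preimage, mem_singleton_iff, mem_ofPred_eq, mem_compl_iff, mem_iUnion,
        exists_prop, not_exists, not_and]
      exact ⟨fun h l hl h' => hl (h'.symm.trans h), fun h => by_contra fun h' => h _ h' rfl⟩
    change MeasurableSet ((fun y : ℝ × ℝ => jumpTarget q i y.1 y.2) ⁻¹' {j})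
    rw [this]
    exact (MeasurableSet.biUnion (to_countable _) fun l hl => hne l hl).compl
  · exact hne j hj

/-! ### The jump chain -/

end IsModel

/-- One step of the jump chain. -/
def step (q : Fin n → Fin n → ℝ → ℝ) (v : Fin n → ℝ → ℝ) (ε : ℝ)
    (s : ℝ≥0∞ × Fin n × ℝ) (p : ℝ × ℝ) : ℝ≥0∞ × Fin n × ℝ :=
  (s.1 + holdTime q v ε s.2.1 s.2.2 p.1,
    jumpTarget q s.2.1 (motion (v s.2.1) s.2.2 (holdTime q v ε s.2.1 s.2.2 p.1).toReal) p.2,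
    motion (v s.2.1) s.2.2 (holdTime q v ε s.2.1 s.2.2 p.1).toReal)

theorem jumpState_succ (ε : ℝ) (x : Fin n × ℝ) (ω : Noise) (k : ℕ) :
    jumpState q v ε x ω (k + 1) = step q v ε (jumpState q v ε x ω k) (ω k) := rfl

theorem jumpState_zero (ε : ℝ) (x : Fin n × ℝ) (ω : Noise) :
    jumpState q v ε x ω 0 = (0, x.1, x.2) := rfl

/-- The `k`-th state uses only the noise with index below `k`; this makes it independent of `ω k`.
-/
theorem jumpState_congr (ε : ℝ) (x : Fin n × ℝ) {ω ω' : Noise} (k : ℕ)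
    (h : ∀ i < k, ω i = ω' i) : jumpState q v ε x ω k = jumpState q v ε x ω' k := by
  induction k with
  | zero => rfl
  | succ k ih =>
    rw [jumpState_succ, jumpState_succ, ih fun i hi => h i (by omega), h k (by omega)]

namespace IsModel

theorem step_measurable (M : IsModel m q v qbar φ a b Q) {ε : ℝ} (hε : 0 < ε) :
    Measurable fun y : (ℝ≥0∞ × Fin n × ℝ) × ℝ × ℝ => step q v ε y.1 y.2 := by
  have hh : Measurable fun y : (ℝ≥0∞ × Fin n × ℝ) × ℝ × ℝ =>
      holdTime q v ε y.1.2.1 y.1.2.2 y.2.1 :=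
    (M.holdTime_measurable hε).comp (by fun_prop : Measurable
      fun y : (ℝ≥0∞ × Fin n × ℝ) × ℝ × ℝ => (y.1.2.1, y.1.2.2, y.2.1))
  have hz : Measurable fun y : (ℝ≥0∞ × Fin n × ℝ) × ℝ × ℝ =>
      motion (v y.1.2.1) y.1.2.2 (holdTime q v ε y.1.2.1 y.1.2.2 y.2.1).toReal :=
    M.motion_toReal_measurable.comp ((by fun_prop : Measurable
      fun y : (ℝ≥0∞ × Fin n × ℝ) × ℝ × ℝ => y.1.2.1).prodMk
        ((by fun_prop : Measurable fun y : (ℝ≥0∞ × Fin n × ℝ) × ℝ × ℝ => y.1.2.2).prodMk hh))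
  refine Measurable.prodMk ((by fun_prop : Measurable
    fun y : (ℝ≥0∞ × Fin n × ℝ) × ℝ × ℝ => y.1.1).add hh) (Measurable.prodMk ?_ hz)
  exact M.jumpTarget_measurable.comp ((by fun_prop : Measurable
      fun y : (ℝ≥0∞ × Fin n × ℝ) × ℝ × ℝ => y.1.2.1).prodMk
        (hz.prodMk (by fun_prop : Measurable fun y : (ℝ≥0∞ × Fin n × ℝ) × ℝ × ℝ => y.2.2)))

theorem jumpState_measurable (M : IsModel m q v qbar φ a b Q) {ε : ℝ} (hε : 0 < ε)
    (x : Fin n × ℝ) (k : ℕ) : Measurable fun ω => jumpState q v ε x ω k := by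
  induction k with
  | zero => exact measurable_const
  | succ k ih =>
    simp only [jumpState_succ]
    exact (M.step_measurable hε).comp (ih.prodMk (measurable_pi_apply k))

end IsModel

end FastSlow

end

noncomputable section

namespace FastSlow

/-! ### The noise -/

/-- The law of the pair of variables used for one jump. -/
def pairLaw : Measure (ℝ × ℝ) := (expMeasure 1).prod ((volume : Measure ℝ).restrict (Icc 0 1))

instance : IsProbabilityMeasure pairLaw := by unfold pairLaw; infer_instance

instance : IsProbabilityMeasure noiseMeasure := by unfold noiseMeasure; infer_instance

theorem noiseMeasure_eq : noiseMeasure = Measure.infinitePi fun _ => pairLaw := rfl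

theorem noise_map_eval (k : ℕ) : noiseMeasure.map (fun ω => ω k) = pairLaw :=
  (measurePreserving_eval_infinitePi (fun _ : ℕ => pairLaw) k).map_eq

theorem noise_iIndepFun : iIndepFun (fun k (ω : Noise) => ω k) noiseMeasure := by
  rw [noiseMeasure_eq]
  exact iIndepFun_infinitePi (P := fun _ : ℕ => pairLaw) (X := fun _ => id) fun _ => measurable_id

theorem expMeasure_Iic {x : ℝ} (hx : 0 ≤ x) :
    expMeasure 1 (Iic x) = ENNReal.ofReal (1 - Real.exp (-x)) := by
  have h := cdf_expMeasure_eq one_pos x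
  rw [if_pos hx, one_mul, cdf_eq_real] at h
  rw [← h, ofReal_measureReal]

theorem expMeasure_Ioi {x : ℝ} (hx : 0 ≤ x) :
    expMeasure 1 (Ioi x) = ENNReal.ofReal (Real.exp (-x)) := by
  rw [← compl_Iic, prob_compl_eq_one_sub measurableSet_Iic, expMeasure_Iic hx,
    ← ENNReal.ofReal_one, ← ENNReal.ofReal_sub _ (by simp [hx]), sub_sub_cancel]

theorem pairLaw_fst (A : Set ℝ) :
    pairLaw (Prod.fst ⁻¹' A) = expMeasure 1 A := by
  have : Prod.fst ⁻¹' A = A ×ˢ (univ : Set ℝ) := by ext; simp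
  rw [this, pairLaw, Measure.prod_prod]
  simp

/-- The noise has positive exponential variables with a divergent sum. -/
structure GoodNoise (ω : Noise) : Prop where
  pos : ∀ k, 0 < (ω k).1
  div : Tendsto (fun k => ∑ i ∈ Finset.range k, (ω i).1) atTop atTop

/-- By the second Borel–Cantelli lemma infinitely many exponential variables exceed one, so their
sum diverges. -/
theorem ae_goodNoise : ∀ᵐ ω ∂noiseMeasure, GoodNoise ω := by
  have hpos : ∀ᵐ ω ∂noiseMeasure, ∀ k, 0 < (ω k).1 := by
    rw [ae_all_iff]
    intro k
    have hp : ∀ᵐ p ∂pairLaw, 0 < p.1 := by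
      rw [ae_iff]
      have : {p : ℝ × ℝ | ¬ 0 < p.1} = Prod.fst ⁻¹' Iic (0 : ℝ) := by ext; simp
      rw [this, pairLaw_fst, expMeasure_Iic le_rfl]
      simp
    rw [← noise_map_eval k] at hp
    exact ae_of_ae_map (measurable_pi_apply k).aemeasurable hp
  have hfreq : ∀ᵐ ω ∂noiseMeasure, ∃ᶠ k in atTop, 1 < (ω k).1 := by
    set s : ℕ → Set Noise := fun k => {ω | 1 < (ω k).1} with hs
    have hsm : ∀ k, MeasurableSet (s k) := fun k =>
      measurableSet_lt measurable_const (measurable_fst.comp (measurable_pi_apply k))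
    have hsp : ∀ k, s k = (fun ω : Noise => ω k) ⁻¹' (Prod.fst ⁻¹' Ioi (1 : ℝ)) := fun k => rfl
    have hA : MeasurableSet ((Prod.fst : ℝ × ℝ → ℝ) ⁻¹' Ioi (1 : ℝ)) :=
      measurable_fst measurableSet_Ioi
    have hprob : ∀ k, noiseMeasure (s k) = ENNReal.ofReal (Real.exp (-1)) := fun k => by
      rw [hsp, ← Measure.map_apply (measurable_pi_apply k) hA, noise_map_eval,
        pairLaw_fst, expMeasure_Ioi zero_le_one]
    have h := measure_limsup_eq_one hsm ((iIndepSet_iff_meas_biInter hsm).2 fun S => by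
      simp only [hsp]
      exact noise_iIndepFun.measure_inter_preimage_eq_mul S fun k _ => hA) (by
        simp only [hprob]
        exact ENNReal.tsum_const_eq_top_of_ne_zero
          (by simpa using Real.exp_pos _))
    have hm : MeasurableSet (limsup s atTop) := MeasurableSet.measurableSet_limsup hsm
    have h2 : ∀ᵐ ω ∂noiseMeasure, ω ∈ limsup s atTop := by
      rw [← mem_ae_iff_prob_eq_one hm] at h
      exact h
    filter_upwards [h2] with ω hω
    exact mem_limsup_iff_frequently_mem.1 hω
  filter_upwards [hpos, hfreq] with ω h1 h2
  refine ⟨h1, ?_⟩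
  rw [← not_summable_iff_tendsto_nat_atTop_of_nonneg fun k => (h1 k).le]
  intro hsum
  have := hsum.tendsto_atTop_zero.eventually_lt_const zero_lt_one
  exact h2 (this.mono fun k hk => not_lt.2 hk.le)

/-! ### Trajectories -/

variable {n m : ℕ} {q : Fin n → Fin n → ℝ → ℝ} {v : Fin n → ℝ → ℝ} {qbar : Fin n → Fin n → ℝ}
  {φ : ℝ → ℝ} {a b Q ε : ℝ} {x : Fin n × ℝ} {ω : Noise}

/-- The passage from the state `s` (time, fast and slow variable) to the state `s'` respects the
bounds on the speed, and the class does not change in the half-line `z ≥ 0`. -/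
structure Adv (m : ℕ) (a b : ℝ) (s s' : ℝ × Fin n × ℝ) : Prop where
  lower : a * (s'.1 - s.1) ≤ s'.2.2 - s.2.2
  upper : s'.2.2 - s.2.2 ≤ b * (s'.1 - s.1)
  mono : s.2.2 ≤ s'.2.2
  cls_eq : 0 ≤ s.2.2 → cls m s'.2.1 = cls m s.2.1

theorem Adv.trans {s s' s'' : ℝ × Fin n × ℝ} (h : Adv m a b s s') (h' : Adv m a b s' s'') :
    Adv m a b s s'' :=
  ⟨by linarith [h.lower, h'.lower], by linarith [h.upper, h'.upper], h.mono.trans h'.mono,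
    fun h0 => (h'.cls_eq (h0.trans h.mono)).trans (h.cls_eq h0)⟩

theorem Adv.refl (s : ℝ × Fin n × ℝ) : Adv m a b s s := ⟨by simp, by simp, le_rfl, fun _ => rfl⟩

/-- The `k`-th jump as a triple of time, fast and slow variable. -/
def jumpPoint (q : Fin n → Fin n → ℝ → ℝ) (v : Fin n → ℝ → ℝ) (ε : ℝ) (x : Fin n × ℝ) (ω : Noise)
    (k : ℕ) : ℝ × Fin n × ℝ :=
  ((jumpState q v ε x ω k).1.toReal, (jumpState q v ε x ω k).2)

/-- The state at time `t` of the motion started at the triple `s`. -/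
def flowPoint (v : Fin n → ℝ → ℝ) (s : ℝ × Fin n × ℝ) (t : ℝ) : ℝ × Fin n × ℝ :=
  (t, s.2.1, motion (v s.2.1) s.2.2 (t - s.1))

/-- The time `t` lies between the `k`-th and the next jump. -/
def InSojourn (q : Fin n → Fin n → ℝ → ℝ) (v : Fin n → ℝ → ℝ) (ε : ℝ) (x : Fin n × ℝ) (ω : Noise)
    (k : ℕ) (t : ℝ≥0) : Prop :=
  (jumpState q v ε x ω k).1 ≤ t ∧ (t : ℝ≥0∞) < (jumpState q v ε x ω (k + 1)).1

theorem jumpTime_mono : Monotone fun k => (jumpState q v ε x ω k).1 :=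
  monotone_nat_of_le_succ fun k => by
    rw [jumpState_succ]
    exact le_self_add

theorem InSojourn.unique {k l : ℕ} {t : ℝ≥0} (hk : InSojourn q v ε x ω k t)
    (hl : InSojourn q v ε x ω l t) : k = l := by
  have key : ∀ {k l : ℕ}, InSojourn q v ε x ω k t → InSojourn q v ε x ω l t → ¬ k < l := by
    intro k l hk hl hkl
    exact absurd (hk.2.trans_le ((jumpTime_mono (Nat.succ_le_of_lt hkl)).trans hl.1))
      (lt_irrefl _)
  rcases lt_trichotomy k l with h | h | h
  · exact absurd h (key hk hl)
  · exact h
  · exact absurd h (key hl hk)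

theorem InSojourn.le {k l : ℕ} {s t : ℝ≥0} (hst : s ≤ t) (hk : InSojourn q v ε x ω k s)
    (hl : InSojourn q v ε x ω l t) : k ≤ l := by
  by_contra! hlk
  have h1 := hl.2.trans_le ((jumpTime_mono (Nat.succ_le_of_lt hlk)).trans hk.1)
  exact absurd (ENNReal.coe_lt_coe.1 h1) (not_lt.2 hst)

theorem InSojourn.toReal_le {k : ℕ} {t : ℝ≥0} (hk : InSojourn q v ε x ω k t) :
    (jumpState q v ε x ω k).1.toReal ≤ t := by
  have := ENNReal.toReal_mono ENNReal.coe_ne_top hk.1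
  simpa using this

theorem X_eq {k : ℕ} {t : ℝ≥0} (hk : InSojourn q v ε x ω k t) :
    X q v ε x ω t = (flowPoint v (jumpPoint q v ε x ω k) t).2 := by
  have h : ∃ k, (jumpState q v ε x ω k).1 ≤ t ∧
      (t : ℝ≥0∞) < (jumpState q v ε x ω (k + 1)).1 := ⟨k, hk⟩
  unfold X
  rw [dif_pos h]
  have : h.choose = k := InSojourn.unique (q := q) (v := v) h.choose_spec hk
  rw [this]
  rfl

theorem jumpTime_succ_ne_top {k : ℕ} (h : (jumpState q v ε x ω (k + 1)).1 ≠ ∞) :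
    (jumpState q v ε x ω k).1 ≠ ∞ ∧
      holdTime q v ε (jumpState q v ε x ω k).2.1 (jumpState q v ε x ω k).2.2 (ω k).1 ≠ ∞ := by
  rw [jumpState_succ] at h
  simpa [step] using h

namespace IsModel

theorem adv_flowPoint (M : IsModel m q v qbar φ a b Q) (s : ℝ × Fin n × ℝ) {t t' : ℝ}
    (ht : s.1 ≤ t) (htt' : t ≤ t') : Adv m a b (flowPoint v s t) (flowPoint v s t') := by
  have h1 := (M.speed s.2.1).le_motion_sub s.2.2 (sub_nonneg.2 ht) (sub_le_sub_right htt' s.1)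
  have h2 := (M.speed s.2.1).motion_sub_le s.2.2 (sub_nonneg.2 ht) (sub_le_sub_right htt' s.1)
  refine ⟨?_, ?_, ?_, fun _ => rfl⟩
  · simpa [flowPoint] using h1
  · simpa [flowPoint] using h2
  · exact (M.speed s.2.1).motion_mono s.2.2 (sub_nonneg.2 ht) (sub_le_sub_right htt' s.1)

theorem flowPoint_self (M : IsModel m q v qbar φ a b Q) (s : ℝ × Fin n × ℝ) :
    flowPoint v s s.1 = s := by
  simp [flowPoint, (M.speed s.2.1).motion_zero]

theorem jumpPoint_succ {k : ℕ} (h : (jumpState q v ε x ω (k + 1)).1 ≠ ∞) :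
    (jumpPoint q v ε x ω k).1 ≤ (jumpPoint q v ε x ω (k + 1)).1 ∧
    (jumpPoint q v ε x ω (k + 1)).2.2 =
      (flowPoint v (jumpPoint q v ε x ω k) (jumpPoint q v ε x ω (k + 1)).1).2.2 ∧
    (jumpPoint q v ε x ω (k + 1)).2.1 =
      jumpTarget q (jumpPoint q v ε x ω k).2.1 (jumpPoint q v ε x ω (k + 1)).2.2 (ω k).2 := by
  obtain ⟨h1, h2⟩ := jumpTime_succ_ne_top h
  have h3 : (jumpPoint q v ε x ω (k + 1)).1 = (jumpPoint q v ε x ω k).1 +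
      (holdTime q v ε (jumpState q v ε x ω k).2.1 (jumpState q v ε x ω k).2.2 (ω k).1).toReal := by
    simp only [jumpPoint, jumpState_succ, step]
    exact ENNReal.toReal_add h1 h2
  refine ⟨?_, ?_, ?_⟩
  · rw [h3]
    exact le_add_of_nonneg_right ENNReal.toReal_nonneg
  · rw [h3]
    simp only [flowPoint, add_sub_cancel_left]
    rfl
  · rfl

theorem adv_flow_jump (M : IsModel m q v qbar φ a b Q) {k : ℕ}
    (h : (jumpState q v ε x ω (k + 1)).1 ≠ ∞) {t : ℝ} (ht : (jumpPoint q v ε x ω k).1 ≤ t)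
    (ht' : t ≤ (jumpPoint q v ε x ω (k + 1)).1) :
    Adv m a b (flowPoint v (jumpPoint q v ε x ω k) t) (jumpPoint q v ε x ω (k + 1)) := by
  obtain ⟨-, h2, h3⟩ := jumpPoint_succ h
  have hadv := M.adv_flowPoint (jumpPoint q v ε x ω k) ht ht'
  refine ⟨?_, ?_, ?_, fun h0 => ?_⟩
  · rw [h2]; exact hadv.lower
  · rw [h2]; exact hadv.upper
  · rw [h2]; exact hadv.mono
  · rw [h3]
    exact M.jumpTarget_cls _ (h0.trans (by rw [h2]; exact hadv.mono)) _

theorem adv_jump (M : IsModel m q v qbar φ a b Q) {k l : ℕ} (hkl : k ≤ l)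
    (h : (jumpState q v ε x ω l).1 ≠ ∞) :
    Adv m a b (jumpPoint q v ε x ω k) (jumpPoint q v ε x ω l) := by
  induction l, hkl using Nat.le_induction with
  | base => exact Adv.refl _
  | succ l hkl ih =>
    have h1 := M.adv_flow_jump h le_rfl (jumpPoint_succ h).1
    rw [M.flowPoint_self] at h1
    exact (ih (jumpTime_succ_ne_top h).1).trans h1

/-- Bounded exit rates make each holding time at least `ε / Q` times its exponential variable. With
divergent sums of these variables the jumps cannot accumulate. -/
theorem le_jumpTime (M : IsModel m q v qbar φ a b Q) (hε : 0 < ε) (hω : GoodNoise ω) (k : ℕ) :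
    ENNReal.ofReal (ε / Q * ∑ i ∈ Finset.range k, (ω i).1) ≤ (jumpState q v ε x ω k).1 := by
  induction k with
  | zero => simp
  | succ k ih =>
    rw [Finset.sum_range_succ, mul_add, jumpState_succ]
    have hc : 0 < ε / Q := div_pos hε M.Q_pos
    rw [ENNReal.ofReal_add (mul_nonneg hc.le (Finset.sum_nonneg fun i _ => (hω.pos i).le))
      (mul_nonneg hc.le (hω.pos k).le)]
    exact add_le_add ih (M.le_holdTime hε _ _ _)

theorem exists_lt_jumpTime (M : IsModel m q v qbar φ a b Q) (hε : 0 < ε) (hω : GoodNoise ω)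
    (x : Fin n × ℝ) (t : ℝ≥0) : ∃ k, (t : ℝ≥0∞) < (jumpState q v ε x ω k).1 := by
  have hc : 0 < ε / Q := div_pos hε M.Q_pos
  obtain ⟨k, hk⟩ := ((hω.div.const_mul_atTop hc).eventually_gt_atTop (t : ℝ)).exists
  refine ⟨k, lt_of_lt_of_le ?_ (M.le_jumpTime hε hω k)⟩
  rw [← ENNReal.ofReal_coe_nnreal]
  exact (ENNReal.ofReal_lt_ofReal_iff (lt_of_le_of_lt t.2 hk)).2 hk

theorem exists_inSojourn (M : IsModel m q v qbar φ a b Q) (hε : 0 < ε) (hω : GoodNoise ω)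
    (x : Fin n × ℝ) (t : ℝ≥0) : ∃ k, InSojourn q v ε x ω k t := by
  classical
  have h := M.exists_lt_jumpTime hε hω x t
  have hpos : Nat.find h ≠ 0 := by
    intro h0
    have := Nat.find_spec h
    rw [h0] at this
    simp [jumpState_zero] at this
  obtain ⟨k, hk⟩ := Nat.exists_eq_succ_of_ne_zero hpos
  refine ⟨k, not_lt.1 (Nat.find_min h (by omega)), ?_⟩
  have := Nat.find_spec h
  rwa [hk] at this

theorem adv_X (M : IsModel m q v qbar φ a b Q) (hε : 0 < ε) (hω : GoodNoise ω) (x : Fin n × ℝ)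
    {s t : ℝ≥0} (hst : s ≤ t) :
    Adv m a b ((s : ℝ), X q v ε x ω s) ((t : ℝ), X q v ε x ω t) := by
  obtain ⟨k, hk⟩ := M.exists_inSojourn hε hω x s
  obtain ⟨l, hl⟩ := M.exists_inSojourn hε hω x t
  rw [X_eq hk, X_eq hl]
  change Adv m a b (flowPoint v (jumpPoint q v ε x ω k) s) (flowPoint v (jumpPoint q v ε x ω l) t)
  rcases (InSojourn.le hst hk hl).eq_or_lt with rfl | hlt
  · exact M.adv_flowPoint _ hk.toReal_le (NNReal.coe_le_coe.2 hst)
  · have hltop : (jumpState q v ε x ω l).1 ≠ ∞ := ne_top_of_le_ne_top ENNReal.coe_ne_top hl.1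
    have hk1 : (jumpState q v ε x ω (k + 1)).1 ≠ ∞ :=
      ne_top_of_le_ne_top hltop (jumpTime_mono (Nat.succ_le_of_lt hlt))
    have h1 := M.adv_flow_jump hk1 hk.toReal_le (by
      have := ENNReal.toReal_mono hk1 hk.2.le
      rwa [ENNReal.coe_toReal] at this)
    have h2 := M.adv_jump (Nat.succ_le_of_lt hlt) hltop
    have h3 := M.adv_flowPoint (jumpPoint q v ε x ω l) le_rfl hl.toReal_le
    rw [M.flowPoint_self] at h3
    exact (h1.trans h2).trans h3

theorem X_zero (M : IsModel m q v qbar φ a b Q) (hε : 0 < ε) (hω : GoodNoise ω) (x : Fin n × ℝ) :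
    X q v ε x ω 0 = x := by
  have h : InSojourn q v ε x ω 0 0 := by
    refine ⟨by simp [jumpState_zero], ?_⟩
    refine lt_of_lt_of_le ?_ (M.le_jumpTime hε hω 1)
    simpa using mul_pos (div_pos hε M.Q_pos) (hω.pos 0)
  rw [X_eq h]
  have := M.flowPoint_self (jumpPoint q v ε x ω 0)
  have h0 : (jumpPoint q v ε x ω 0).1 = ((0 : ℝ≥0) : ℝ) := by simp [jumpPoint, jumpState_zero]
  rw [h0] at this
  rw [this]
  rfl

/-- The process reaches the level `y` during the sojourn that begins at the `k`-th jump. -/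
theorem exists_crossing (M : IsModel m q v qbar φ a b Q) (hε : 0 < ε) (hω : GoodNoise ω)
    (x : Fin n × ℝ) {y : ℝ} (hy : x.2 ≤ y) : ∃ k, (jumpState q v ε x ω k).1 ≠ ∞ ∧
      (jumpState q v ε x ω k).2.2 ≤ y ∧
      ε⁻¹ * (exitInt q v (jumpState q v ε x ω k).2.1 y -
        exitInt q v (jumpState q v ε x ω k).2.1 (jumpState q v ε x ω k).2.2) < (ω k).1 := by
  -- Otherwise every sojourn ends by a jump at or below the level `y`. All jump times are then
  -- finite and, the speed being at least `a`, bounded by `(y - x.2) / a`, which contradicts their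
  -- unboundedness.
  by_contra! hcon
  have hall : ∀ k, (jumpState q v ε x ω k).1 ≠ ∞ ∧ (jumpState q v ε x ω k).2.2 ≤ y := by
    intro k
    induction k with
    | zero => exact ⟨by simp [jumpState_zero], hy⟩
    | succ k ih =>
      have he := hcon k ih.1 ih.2
      set i := (jumpState q v ε x ω k).2.1
      set z := (jumpState q v ε x ω k).2.2
      have hspeed := M.speed i
      have h0 : 0 ≤ clock (v i) y - clock (v i) z :=
        sub_nonneg.2 (hspeed.clock_strictMono.monotone ih.2)
      obtain ⟨r, hr⟩ : ∃ r : ℝ≥0, (r : ℝ) = clock (v i) y - clock (v i) z :=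
        ⟨Real.toNNReal _, Real.coe_toNNReal _ h0⟩
      have hle := (M.holdTime_le_iff hε i z (ω k).1 r).2 (by
        rw [hr, hspeed.motion_clock_sub ih.2]
        exact he)
      have htop : holdTime q v ε i z (ω k).1 ≠ ∞ := ne_top_of_le_ne_top ENNReal.coe_ne_top hle
      rw [jumpState_succ]
      refine ⟨ENNReal.add_ne_top.2 ⟨ih.1, htop⟩, ?_⟩
      change motion (v i) z (holdTime q v ε i z (ω k).1).toReal ≤ y
      rw [hspeed.motion_le_iff ENNReal.toReal_nonneg]
      have := ENNReal.toReal_mono ENNReal.coe_ne_top hle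
      rwa [ENNReal.coe_toReal, hr] at this
  have hb : 0 ≤ (y - x.2) / a := div_nonneg (sub_nonneg.2 hy) M.a_pos.le
  obtain ⟨k, hk⟩ := M.exists_lt_jumpTime hε hω x (Real.toNNReal ((y - x.2) / a))
  have hadv := (M.adv_jump (Nat.zero_le k) (hall k).1).lower
  have h1 : (jumpPoint q v ε x ω 0).1 = 0 := by simp [jumpPoint, jumpState_zero]
  have h2 : (jumpPoint q v ε x ω 0).2.2 = x.2 := rfl
  rw [h1, h2, sub_zero] at hadv
  have h3 : a * (jumpPoint q v ε x ω k).1 ≤ y - x.2 :=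
    hadv.trans (sub_le_sub_right (hall k).2 _)
  have h4 : (jumpPoint q v ε x ω k).1 ≤ (y - x.2) / a := by
    rw [le_div_iff₀ M.a_pos, mul_comm]
    exact h3
  have h5 := (ENNReal.toReal_lt_toReal ENNReal.coe_ne_top (hall k).1).2 hk
  rw [ENNReal.coe_toReal, Real.coe_toNNReal _ hb] at h5
  exact absurd h5 (not_lt.2 h4)

theorem X_crossing (M : IsModel m q v qbar φ a b Q) (hε : 0 < ε) {y : ℝ} {k : ℕ}
    (h1 : (jumpState q v ε x ω k).1 ≠ ∞) (h2 : (jumpState q v ε x ω k).2.2 ≤ y)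
    (h3 : ε⁻¹ * (exitInt q v (jumpState q v ε x ω k).2.1 y -
        exitInt q v (jumpState q v ε x ω k).2.1 (jumpState q v ε x ω k).2.2) < (ω k).1) :
    ∃ τ : ℝ≥0, (τ : ℝ) = (jumpState q v ε x ω k).1.toReal +
        (clock (v (jumpState q v ε x ω k).2.1) y -
          clock (v (jumpState q v ε x ω k).2.1) (jumpState q v ε x ω k).2.2) ∧
      X q v ε x ω τ = ((jumpState q v ε x ω k).2.1, y) := by
  have hspeed := M.speed (jumpState q v ε x ω k).2.1
  have h0 := sub_nonneg.2 (hspeed.clock_strictMono.monotone h2)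
  obtain ⟨r, hr⟩ : ∃ r : ℝ≥0, (r : ℝ) = clock (v (jumpState q v ε x ω k).2.1) y -
      clock (v (jumpState q v ε x ω k).2.1) (jumpState q v ε x ω k).2.2 :=
    ⟨Real.toNNReal _, Real.coe_toNNReal _ h0⟩
  have hin : InSojourn q v ε x ω k ((jumpState q v ε x ω k).1.toNNReal + r) := by
    refine ⟨?_, ?_⟩
    · rw [ENNReal.coe_add, ENNReal.coe_toNNReal h1]
      exact le_self_add
    · rw [ENNReal.coe_add, ENNReal.coe_toNNReal h1, jumpState_succ]
      refine ENNReal.add_lt_add_left h1 (lt_of_not_ge fun hle => ?_)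
      have := (M.holdTime_le_iff hε _ _ _ _).1 hle
      rw [hr, hspeed.motion_clock_sub h2] at this
      exact absurd h3 (not_lt.2 this)
  refine ⟨(jumpState q v ε x ω k).1.toNNReal + r, ?_, ?_⟩
  · rw [NNReal.coe_add, hr]
    rfl
  · rw [X_eq hin]
    simp only [flowPoint, jumpPoint, NNReal.coe_add, ENNReal.coe_toNNReal_eq_toReal,
      add_sub_cancel_left, hr]
    rw [hspeed.motion_clock_sub h2]

/-- On each sojourn event the state is a measurable function of the jump chain. These events are
countably many, and off their union the process has its default value `x`. -/
theorem X_measurable (M : IsModel m q v qbar φ a b Q) (hε : 0 < ε) (x : Fin n × ℝ) (t : ℝ≥0) :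
    Measurable fun ω => X q v ε x ω t := by
  have hmeas : ∀ k, MeasurableSet {ω | InSojourn q v ε x ω k t} := fun k =>
    (measurableSet_le (measurable_fst.comp (M.jumpState_measurable hε x k))
      measurable_const).inter
    (measurableSet_lt measurable_const (measurable_fst.comp (M.jumpState_measurable hε x (k + 1))))
  have hY : ∀ k, Measurable fun ω =>
      ((jumpState q v ε x ω k).2.1, motion (v (jumpState q v ε x ω k).2.1)
        (jumpState q v ε x ω k).2.2 (((t : ℝ≥0∞) - (jumpState q v ε x ω k).1).toReal)) := by
    intro k
    have hs := M.jumpState_measurable hε x k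
    refine (measurable_fst.comp (measurable_snd.comp hs)).prodMk ?_
    exact M.motion_toReal_measurable.comp ((measurable_fst.comp (measurable_snd.comp hs)).prodMk
      ((measurable_snd.comp (measurable_snd.comp hs)).prodMk
        (measurable_const.sub (measurable_fst.comp hs))))
  intro A hA
  have : (fun ω => X q v ε x ω t) ⁻¹' A =
      (⋃ k, {ω | InSojourn q v ε x ω k t} ∩ (fun ω =>
      ((jumpState q v ε x ω k).2.1, motion (v (jumpState q v ε x ω k).2.1)
        (jumpState q v ε x ω k).2.2 (((t : ℝ≥0∞) - (jumpState q v ε x ω k).1).toReal))) ⁻¹' A) ∪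
      ((⋃ k, {ω | InSojourn q v ε x ω k t})ᶜ ∩ (fun _ => x) ⁻¹' A) := by
    have hval : ∀ {ω k}, InSojourn q v ε x ω k t → X q v ε x ω t =
        ((jumpState q v ε x ω k).2.1, motion (v (jumpState q v ε x ω k).2.1)
        (jumpState q v ε x ω k).2.2 (((t : ℝ≥0∞) - (jumpState q v ε x ω k).1).toReal)) := by
      intro ω k hk
      rw [X_eq hk, ENNReal.toReal_sub_of_le hk.1 ENNReal.coe_ne_top]
      rfl
    ext ω
    simp only [mem_preimage, mem_union, mem_iUnion, mem_inter_iff, mem_ofPred_eq, mem_compl_iff,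
      not_exists]
    constructor
    · intro h
      by_cases hex : ∃ k, InSojourn q v ε x ω k t
      · obtain ⟨k, hk⟩ := hex
        exact Or.inl ⟨k, hk, by rw [← hval hk]; exact h⟩
      · refine Or.inr ⟨fun k hk => hex ⟨k, hk⟩, ?_⟩
        have hX : X q v ε x ω t = x := dif_neg hex
        rwa [hX] at h
    · rintro (⟨k, hk, h⟩ | ⟨hno, h⟩)
      · rw [hval hk]
        exact h
      · have hX : X q v ε x ω t = x := dif_neg fun ⟨k, hk⟩ => hno k hk
        rwa [hX]
  rw [this]
  exact (MeasurableSet.iUnion fun k => (hmeas k).inter (hY k hA)).union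
    ((MeasurableSet.iUnion hmeas).compl.inter (measurable_const hA))

/-! ### The projected process -/

end IsModel

theorem continuous_branch (k : Fin 2) : Continuous (branch k) := by
  unfold branch
  refine Continuous.subtype_mk (continuous_pi fun l => ?_) _
  split_ifs <;> fun_prop

theorem branch_eq_of_nonpos (k l : Fin 2) {z : ℝ} (hz : z ≤ 0) : branch k z = branch l z := by
  apply Subtype.ext
  funext j
  simp [branch, max_eq_right hz]

namespace IsModel

theorem dist_X_le (M : IsModel m q v qbar φ a b Q) (hε : 0 < ε) (hω : GoodNoise ω)
    (x : Fin n × ℝ) (s t : ℝ≥0) :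
    |(X q v ε x ω s).2 - (X q v ε x ω t).2| ≤ b * |(s : ℝ) - t| := by
  have key : ∀ {s t : ℝ≥0}, s ≤ t →
      |(X q v ε x ω s).2 - (X q v ε x ω t).2| ≤ b * |(s : ℝ) - t| := by
    intro s t hst
    have h := M.adv_X hε hω x hst
    have h1 := h.upper
    have h2 := h.mono
    have hst' : (s : ℝ) ≤ t := NNReal.coe_le_coe.2 hst
    rw [abs_sub_comm, abs_of_nonneg (sub_nonneg.2 h2), abs_sub_comm (s : ℝ),
      abs_of_nonneg (sub_nonneg.2 hst')]
    exact h1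
  rcases le_total s t with hst | hst
  · exact key hst
  · rw [abs_sub_comm, abs_sub_comm (s : ℝ)]
    exact key hst

theorem continuous_X_snd (M : IsModel m q v qbar φ a b Q) (hε : 0 < ε) (hω : GoodNoise ω)
    (x : Fin n × ℝ) : Continuous fun t => (X q v ε x ω t).2 := by
  have : LipschitzWith (Real.toNNReal b) fun t : ℝ≥0 => (X q v ε x ω t).2 := by
    refine LipschitzWith.of_dist_le_mul fun s t => ?_
    rw [Real.dist_eq, NNReal.dist_eq, Real.coe_toNNReal b M.b_pos.le]
    exact M.dist_X_le hε hω x s t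
  exact this.continuous

/-- The trajectory of the projected process, in terms of the class at a time `t₁` at which the
vertex has been passed. -/
theorem h_X_eq (M : IsModel m q v qbar φ a b Q) (hε : 0 < ε) (hω : GoodNoise ω)
    (x : Fin n × ℝ) {t₁ : ℝ≥0} (h₁ : 0 ≤ (X q v ε x ω t₁).2) (t : ℝ≥0) :
    h m (X q v ε x ω t) = branch (cls m (X q v ε x ω t₁).1) (X q v ε x ω t).2 := by
  unfold h
  rcases le_total (X q v ε x ω t).2 0 with h0 | h0
  · exact branch_eq_of_nonpos _ _ h0
  · congr 1
    rcases le_total t t₁ with ht | ht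
    · exact ((M.adv_X hε hω x ht).cls_eq h0).symm
    · exact (M.adv_X hε hω x ht).cls_eq h₁

/-- The speed is at least `a`, so one deterministic time works for all `ε` and all good noises. The
class at this time names the edge along which the trajectory proceeds. -/
theorem exists_X_nonneg (M : IsModel m q v qbar φ a b Q) (x : Fin n × ℝ) :
    ∃ t₁ : ℝ≥0, ∀ {ε : ℝ} {ω : Noise}, 0 < ε → GoodNoise ω → 0 ≤ (X q v ε x ω t₁).2 := by
  refine ⟨Real.toNNReal (|x.2| / a), fun {ε ω} hε hω => ?_⟩
  have h := (M.adv_X hε hω x (zero_le : 0 ≤ Real.toNNReal (|x.2| / a))).lower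
  rw [M.X_zero hε hω] at h
  simp only [NNReal.coe_zero, sub_zero] at h
  rw [Real.coe_toNNReal _ (div_nonneg (abs_nonneg _) M.a_pos.le),
    mul_div_cancel₀ _ M.a_pos.ne'] at h
  linarith [neg_abs_le x.2]

theorem continuous_h_X (M : IsModel m q v qbar φ a b Q) (hε : 0 < ε) (hω : GoodNoise ω)
    (x : Fin n × ℝ) : Continuous fun t => h m (X q v ε x ω t) := by
  obtain ⟨t₁, h₁⟩ := M.exists_X_nonneg x
  have : (fun t => h m (X q v ε x ω t)) =
      fun t => branch (cls m (X q v ε x ω t₁).1) (X q v ε x ω t).2 :=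
    funext fun t => M.h_X_eq hε hω x (h₁ hε hω) t
  rw [this]
  exact (continuous_branch _).comp (M.continuous_X_snd hε hω x)

theorem measurable_h (m : ℕ) : Measurable (h m : Fin n × ℝ → S) :=
  measurable_from_prod_countable_right fun i => (continuous_branch (cls m i)).measurable

theorem aemeasurable_path (M : IsModel m q v qbar φ a b Q) (hε : 0 < ε) (x : Fin n × ℝ) :
    AEMeasurable (fun ω => toPath fun t => h m (X q v ε x ω t)) noiseMeasure :=
  aemeasurable_toPath (fun t => (measurable_h m).comp (M.X_measurable hε x t))
    (ae_goodNoise.mono fun _ hω => M.continuous_h_X hε hω x)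

end IsModel

end FastSlow

end

noncomputable section

namespace FastSlow

variable {n m : ℕ} {q : Fin n → Fin n → ℝ → ℝ} {v : Fin n → ℝ → ℝ} {qbar : Fin n → Fin n → ℝ}
  {φ : ℝ → ℝ} {a b Q ε θ l r : ℝ} {x : Fin n × ℝ} {ω : Noise} {u : Fin n → ℝ → ℝ}

/-! ### Supersolutions of the backward equation -/

/-- The probability of no jump out of `i`, with the discount factor, up to a factor that does not
depend on `z`. -/
def survival (q : Fin n → Fin n → ℝ → ℝ) (v : Fin n → ℝ → ℝ) (ε θ : ℝ) (i : Fin n) (z : ℝ) : ℝ :=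
  Real.exp (-(ε⁻¹ * exitInt q v i z + θ * clock (v i) z))

/-- The rate (in the slow variable) at which value is gained by the jumps out of `i`. -/
def gain (q : Fin n → Fin n → ℝ → ℝ) (v : Fin n → ℝ → ℝ) (ε : ℝ) (u : Fin n → ℝ → ℝ) (i : Fin n)
    (z : ℝ) : ℝ :=
  ε⁻¹ * ((∑ j, rate q z i j * u j z) / v i z)

/-- `u` is a supersolution on `[l, r]`, in integral form, of the backward equation of the process
parametrized by the slow variable, with discount `θ`. -/
structure IsSuper (q : Fin n → Fin n → ℝ → ℝ) (v : Fin n → ℝ → ℝ) (ε θ l r : ℝ)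
    (u : Fin n → ℝ → ℝ) : Prop where
  nonneg : ∀ i z, z ∈ Icc l r → 0 ≤ u i z
  meas : ∀ i, Measurable (u i)
  int : ∀ i, IntervalIntegrable (u i) volume l r
  ineq : ∀ i z w, l ≤ z → z ≤ w → w ≤ r →
    survival q v ε θ i w * u i w + ∫ y in z..w, survival q v ε θ i y * gain q v ε u i y ≤
      survival q v ε θ i z * u i z

theorem survival_pos (ε θ : ℝ) (i : Fin n) (z : ℝ) : 0 < survival q v ε θ i z := Real.exp_pos _

namespace IsModel

theorem survival_continuous (M : IsModel m q v qbar φ a b Q) (ε θ : ℝ) (i : Fin n) :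
    Continuous (survival q v ε θ i) := by
  have h1 := M.exitInt_continuous i
  have h2 := (M.speed i).clock_continuous
  unfold survival
  fun_prop

theorem gain_intervalIntegrable (M : IsModel m q v qbar φ a b Q) {l r : ℝ}
    (hu : ∀ j, IntervalIntegrable (u j) volume l r) (ε θ : ℝ) (i : Fin n) :
    IntervalIntegrable (fun y => survival q v ε θ i y * gain q v ε u i y) volume l r := by
  have : (fun y => survival q v ε θ i y * gain q v ε u i y) =
      fun y => ∑ j, (survival q v ε θ i y * (ε⁻¹ * (rate q y i j / v i y))) * u j y := by
    funext y
    unfold gain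
    rw [Finset.sum_div, Finset.mul_sum, Finset.mul_sum]
    exact Finset.sum_congr rfl fun j _ => by ring
  rw [this]
  have hsum : ∀ j ∈ (Finset.univ : Finset (Fin n)), IntervalIntegrable
      (fun y => (survival q v ε θ i y * (ε⁻¹ * (rate q y i j / v i y))) * u j y) volume l r := ?_
  · rw [← Finset.sum_fn]
    exact IntervalIntegrable.sum Finset.univ hsum
  intro j _
  exact (hu j).continuousOn_mul (((M.survival_continuous ε θ i).mul (continuous_const.mul
    ((M.rate_continuous i j).div (M.v_cont i) fun y =>
      ((M.speed i).speed_pos y).ne'))).continuousOn)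

/-! ### One jump -/

theorem volume_jumpTarget (M : IsModel m q v qbar φ a b Q) {i j : Fin n} (hij : j ≠ i) {z : ℝ}
    (hQ : 0 < exitRate q i z) :
    (volume : Measure ℝ).restrict (Icc 0 1) {t | jumpTarget q i z t = j} =
      ENNReal.ofReal (rate q z i j / exitRate q i z) := by
  set c := ∑ k ∈ (Finset.univ.erase i).filter (· < j), q i k z with hc
  have hc0 : 0 ≤ c := Finset.sum_nonneg fun k hk => by
    simp only [Finset.mem_filter, Finset.mem_erase] at hk
    exact M.nonneg i k hk.1.1.symm z
  have hc1 : c + q i j z ≤ exitRate q i z := by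
    rw [hc, ← sum_filter_le_eq q hij z, exitRate]
    refine Finset.sum_le_sum_of_subset_of_nonneg (Finset.filter_subset _ _) fun k hk _ => ?_
    exact M.nonneg i k (Finset.ne_of_mem_erase hk).symm z
  have hset : {t | jumpTarget q i z t = j} =
      Ico (c / exitRate q i z) ((c + q i j z) / exitRate q i z) := by
    ext t
    simp only [mem_ofPred_eq, mem_Ico]
    rw [M.jumpTarget_eq_iff hij, div_le_iff₀ hQ, lt_div_iff₀ hQ, JumpsTo,
      sum_filter_le_eq q hij z]
    exact ⟨fun h => h.2, fun h => ⟨hij, h⟩⟩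
  rw [hset, Measure.restrict_apply measurableSet_Ico]
  have hsub : Ico (c / exitRate q i z) ((c + q i j z) / exitRate q i z) ⊆ Icc 0 1 := by
    intro t ht
    exact ⟨(div_nonneg hc0 hQ.le).trans ht.1, ht.2.le.trans ((div_le_one hQ).2 hc1)⟩
  rw [inter_eq_left.2 hsub, Real.volume_Ico, rate, if_neg hij.symm]
  congr 1
  ring

/-- Stated with the factor `exitRate`, so that the case of a vanishing exit rate, where the jump law
is meaningless, is included. -/
theorem lintegral_jumpTarget (M : IsModel m q v qbar φ a b Q) (i : Fin n) (z : ℝ) {f : Fin n → ℝ}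
    (hf : ∀ j, 0 ≤ f j) :
    ENNReal.ofReal (exitRate q i z) *
      ∫⁻ t in Icc (0 : ℝ) 1, ENNReal.ofReal (f (jumpTarget q i z t)) =
        ENNReal.ofReal (∑ j, rate q z i j * f j) := by
  rcases (M.exit_nonneg i z).eq_or_lt with h0 | hQ
  · rw [← h0]
    have h1 : ∀ j, rate q z i j = 0 := by
      intro j
      rw [exitRate_eq] at h0
      exact (Finset.sum_eq_zero_iff_of_nonneg fun j _ => M.rate_nonneg z i j).1 h0.symm j
        (Finset.mem_univ j)
    simp [h1]
  · set P : Measure ℝ := (volume : Measure ℝ).restrict (Icc 0 1) with hP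
    have hmeas : Measurable fun t => jumpTarget q i z t :=
      M.jumpTarget_measurable.comp (by fun_prop : Measurable fun t : ℝ => (i, z, t))
    set ν := P.map (fun t => jumpTarget q i z t) with hν
    have hνj : ∀ j, j ≠ i → ν {j} = ENNReal.ofReal (rate q z i j / exitRate q i z) := by
      intro j hj
      rw [hν, Measure.map_apply hmeas (measurableSet_singleton j)]
      exact M.volume_jumpTarget hj hQ
    have hprob : IsProbabilityMeasure ν := Measure.isProbabilityMeasure_map hmeas.aemeasurable
    have hsum : ∑ j ∈ Finset.univ.erase i, ENNReal.ofReal (rate q z i j / exitRate q i z) = 1 := by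
      rw [← ENNReal.ofReal_sum_of_nonneg fun j _ => div_nonneg (M.rate_nonneg z i j) hQ.le,
        ← Finset.sum_div, ← ENNReal.ofReal_one]
      congr 1
      rw [div_eq_one_iff_eq hQ.ne', exitRate_eq, ← Finset.add_sum_erase _ _ (Finset.mem_univ i)]
      simp [rate]
    -- The masses of the states other than `i` already add up to one, so the default value of
    -- `jumpTarget` has probability zero.
    have hνi : ν {i} = 0 := by
      have h1 : ∑ j, ν {j} = 1 := by
        rw [← measure_univ (μ := ν)]
        simp
      rw [← Finset.add_sum_erase _ _ (Finset.mem_univ i), Finset.sum_congr rfl fun j hj =>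
        hνj j (Finset.ne_of_mem_erase hj), hsum] at h1
      have h2 : ν {i} + 1 = 0 + 1 := by rw [h1, zero_add]
      exact (ENNReal.add_left_inj ENNReal.one_ne_top).1 h2
    have h1 : ∫⁻ t, ENNReal.ofReal (f (jumpTarget q i z t)) ∂P =
        ∑ j ∈ Finset.univ.erase i, ENNReal.ofReal (f j) *
          ENNReal.ofReal (rate q z i j / exitRate q i z) := by
      rw [← lintegral_map (f := fun j => ENNReal.ofReal (f j)) (by fun_prop) hmeas, ← hν,
        lintegral_fintype, ← Finset.add_sum_erase _ _ (Finset.mem_univ i), hνi, mul_zero, zero_add]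
      exact Finset.sum_congr rfl fun j hj => by rw [hνj j (Finset.ne_of_mem_erase hj)]
    rw [h1, Finset.mul_sum, ← Finset.add_sum_erase _ (fun j => rate q z i j * f j)
      (Finset.mem_univ i)]
    have : rate q z i i * f i = 0 := by simp [rate]
    rw [this, zero_add, ENNReal.ofReal_sum_of_nonneg fun j _ =>
      mul_nonneg (M.rate_nonneg z i j) (hf j)]
    refine Finset.sum_congr rfl fun j _ => ?_
    rw [← ENNReal.ofReal_mul (hf j), ← ENNReal.ofReal_mul hQ.le]
    congr 1
    field_simp

/-- The place of the jump out of `(i, z)` when the exponential variable takes the value `e`. -/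
def jumpPlace (q : Fin n → Fin n → ℝ → ℝ) (v : Fin n → ℝ → ℝ) (ε : ℝ) (i : Fin n) (z e : ℝ) : ℝ :=
  motion (v i) z (holdTime q v ε i z e).toReal

theorem le_jumpPlace (M : IsModel m q v qbar φ a b Q) (ε : ℝ) (i : Fin n) (z e : ℝ) :
    z ≤ jumpPlace q v ε i z e := by
  have := (M.speed i).motion_mono z le_rfl (ENNReal.toReal_nonneg (a := holdTime q v ε i z e))
  rwa [(M.speed i).motion_zero] at this

/-- Finiteness is a separate condition because `toReal` sends `∞` to `0`, which would place a jump
that never happens at `z`. -/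
theorem holdTime_le_clock_iff (M : IsModel m q v qbar φ a b Q) (hε : 0 < ε) (i : Fin n)
    {z y : ℝ} (hzy : z ≤ y) (e : ℝ) :
    (holdTime q v ε i z e ≠ ∞ ∧ jumpPlace q v ε i z e ≤ y) ↔
      e ≤ ε⁻¹ * (exitInt q v i y - exitInt q v i z) := by
  have hs := M.speed i
  have h0 := sub_nonneg.2 (hs.clock_strictMono.monotone hzy)
  obtain ⟨t, ht⟩ : ∃ t : ℝ≥0, (t : ℝ) = clock (v i) y - clock (v i) z :=
    ⟨Real.toNNReal _, Real.coe_toNNReal _ h0⟩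
  have hiff := M.holdTime_le_iff hε i z e t
  rw [ht, hs.motion_clock_sub hzy] at hiff
  rw [← hiff, jumpPlace, hs.motion_le_iff ENNReal.toReal_nonneg, ← ht]
  constructor
  · rintro ⟨h1, h2⟩
    rw [← ENNReal.coe_toReal, ENNReal.toReal_le_toReal h1 ENNReal.coe_ne_top] at h2
    exact h2
  · intro h
    refine ⟨ne_top_of_le_ne_top ENNReal.coe_ne_top h, ?_⟩
    rw [← ENNReal.coe_toReal]
    exact ENNReal.toReal_mono ENNReal.coe_ne_top h

theorem measurable_jumpPlace (M : IsModel m q v qbar φ a b Q) (hε : 0 < ε) (i : Fin n) (z : ℝ) :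
    Measurable (jumpPlace q v ε i z) := by
  have hh : Measurable fun e : ℝ => holdTime q v ε i z e :=
    (M.holdTime_measurable hε).comp (by fun_prop : Measurable fun e : ℝ => (i, z, e))
  exact M.motion_toReal_measurable.comp
    (measurable_const.prodMk (measurable_const.prodMk hh))

theorem integral_density (M : IsModel m q v qbar φ a b Q) (ε : ℝ) (i : Fin n) (z y : ℝ) :
    ∫ w in z..y, ε⁻¹ * (exitRate q i w / v i w) *
      Real.exp (-(ε⁻¹ * (exitInt q v i w - exitInt q v i z))) =
        1 - Real.exp (-(ε⁻¹ * (exitInt q v i y - exitInt q v i z))) := by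
  have hder : ∀ w, HasDerivAt (fun w => -Real.exp (-(ε⁻¹ * (exitInt q v i w - exitInt q v i z))))
      (ε⁻¹ * (exitRate q i w / v i w) *
        Real.exp (-(ε⁻¹ * (exitInt q v i w - exitInt q v i z)))) w := by
    intro w
    have := ((((M.hasDerivAt_exitInt i w).sub_const (exitInt q v i z)).const_mul ε⁻¹).neg.exp).neg
    exact this.congr_deriv (by simp only [Pi.neg_apply]; ring)
  have hcont : Continuous fun w => ε⁻¹ * (exitRate q i w / v i w) *
      Real.exp (-(ε⁻¹ * (exitInt q v i w - exitInt q v i z))) := by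
    have h1 := M.continuous_exit_div i
    have h2 := M.exitInt_continuous i
    fun_prop
  rw [intervalIntegral.integral_eq_sub_of_hasDerivAt (fun w _ => hder w)
    (hcont.intervalIntegrable _ _)]
  simp
  ring

/-- The integrated rate up to the jump place is exponential, so this place has the usual hazard-rate
density. The two measures are compared on the half-lines `Iic y`, where `integral_density` evaluates
one of them. The restriction to `Iic` keeps the jumps that occur at or before `r`. -/
theorem map_jumpPlace (M : IsModel m q v qbar φ a b Q) (hε : 0 < ε) (i : Fin n) {z : ℝ}
    (hzr : z ≤ r) :
    ((expMeasure 1).restrict (Iic (ε⁻¹ * (exitInt q v i r - exitInt q v i z)))).map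
      (jumpPlace q v ε i z) = ((volume : Measure ℝ).restrict (Ioc z r)).withDensity
        fun y => ENNReal.ofReal (ε⁻¹ * (exitRate q i y / v i y) *
          Real.exp (-(ε⁻¹ * (exitInt q v i y - exitInt q v i z)))) := by
  have hinv := inv_pos.2 hε
  refine Measure.ext_of_Iic _ _ fun y => ?_
  rw [Measure.map_apply (M.measurable_jumpPlace hε i z) measurableSet_Iic,
    Measure.restrict_apply (M.measurable_jumpPlace hε i z measurableSet_Iic),
    withDensity_apply _ measurableSet_Iic, Measure.restrict_restrict measurableSet_Iic]
  rcases lt_or_ge y z with hyz | hzy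
  · have h1 : jumpPlace q v ε i z ⁻¹' Iic y = ∅ := by
      ext e
      simpa using hyz.trans_le (M.le_jumpPlace ε i z e)
    have h2 : Iic y ∩ Ioc z r = ∅ := by
      ext w
      simp only [mem_inter_iff, mem_Iic, mem_Ioc, mem_empty_iff_false, iff_false, not_and]
      intro h h'
      linarith
    simp [h1, h2]
  · have hset : jumpPlace q v ε i z ⁻¹' Iic y ∩
        Iic (ε⁻¹ * (exitInt q v i r - exitInt q v i z)) =
        Iic (ε⁻¹ * (exitInt q v i (min y r) - exitInt q v i z)) := by
      ext e
      simp only [mem_inter_iff, mem_preimage, mem_Iic]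
      rw [← M.holdTime_le_clock_iff hε i hzr, ← M.holdTime_le_clock_iff hε i (le_min hzy hzr),
        le_min_iff]
      tauto
    have hset' : Iic y ∩ Ioc z r = Ioc z (min y r) := by
      ext w
      simp only [mem_inter_iff, mem_Iic, mem_Ioc, le_min_iff]
      tauto
    have hpos : 0 ≤ ε⁻¹ * (exitInt q v i (min y r) - exitInt q v i z) :=
      mul_nonneg hinv.le (sub_nonneg.2 (M.exitInt_mono i (le_min hzy hzr)))
    have hcont : Continuous fun w => ε⁻¹ * (exitRate q i w / v i w) *
        Real.exp (-(ε⁻¹ * (exitInt q v i w - exitInt q v i z))) := by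
      have h1 := M.continuous_exit_div i
      have h2 := M.exitInt_continuous i
      fun_prop
    rw [hset, hset', expMeasure_Iic hpos, ← M.integral_density ε i z (min y r),
      intervalIntegral.integral_of_le (le_min hzy hzr),
      ofReal_integral_eq_lintegral_ofReal]
    · exact (hcont.intervalIntegrable z (min y r)).1
    · refine Eventually.of_forall fun w => ?_
      exact mul_nonneg (mul_nonneg hinv.le (div_nonneg (M.exit_nonneg i w)
        ((M.speed i).speed_pos w).le)) (Real.exp_pos _).le

end IsModel

/-- The discounted value of a state, as long as the level `r` is not passed. -/
def value (θ r : ℝ) (u : Fin n → ℝ → ℝ) (s : ℝ≥0∞ × Fin n × ℝ) : ℝ≥0∞ :=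
  open Classical in
  if s.1 ≠ ∞ ∧ s.2.2 ≤ r then ENNReal.ofReal (Real.exp (-(θ * s.1.toReal)) * u s.2.1 s.2.2) else 0

/-- The discounted reward for passing the level `r` during the sojourn that begins at the
state `s`. -/
def reward (q : Fin n → Fin n → ℝ → ℝ) (v : Fin n → ℝ → ℝ) (ε θ r : ℝ) (g : Fin n → ℝ)
    (s : ℝ≥0∞ × Fin n × ℝ) (p : ℝ × ℝ) : ℝ≥0∞ :=
  open Classical in
  if s.1 ≠ ∞ ∧ s.2.2 ≤ r ∧ ε⁻¹ * (exitInt q v s.2.1 r - exitInt q v s.2.1 s.2.2) < p.1 then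
    ENNReal.ofReal (Real.exp (-(θ * (s.1.toReal + (clock (v s.2.1) r - clock (v s.2.1) s.2.2)))) *
      g s.2.1) else 0

namespace IsModel

theorem value_measurable (hu : ∀ i, Measurable (u i)) (θ r : ℝ) : Measurable (value θ r u) := by
  unfold value
  refine Measurable.ite ?_ ?_ measurable_const
  · exact ((measurable_fst (measurableSet_singleton ∞)).compl).inter
      (measurableSet_le (measurable_snd.comp measurable_snd) measurable_const)
  · have h1 : Measurable fun y : Fin n × ℝ => u y.1 y.2 :=
      measurable_from_prod_countable_right fun i => hu i
    have h2 : Measurable fun s : ℝ≥0∞ × Fin n × ℝ => u s.2.1 s.2.2 := h1.comp measurable_snd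
    have h3 : Measurable fun s : ℝ≥0∞ × Fin n × ℝ => s.1.toReal := measurable_fst.ennreal_toReal
    fun_prop

theorem reward_measurable (M : IsModel m q v qbar φ a b Q) (ε θ r : ℝ) (g : Fin n → ℝ) :
    Measurable fun y : (ℝ≥0∞ × Fin n × ℝ) × ℝ × ℝ => reward q v ε θ r g y.1 y.2 := by
  have h1 : Measurable fun y : Fin n × ℝ => exitInt q v y.1 y.2 :=
    measurable_from_prod_countable_right fun i => (M.exitInt_continuous i).measurable
  have h2 : Measurable fun y : Fin n × ℝ => clock (v y.1) y.2 :=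
    measurable_from_prod_countable_right fun i => (M.speed i).clock_continuous.measurable
  have h1' : Measurable fun y : (ℝ≥0∞ × Fin n × ℝ) × ℝ × ℝ => exitInt q v y.1.2.1 y.1.2.2 :=
    h1.comp (by fun_prop)
  have h1r : Measurable fun y : (ℝ≥0∞ × Fin n × ℝ) × ℝ × ℝ => exitInt q v y.1.2.1 r :=
    h1.comp (by fun_prop : Measurable
      fun y : (ℝ≥0∞ × Fin n × ℝ) × ℝ × ℝ => (y.1.2.1, r))
  have h2' : Measurable fun y : (ℝ≥0∞ × Fin n × ℝ) × ℝ × ℝ => clock (v y.1.2.1) y.1.2.2 :=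
    h2.comp (by fun_prop)
  have h2r : Measurable fun y : (ℝ≥0∞ × Fin n × ℝ) × ℝ × ℝ => clock (v y.1.2.1) r :=
    h2.comp (by fun_prop : Measurable
      fun y : (ℝ≥0∞ × Fin n × ℝ) × ℝ × ℝ => (y.1.2.1, r))
  have h3 : Measurable fun y : (ℝ≥0∞ × Fin n × ℝ) × ℝ × ℝ => y.1.1.toReal :=
    (measurable_fst.comp measurable_fst).ennreal_toReal
  have h4 : Measurable fun y : (ℝ≥0∞ × Fin n × ℝ) × ℝ × ℝ => g y.1.2.1 :=
    (measurable_of_countable g).comp (by fun_prop)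
  unfold reward
  refine Measurable.ite ?_ (by fun_prop) measurable_const
  refine (((measurable_fst.comp measurable_fst) (measurableSet_singleton ∞)).compl).inter
    ((measurableSet_le (measurable_snd.comp (measurable_snd.comp measurable_fst))
      measurable_const).inter (measurableSet_lt ((h1r.sub h1').const_mul ε⁻¹)
        (measurable_fst.comp measurable_snd)))

theorem lintegral_reward (M : IsModel m q v qbar φ a b Q) (hε : 0 < ε) {t : ℝ≥0∞} (ht : t ≠ ∞)
    {i : Fin n} {z : ℝ} (hzr : z ≤ r) (θ : ℝ) {g : Fin n → ℝ} :
    ∫⁻ p, reward q v ε θ r g (t, i, z) p ∂pairLaw =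
      ENNReal.ofReal (Real.exp (-(θ * t.toReal)) * (survival q v ε θ i z)⁻¹ *
        (survival q v ε θ i r * g i)) := by
  set Λ := ε⁻¹ * (exitInt q v i r - exitInt q v i z) with hΛ
  have hΛ0 : 0 ≤ Λ := mul_nonneg (inv_pos.2 hε).le (sub_nonneg.2 (M.exitInt_mono i hzr))
  have h1 : ∀ p : ℝ × ℝ, reward q v ε θ r g (t, i, z) p =
      (Prod.fst ⁻¹' Ioi Λ).indicator (fun _ => ENNReal.ofReal
        (Real.exp (-(θ * (t.toReal + (clock (v i) r - clock (v i) z)))) * g i)) p := by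
    intro p
    by_cases hp : Λ < p.1
    · rw [indicator_of_mem (by simpa using hp), reward, if_pos ⟨ht, hzr, hp⟩]
    · rw [indicator_of_notMem (by simpa using hp), reward, if_neg fun h => hp h.2.2]
  simp only [h1]
  rw [lintegral_indicator_const (measurable_fst measurableSet_Ioi), pairLaw_fst,
    expMeasure_Ioi hΛ0, ← ENNReal.ofReal_mul' (Real.exp_pos _).le]
  congr 1
  have : Real.exp (-(θ * (t.toReal + (clock (v i) r - clock (v i) z)))) * Real.exp (-Λ) =
      Real.exp (-(θ * t.toReal)) * (survival q v ε θ i z)⁻¹ * survival q v ε θ i r := by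
    rw [survival, survival, ← Real.exp_neg, ← Real.exp_add, ← Real.exp_add, ← Real.exp_add, hΛ]
    congr 1
    ring
  rw [← mul_assoc (_ * _), ← this]
  ring

/-- The uniform variable is integrated first, which turns the jump law into the rates, and the
exponential one is then replaced by the jump place. The result is the integral term of the
supersolution inequality. -/
theorem lintegral_value (M : IsModel m q v qbar φ a b Q) (hε : 0 < ε) {t : ℝ≥0∞} (ht : t ≠ ∞)
    {i : Fin n} {z : ℝ} (hlz : l ≤ z) (hzr : z ≤ r) {θ : ℝ} (hu : IsSuper q v ε θ l r u) :
    ∫⁻ p, value θ r u (step q v ε (t, i, z) p) ∂pairLaw =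
      ENNReal.ofReal (Real.exp (-(θ * t.toReal)) * (survival q v ε θ i z)⁻¹ *
        ∫ y in z..r, survival q v ε θ i y * gain q v ε u i y) := by
  set Λ := ε⁻¹ * (exitInt q v i r - exitInt q v i z) with hΛ
  have hinv := inv_pos.2 hε
  have hs := M.speed i
  set F : ℝ → ℝ≥0∞ := fun y => ∫⁻ p in Icc (0 : ℝ) 1, ENNReal.ofReal (u (jumpTarget q i y p) y)
    with hF
  set K : ℝ → ℝ≥0∞ := fun y => ENNReal.ofReal
    (Real.exp (-(θ * (t.toReal + (clock (v i) y - clock (v i) z))))) * F y with hK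
  have hum : Measurable fun y : Fin n × ℝ => u y.1 y.2 :=
    measurable_from_prod_countable_right fun i => hu.meas i
  have hFm : Measurable F := by
    have h1 : Measurable fun y : ℝ × ℝ => jumpTarget q i y.1 y.2 :=
      M.jumpTarget_measurable.comp (by fun_prop : Measurable fun y : ℝ × ℝ => (i, y.1, y.2))
    have h2 : Measurable fun y : ℝ × ℝ => ENNReal.ofReal (u (jumpTarget q i y.1 y.2) y.1) :=
      (hum.comp (h1.prodMk measurable_fst)).ennreal_ofReal
    exact h2.lintegral_prod_right'
  have hKm : Measurable K := by
    have := hs.clock_continuous.measurable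
    fun_prop
  have hvm : Measurable fun p : ℝ × ℝ => value θ r u (step q v ε (t, i, z) p) :=
    (value_measurable hu.meas θ r).comp ((M.step_measurable hε).comp
      (by fun_prop : Measurable fun p : ℝ × ℝ => ((t, i, z), p)))
  have hinner : ∀ e, ∫⁻ p in Icc (0 : ℝ) 1, value θ r u (step q v ε (t, i, z) (e, p)) =
      (Iic Λ).indicator (fun e => K (jumpPlace q v ε i z e)) e := by
    intro e
    have hiff := M.holdTime_le_clock_iff hε i hzr e
    by_cases he : e ≤ Λ
    · rw [indicator_of_mem (by simpa using he)]
      obtain ⟨h1, h2⟩ := hiff.2 he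
      have htime : (t + holdTime q v ε i z e).toReal =
          t.toReal + (clock (v i) (jumpPlace q v ε i z e) - clock (v i) z) := by
        rw [ENNReal.toReal_add ht h1, jumpPlace, hs.clock_motion z ENNReal.toReal_nonneg]
        ring
      have hval : ∀ p, value θ r u (step q v ε (t, i, z) (e, p)) =
          ENNReal.ofReal (Real.exp (-(θ * (t.toReal +
            (clock (v i) (jumpPlace q v ε i z e) - clock (v i) z))))) *
          ENNReal.ofReal (u (jumpTarget q i (jumpPlace q v ε i z e) p)
            (jumpPlace q v ε i z e)) := by
        intro p
        have hc : (step q v ε (t, i, z) (e, p)).1 ≠ ∞ ∧ (step q v ε (t, i, z) (e, p)).2.2 ≤ r :=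
          ⟨ENNReal.add_ne_top.2 ⟨ht, h1⟩, h2⟩
        rw [value, if_pos hc, ← ENNReal.ofReal_mul (Real.exp_pos _).le, ← htime]
        rfl
      simp only [hval]
      rw [lintegral_const_mul' _ _ ENNReal.ofReal_ne_top]
    · rw [indicator_of_notMem (by simpa using he)]
      have hval : ∀ p, value θ r u (step q v ε (t, i, z) (e, p)) = 0 := by
        intro p
        rw [value, if_neg]
        rintro ⟨h1, h2⟩
        exact he (hiff.1 ⟨(ENNReal.add_ne_top.1 h1).2, h2⟩)
      simp [hval]
  have hKeq : ∀ y ∈ Ioc z r, ENNReal.ofReal (ε⁻¹ * (exitRate q i y / v i y) *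
      Real.exp (-(ε⁻¹ * (exitInt q v i y - exitInt q v i z)))) * K y =
      ENNReal.ofReal (Real.exp (-(θ * t.toReal)) * (survival q v ε θ i z)⁻¹ *
        (survival q v ε θ i y * gain q v ε u i y)) := by
    intro y hy
    have hvy := hs.speed_pos y
    have hnn : ∀ j, 0 ≤ u j y := fun j => hu.nonneg j y ⟨hlz.trans hy.1.le, hy.2⟩
    have h1 := M.lintegral_jumpTarget i y hnn
    have hE := M.exit_nonneg i y
    have h2 : ENNReal.ofReal (ε⁻¹ * (exitRate q i y / v i y) *
        Real.exp (-(ε⁻¹ * (exitInt q v i y - exitInt q v i z)))) =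
        ENNReal.ofReal (ε⁻¹ * (v i y)⁻¹ *
          Real.exp (-(ε⁻¹ * (exitInt q v i y - exitInt q v i z)))) *
            ENNReal.ofReal (exitRate q i y) := by
      rw [← ENNReal.ofReal_mul' hE]
      congr 1
      ring
    have hG : 0 ≤ ε⁻¹ * (v i y)⁻¹ *
          Real.exp (-(ε⁻¹ * (exitInt q v i y - exitInt q v i z))) := by positivity
    rw [h2, hK, mul_assoc, mul_left_comm (ENNReal.ofReal (exitRate q i y)), h1,
      ← ENNReal.ofReal_mul (Real.exp_pos _).le, ← ENNReal.ofReal_mul hG]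
    congr 1
    have h3 : Real.exp (-(ε⁻¹ * (exitInt q v i y - exitInt q v i z))) *
        Real.exp (-(θ * (t.toReal + (clock (v i) y - clock (v i) z)))) =
        Real.exp (-(θ * t.toReal)) * (survival q v ε θ i z)⁻¹ * survival q v ε θ i y := by
      rw [survival, survival, ← Real.exp_neg, ← Real.exp_add, ← Real.exp_add, ← Real.exp_add]
      congr 1
      ring
    rw [← mul_assoc (_ * _) (survival q v ε θ i y), ← h3, gain]
    ring
  have hI := M.gain_intervalIntegrable hu.int ε θ i
  have hIz : IntervalIntegrable (fun y => survival q v ε θ i y * gain q v ε u i y) volume z r :=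
    hI.mono_set (by
      rw [uIcc_of_le hzr, uIcc_of_le (hlz.trans hzr)]
      exact Icc_subset_Icc_left hlz)
  rw [pairLaw, lintegral_prod _ hvm.aemeasurable]
  simp only [hinner]
  rw [lintegral_indicator measurableSet_Iic, ← lintegral_map hKm (M.measurable_jumpPlace hε i z),
    M.map_jumpPlace hε i hzr, lintegral_withDensity_eq_lintegral_mul _ ?_ hKm]
  simp only [Pi.mul_apply]
  rw [setLIntegral_congr_fun measurableSet_Ioc hKeq, intervalIntegral.integral_of_le hzr,
    ← integral_const_mul, ofReal_integral_eq_lintegral_ofReal]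
  · exact hIz.1.const_mul _
  · rw [EventuallyLE, ae_restrict_iff' measurableSet_Ioc]
    refine Eventually.of_forall fun y hy => ?_
    refine mul_nonneg (mul_nonneg (Real.exp_pos _).le (inv_nonneg.2 (survival_pos ε θ i z).le))
      (mul_nonneg (survival_pos ε θ i y).le (mul_nonneg hinv.le (div_nonneg
        (Finset.sum_nonneg fun j _ => mul_nonneg (M.rate_nonneg y i j)
          (hu.nonneg j y ⟨hlz.trans hy.1.le, hy.2⟩)) (hs.speed_pos y).le)))
  · have h1 := M.continuous_exit_div i
    have h2 := M.exitInt_continuous i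
    exact (Continuous.measurable (by fun_prop)).ennreal_ofReal

/-- Either the level `r` is reached before the next jump, which pays the reward, or a jump occurs
first, which passes the value on. The two contributions are the two terms on the left of the
supersolution inequality between `z` and `r`. -/
theorem lintegral_step_le (M : IsModel m q v qbar φ a b Q) (hε : 0 < ε) {θ : ℝ}
    (hu : IsSuper q v ε θ l r u) {g : Fin n → ℝ} (hg0 : ∀ i, 0 ≤ g i) (hg : ∀ i, g i ≤ u i r)
    (s : ℝ≥0∞ × Fin n × ℝ) (hs : l ≤ s.2.2) :
    ∫⁻ p, (reward q v ε θ r g s p + value θ r u (step q v ε s p)) ∂pairLaw ≤ value θ r u s := by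
  obtain ⟨t, i, z⟩ := s
  simp only at hs
  have hrm : Measurable fun p : ℝ × ℝ => reward q v ε θ r g (t, i, z) p :=
    (M.reward_measurable ε θ r g).comp (by fun_prop : Measurable fun p : ℝ × ℝ => ((t, i, z), p))
  by_cases hc : t ≠ ∞ ∧ z ≤ r
  · obtain ⟨ht, hzr⟩ := hc
    rw [lintegral_add_left hrm, M.lintegral_reward hε ht hzr, M.lintegral_value hε ht hs hzr hu,
      value, if_pos ⟨ht, hzr⟩, ← ENNReal.ofReal_add]
    · refine ENNReal.ofReal_le_ofReal ?_
      rw [← mul_add, mul_assoc]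
      refine mul_le_mul_of_nonneg_left ?_ (Real.exp_pos _).le
      rw [inv_mul_le_iff₀ (survival_pos ε θ i z)]
      refine le_trans ?_ (hu.ineq i z r hs hzr le_rfl)
      exact add_le_add (mul_le_mul_of_nonneg_left (hg i) (survival_pos ε θ i r).le) le_rfl
    · exact mul_nonneg (mul_nonneg (Real.exp_pos _).le (inv_nonneg.2 (survival_pos ε θ i z).le))
        (mul_nonneg (survival_pos ε θ i r).le (hg0 i))
    · refine mul_nonneg (mul_nonneg (Real.exp_pos _).le
        (inv_nonneg.2 (survival_pos ε θ i z).le)) (intervalIntegral.integral_nonneg hzr ?_)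
      intro y hy
      exact mul_nonneg (survival_pos ε θ i y).le (mul_nonneg (inv_pos.2 hε).le (div_nonneg
        (Finset.sum_nonneg fun j _ => mul_nonneg (M.rate_nonneg y i j)
          (hu.nonneg j y ⟨hs.trans hy.1, hy.2⟩)) ((M.speed i).speed_pos y).le))
  · have h0 : ∀ p, reward q v ε θ r g (t, i, z) p + value θ r u (step q v ε (t, i, z) p) = 0 := by
      intro p
      rw [reward, if_neg fun h => hc ⟨h.1, h.2.1⟩, value, if_neg, add_zero]
      rintro ⟨h1, h2⟩
      exact hc ⟨(ENNReal.add_ne_top.1 h1).1, (M.le_jumpPlace ε i z p.1).trans h2⟩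
    simp [h0]

/-! ### The expected reward -/

/-- The Markov property of the jump chain, from the independence of the `k`-th state and the `k`-th
noise variable. -/
theorem lintegral_jumpState (M : IsModel m q v qbar φ a b Q) (hε : 0 < ε) (x : Fin n × ℝ) (k : ℕ)
    {Φ : (ℝ≥0∞ × Fin n × ℝ) × ℝ × ℝ → ℝ≥0∞} (hΦ : Measurable Φ) :
    ∫⁻ ω, Φ (jumpState q v ε x ω k, ω k) ∂noiseMeasure =
      ∫⁻ ω, ∫⁻ p, Φ (jumpState q v ε x ω k, p) ∂pairLaw ∂noiseMeasure := by
  classical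
  -- Extending finitely many noise variables by zero writes the `k`-th state as a measurable
  -- function of these variables alone, as independence of disjoint blocks requires.
  set ext : (Finset.range k → ℝ × ℝ) → Noise :=
    fun f i => if hi : i ∈ Finset.range k then f ⟨i, hi⟩ else 0 with hext
  have hextm : Measurable ext := by
    refine measurable_pi_lambda _ fun i => ?_
    by_cases hi : i ∈ Finset.range k
    · simpa only [hext, dif_pos hi] using measurable_pi_apply _
    · simpa only [hext, dif_neg hi] using measurable_const
  have hjs := M.jumpState_measurable hε x k
  have hind : IndepFun (fun ω : Noise => jumpState q v ε x ω k) (fun ω : Noise => ω k)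
      noiseMeasure := by
    have h1 := noise_iIndepFun.indepFun_finset (Finset.range k) {k} (by simp)
      fun i => measurable_pi_apply i
    have hψ : Measurable fun f : ({k} : Finset ℕ) → ℝ × ℝ => f ⟨k, Finset.mem_singleton_self k⟩ :=
      measurable_pi_apply _
    have h2 := h1.comp (φ := fun f => jumpState q v ε x (ext f) k)
      (ψ := fun f => f ⟨k, Finset.mem_singleton_self k⟩) (hjs.comp hextm) hψ
    have h3 : ((fun f => jumpState q v ε x (ext f) k) ∘
        fun (ω : Noise) (i : Finset.range k) => ω i) = fun ω => jumpState q v ε x ω k := by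
      funext ω
      refine jumpState_congr ε x k fun i hi => ?_
      simp [hext, hi]
    rw [h3] at h2
    exact h2
  have hmap := (indepFun_iff_map_prod_eq_prod_map_map hjs.aemeasurable
    (measurable_pi_apply k).aemeasurable).1 hind
  rw [noise_map_eval] at hmap
  have hpair : Measurable fun ω : Noise => (jumpState q v ε x ω k, ω k) :=
    hjs.prodMk (measurable_pi_apply k)
  rw [← lintegral_map hΦ hpair, hmap, lintegral_prod _ hΦ.aemeasurable,
    lintegral_map hΦ.lintegral_prod_right' hjs]

theorem le_jumpState (M : IsModel m q v qbar φ a b Q) (x : Fin n × ℝ) (ω : Noise) (k : ℕ) :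
    x.2 ≤ (jumpState q v ε x ω k).2.2 := by
  induction k with
  | zero => exact le_rfl
  | succ k ih => exact ih.trans (M.le_jumpPlace ε _ _ _)

/-- Rewards plus remaining value do not increase in mean along the jump chain. Summing over the
jumps and dropping the nonnegative remaining value gives the bound. -/
theorem lintegral_sum_reward_le (M : IsModel m q v qbar φ a b Q) (hε : 0 < ε) {θ : ℝ}
    (hu : IsSuper q v ε θ l r u) {g : Fin n → ℝ} (hg0 : ∀ i, 0 ≤ g i) (hg : ∀ i, g i ≤ u i r)
    (x : Fin n × ℝ) (hx : l ≤ x.2) (hxr : x.2 ≤ r) :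
    ∫⁻ ω, ∑' k, reward q v ε θ r g (jumpState q v ε x ω k) (ω k) ∂noiseMeasure ≤
      ENNReal.ofReal (u x.1 x.2) := by
  have hrm := M.reward_measurable ε θ r g
  have hvm := value_measurable hu.meas θ r
  have hrk : ∀ k, Measurable fun ω : Noise => reward q v ε θ r g (jumpState q v ε x ω k) (ω k) :=
    fun k => hrm.comp ((M.jumpState_measurable hε x k).prodMk (measurable_pi_apply k))
  have hstep : ∀ k, ∫⁻ ω, reward q v ε θ r g (jumpState q v ε x ω k) (ω k) ∂noiseMeasure +
      ∫⁻ ω, value θ r u (jumpState q v ε x ω (k + 1)) ∂noiseMeasure ≤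
        ∫⁻ ω, value θ r u (jumpState q v ε x ω k) ∂noiseMeasure := by
    intro k
    rw [← lintegral_add_left (hrk k)]
    simp only [jumpState_succ]
    rw [M.lintegral_jumpState hε x k
      (Φ := fun y => reward q v ε θ r g y.1 y.2 + value θ r u (step q v ε y.1 y.2))
      (hrm.add (hvm.comp (M.step_measurable hε)))]
    exact lintegral_mono fun ω => M.lintegral_step_le hε hu hg0 hg _
      (hx.trans (M.le_jumpState x ω k))
  have hsum : ∀ N, ∑ k ∈ Finset.range N,
      ∫⁻ ω, reward q v ε θ r g (jumpState q v ε x ω k) (ω k) ∂noiseMeasure +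
      ∫⁻ ω, value θ r u (jumpState q v ε x ω N) ∂noiseMeasure ≤ ENNReal.ofReal (u x.1 x.2) := by
    intro N
    induction N with
    | zero => simp [jumpState_zero, value, hxr]
    | succ N ih =>
      rw [Finset.sum_range_succ, add_assoc]
      exact (add_le_add le_rfl (hstep N)).trans ih
  rw [lintegral_tsum fun k => (hrk k).aemeasurable]
  refine ENNReal.tsum_le_of_sum_range_le fun N => le_self_add.trans (hsum N)

/-- The expected discounted reward at the passage of the level `r` is at most the value of a
supersolution at the starting point. -/
theorem exists_reward_bound (M : IsModel m q v qbar φ a b Q) (hε : 0 < ε) {θ : ℝ}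
    (hu : IsSuper q v ε θ l r u) {g : Fin n → ℝ} (hg0 : ∀ i, 0 ≤ g i) (hg : ∀ i, g i ≤ u i r)
    (x : Fin n × ℝ) (hx : l ≤ x.2) (hxr : x.2 ≤ r) :
    ∃ N : Noise → ℝ≥0∞, Measurable N ∧ ∫⁻ ω, N ω ∂noiseMeasure ≤ ENNReal.ofReal (u x.1 x.2) ∧
      ∀ ω, GoodNoise ω → ∃ τ : ℝ≥0, (X q v ε x ω τ).2 = r ∧
        ENNReal.ofReal (Real.exp (-(θ * τ)) * g (X q v ε x ω τ).1) ≤ N ω := by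
  refine ⟨fun ω => ∑' k, reward q v ε θ r g (jumpState q v ε x ω k) (ω k), ?_,
    M.lintegral_sum_reward_le hε hu hg0 hg x hx hxr, fun ω hω => ?_⟩
  · exact Measurable.tsum fun k => (M.reward_measurable ε θ r g).comp
      ((M.jumpState_measurable hε x k).prodMk (measurable_pi_apply k))
  · obtain ⟨k, h1, h2, h3⟩ := M.exists_crossing hε hω x hxr
    obtain ⟨τ, hτ, hX⟩ := M.X_crossing hε h1 h2 h3
    refine ⟨τ, by rw [hX], le_trans (le_of_eq ?_) (ENNReal.le_tsum k)⟩
    rw [hX, reward, if_pos ⟨h1, h2, h3⟩, hτ]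

end IsModel

end FastSlow

end

noncomputable section

namespace FastSlow

variable {n m : ℕ} {q : Fin n → Fin n → ℝ → ℝ} {v : Fin n → ℝ → ℝ} {qbar : Fin n → Fin n → ℝ}
  {φ : ℝ → ℝ} {a b Q ε θ l r : ℝ} {u w : Fin n → ℝ → ℝ}

/-! ### Construction of supersolutions -/

theorem hasDerivAt_clock {V : ℝ → ℝ} (hV : Continuous V) (h0 : ∀ z, V z ≠ 0) (z : ℝ) :
    HasDerivAt (clock V) (V z)⁻¹ z :=
  ((hV.inv₀ h0).integral_hasStrictDerivAt 0 z).hasDerivAt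

namespace IsModel

theorem hasDerivAt_survival (M : IsModel m q v qbar φ a b Q) (ε θ : ℝ) (i : Fin n) (z : ℝ) :
    HasDerivAt (survival q v ε θ i)
      (-(survival q v ε θ i z * ((ε⁻¹ * exitRate q i z + θ) / v i z))) z := by
  have h1 := M.hasDerivAt_exitInt i z
  have h2 := hasDerivAt_clock (M.v_cont i) (fun y => ((M.speed i).speed_pos y).ne') z
  have h3 := (((h1.const_mul ε⁻¹).add (h2.const_mul θ)).neg).exp
  refine h3.congr_deriv ?_
  simp only [survival, Pi.neg_apply, Pi.add_apply]
  ring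

/-- Variation of constants: multiplied by the survival factor, the differential inequality says that
the survival-weighted value plus the integral of the gain is nonincreasing. -/
theorem isSuper_of_deriv (M : IsModel m q v qbar φ a b Q) (ε : ℝ)
    (h0 : ∀ i z, z ∈ Icc l r → 0 ≤ u i z) (hc : ∀ i, Continuous (u i)) {u' : Fin n → ℝ → ℝ}
    (hd : ∀ i z, z ∈ Ioo l r → HasDerivAt (u i) (u' i z) z)
    (hle : ∀ i z, z ∈ Ioo l r →
      v i z * u' i z ≤ θ * u i z - ε⁻¹ * ∑ j, rate q z i j * (u j z - u i z)) :
    IsSuper q v ε θ l r u := by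
  refine ⟨h0, fun i => (hc i).measurable, fun i => (hc i).intervalIntegrable _ _, ?_⟩
  intro i z w hlz hzw hwr
  set f : ℝ → ℝ := fun y => survival q v ε θ i y * gain q v ε u i y with hf
  have hfc : Continuous f := by
    have h1 := M.survival_continuous ε θ i
    have h2 := M.v_cont i
    have h3 : Continuous fun z => ∑ j, rate q z i j * u j z :=
      continuous_finsetSum _ fun j _ => (M.rate_continuous i j).mul (hc j)
    unfold gain at hf
    exact h1.mul (continuous_const.mul (h3.div h2 fun y => ((M.speed i).speed_pos y).ne'))
  have hanti : AntitoneOn (fun y => survival q v ε θ i y * u i y + ∫ s in l..y, f s) (Icc l r) := by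
    have hder : ∀ y ∈ Ioo l r, HasDerivAt
        (fun y => survival q v ε θ i y * u i y + ∫ s in l..y, f s)
        ((-(survival q v ε θ i y * ((ε⁻¹ * exitRate q i y + θ) / v i y))) * u i y +
          survival q v ε θ i y * u' i y + f y) y := fun y hy =>
      ((M.hasDerivAt_survival ε θ i y).mul (hd i y hy)).add
        (hfc.integral_hasStrictDerivAt l y).hasDerivAt
    refine antitoneOn_of_deriv_nonpos (convex_Icc l r) ?_ ?_ ?_
    · exact (((M.survival_continuous ε θ i).mul (hc i)).add
        (intervalIntegral.continuous_primitive (fun _ _ => hfc.intervalIntegrable _ _) l)).continuousOn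
    · intro y hy
      rw [interior_Icc] at hy
      exact (hder y hy).differentiableAt.differentiableWithinAt
    · intro y hy
      rw [interior_Icc] at hy
      rw [(hder y hy).deriv, hf]
      have hv := (M.speed i).speed_pos y
      have h1 := hle i y hy
      have h2 : ∑ j, rate q y i j * (u j y - u i y) =
          ∑ j, rate q y i j * u j y - exitRate q i y * u i y := by
        rw [exitRate_eq, Finset.sum_mul, ← Finset.sum_sub_distrib]
        exact Finset.sum_congr rfl fun j _ => by ring
      rw [h2] at h1
      have h3 : (-(survival q v ε θ i y * ((ε⁻¹ * exitRate q i y + θ) / v i y))) * u i y +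
          survival q v ε θ i y * u' i y + survival q v ε θ i y * gain q v ε u i y =
          survival q v ε θ i y / v i y * (v i y * u' i y - (θ * u i y -
            ε⁻¹ * (∑ j, rate q y i j * u j y - exitRate q i y * u i y))) := by
        rw [gain]
        field_simp
        ring
      simp only
      rw [h3]
      exact mul_nonpos_of_nonneg_of_nonpos (div_nonneg (survival_pos ε θ i y).le hv.le)
        (sub_nonpos.2 h1)
  have h := hanti ⟨hlz, hzw.trans hwr⟩ ⟨hlz.trans hzw, hwr⟩ hzw
  simp only at h
  have h2 : ∫ s in z..w, f s = (∫ s in l..w, f s) - ∫ s in l..z, f s :=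
    (intervalIntegral.integral_interval_sub_left (hfc.intervalIntegrable _ _)
      (hfc.intervalIntegrable _ _)).symm
  rw [h2]
  linarith

theorem isSuper_add (M : IsModel m q v qbar φ a b Q) (hlr : l ≤ r) (hu : IsSuper q v ε θ l r u)
    (hw : IsSuper q v ε θ l r w) : IsSuper q v ε θ l r fun i z => u i z + w i z := by
  refine ⟨fun i z hz => add_nonneg (hu.nonneg i z hz) (hw.nonneg i z hz),
    fun i => (hu.meas i).add (hw.meas i), fun i => (hu.int i).add (hw.int i), ?_⟩
  intro i z y hlz hzy hyr
  have hsub : uIcc z y ⊆ uIcc l r := by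
    rw [uIcc_of_le hzy, uIcc_of_le hlr]
    exact Icc_subset_Icc hlz hyr
  have h1 := (M.gain_intervalIntegrable hu.int ε θ i).mono_set hsub
  have h2 := (M.gain_intervalIntegrable hw.int ε θ i).mono_set hsub
  have h3 : (fun y => survival q v ε θ i y * gain q v ε (fun i z => u i z + w i z) i y) =
      fun y => survival q v ε θ i y * gain q v ε u i y +
        survival q v ε θ i y * gain q v ε w i y := by
    funext y
    simp only [gain, mul_add, Finset.sum_add_distrib, add_div]
  rw [h3, intervalIntegral.integral_add h1 h2]
  have := hu.ineq i z y hlz hzy hyr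
  have := hw.ineq i z y hlz hzy hyr
  linarith

theorem isSuper_const_mul {c : ℝ} (hc : 0 ≤ c)
    (hu : IsSuper q v ε θ l r u) : IsSuper q v ε θ l r fun i z => c * u i z := by
  refine ⟨fun i z hz => mul_nonneg hc (hu.nonneg i z hz), fun i => (hu.meas i).const_mul c,
    fun i => (hu.int i).const_mul c, ?_⟩
  intro i z y hlz hzy hyr
  have h3 : (fun y => survival q v ε θ i y * gain q v ε (fun i z => c * u i z) i y) =
      fun y => c * (survival q v ε θ i y * gain q v ε u i y) := by
    funext y
    have : ∑ j, rate q y i j * (c * u j y) = c * ∑ j, rate q y i j * u j y := by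
      rw [Finset.mul_sum]
      exact Finset.sum_congr rfl fun j _ => by ring
    simp only [gain, this]
    ring
  rw [h3, intervalIntegral.integral_const_mul]
  have := mul_le_mul_of_nonneg_left (hu.ineq i z y hlz hzy hyr) hc
  linarith

/-- Independent of the fast state, so the jumps contribute nothing, and steep enough to beat a
discount of either sign. Small multiples of it repair mismatches when supersolutions are glued. -/
theorem isSuper_exp (M : IsModel m q v qbar φ a b Q) (ε θ l r : ℝ) :
    IsSuper q v ε θ l r fun _ z => Real.exp (|θ| / a * (r - z)) := by
  refine M.isSuper_of_deriv ε (fun _ _ _ => (Real.exp_pos _).le) (fun _ => by fun_prop)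
    (u' := fun _ z => Real.exp (|θ| / a * (r - z)) * (|θ| / a * (-1)))
    (fun i z _ => (((hasDerivAt_id z).const_sub r).const_mul (|θ| / a)).exp) fun i z _ => ?_
  simp only [sub_self, mul_zero, Finset.sum_const_zero, sub_zero]
  have hK : |θ| ≤ |θ| / a * v i z := by
    have h1 := mul_le_mul_of_nonneg_left ((M.speed i).lower z)
      (div_nonneg (abs_nonneg θ) M.a_pos.le)
    rwa [div_mul_cancel₀ _ M.a_pos.ne'] at h1
  have h2 : -(|θ| / a * v i z) ≤ θ := by linarith [neg_abs_le θ]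
  have := mul_le_mul_of_nonneg_right h2 (Real.exp_pos (|θ| / a * (r - z))).le
  linarith

/-- A downward jump at `s` only strengthens the inequality. Since such jumps occur, supersolutions
are defined in integral form. -/
theorem isSuper_concat (M : IsModel m q v qbar φ a b Q) {s : ℝ} (hls : l ≤ s) (hsr : s ≤ r)
    (hu : IsSuper q v ε θ l s u) (hw : IsSuper q v ε θ s r w) (h : ∀ i, w i s ≤ u i s) :
    IsSuper q v ε θ l r fun i z => open Classical in if z < s then u i z else w i z := by
  classical
  set f : Fin n → ℝ → ℝ := fun i z => if z < s then u i z else w i z with hf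
  have hfu : ∀ i z, z < s → f i z = u i z := fun i z hz => by simp [hf, hz]
  have hfw : ∀ i z, s ≤ z → f i z = w i z := fun i z hz => by simp [hf, not_lt.2 hz]
  have hInt : ∀ i, IntervalIntegrable (f i) volume l r := by
    intro i
    refine IntervalIntegrable.trans (b := s) ?_ ?_
    · refine (hu.int i).congr_ae ?_
      have : ∀ᵐ z : ℝ, z ≠ s := by simp [ae_iff]
      rw [uIoc_of_le hls, EventuallyEq, ae_restrict_iff' measurableSet_Ioc]
      filter_upwards [this] with z hz hz'
      rw [hfu i z (lt_of_le_of_ne hz'.2 hz)]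
    · refine (hw.int i).congr fun z hz => ?_
      rw [uIoc_of_le hsr] at hz
      rw [hfw i z hz.1.le]
  refine ⟨?_, fun i => Measurable.ite measurableSet_Iio (hu.meas i) (hw.meas i), hInt, ?_⟩
  · intro i z hz
    rcases lt_or_ge z s with hzs | hzs
    · exact (hu.nonneg i z ⟨hz.1, hzs.le⟩).trans_eq (hfu i z hzs).symm
    · exact (hw.nonneg i z ⟨hzs, hz.2⟩).trans_eq (hfw i z hzs).symm
  · intro i z y hlz hzy hyr
    have hGu : ∀ y ≤ s, ∫ y in z..y, survival q v ε θ i y * gain q v ε f i y =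
        ∫ y in z..y, survival q v ε θ i y * gain q v ε u i y ∨ s < z := by
      intro y hys
      rcases lt_or_ge s z with h | hzs
      · exact Or.inr h
      refine Or.inl (intervalIntegral.integral_congr_ae ?_)
      have : ∀ᵐ z : ℝ, z ≠ s := by simp [ae_iff]
      filter_upwards [this] with t ht ht'
      have hts : t < s := by
        refine lt_of_le_of_ne ?_ ht
        have := ht'.2
        exact this.trans (max_le hzs hys)
      simp only [gain, hfu _ t hts]
    have hGw : ∀ y' y, s ≤ y' → s ≤ y →
        ∫ y in y'..y, survival q v ε θ i y * gain q v ε f i y =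
        ∫ y in y'..y, survival q v ε θ i y * gain q v ε w i y := by
      intro y' y h1 h2
      refine intervalIntegral.integral_congr fun t ht => ?_
      have hts : s ≤ t := (le_min h1 h2).trans ht.1
      simp only [gain, hfw _ t hts]
    rcases le_or_gt s z with hsz | hzs
    · rw [hGw z y hsz (hsz.trans hzy), hfw i y (hsz.trans hzy), hfw i z hsz]
      exact hw.ineq i z y hsz hzy hyr
    · rcases lt_or_ge y s with hys | hsy
      · rw [(hGu y hys.le).resolve_right (not_lt.2 hzs.le), hfu i y hys, hfu i z hzs]
        exact hu.ineq i z y hlz hzy hys.le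
      · have hI := M.gain_intervalIntegrable hInt ε θ i
        have hlr : l ≤ r := hls.trans hsr
        have hI1 := hI.mono_set (c := z) (d := s) (by
          rw [uIcc_of_le hzs.le, uIcc_of_le hlr]
          exact Icc_subset_Icc hlz hsr)
        have hI2 := hI.mono_set (c := s) (d := y) (by
          rw [uIcc_of_le hsy, uIcc_of_le hlr]
          exact Icc_subset_Icc hls hyr)
        rw [← intervalIntegral.integral_add_adjacent_intervals hI1 hI2,
          (hGu s le_rfl).resolve_right (not_lt.2 hzs.le), hGw s y le_rfl hsy, hfw i y hsy,
          hfu i z hzs]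
        have h1 := hu.ineq i z s hlz hzs.le le_rfl
        have h2 := hw.ineq i s y le_rfl hsy hyr
        have h3 := mul_le_mul_of_nonneg_left (h i) (survival_pos (q := q) (v := v) ε θ i s).le
        linarith

end IsModel

/-- For small `ε` there is a supersolution on `[l, r]` that dominates `g` at `r` and is
approximately dominated by `c` at `l`. -/
def UpperBound (q : Fin n → Fin n → ℝ → ℝ) (v : Fin n → ℝ → ℝ) (θ l r : ℝ) (g c : Fin n → ℝ) :
    Prop :=
  ∀ η > 0, ∀ᶠ ε in 𝓝[>] (0 : ℝ), ∃ u, IsSuper q v ε θ l r u ∧ (∀ i, g i ≤ u i r) ∧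
    ∀ i, u i l ≤ c i + η

namespace IsModel

theorem upperBound_concat (M : IsModel m q v qbar φ a b Q) {s : ℝ} (hls : l ≤ s) (hsr : s ≤ r)
    {g₁ g₂ c₁ c₂ : Fin n → ℝ} (h₁ : UpperBound q v θ l s g₁ c₁)
    (h₂ : UpperBound q v θ s r g₂ c₂) (h : ∀ i, c₂ i ≤ g₁ i) : UpperBound q v θ l r g₂ c₁ := by
  intro η hη
  -- The first piece is lifted by a multiple of the exponential supersolution, large enough at `s`
  -- to cover the error of the second piece; at `l` this lift has grown by the factor `K`.
  set K := Real.exp (|θ| / a * (s - l)) with hK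
  have hK0 : 0 < K := Real.exp_pos _
  have hη' : 0 < η / (1 + K) := by positivity
  filter_upwards [h₁ _ hη', h₂ _ hη'] with ε ⟨u, hu, hug, huc⟩ ⟨w, hw, hwg, hwc⟩
  have hu' := M.isSuper_add hls hu (isSuper_const_mul hη'.le (M.isSuper_exp ε θ l s))
  classical
  refine ⟨_, M.isSuper_concat hls hsr hu' hw fun i => ?_, fun i => ?_, fun i => ?_⟩
  · simp only [sub_self, mul_zero, Real.exp_zero, mul_one]
    linarith [hwc i, h i, hug i]
  · simp only [not_lt.2 hsr, if_false]
    exact hwg i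
  · have key : u i l + η / (1 + K) * K ≤ c₁ i + η := by
      have : η / (1 + K) + η / (1 + K) * K = η := by field_simp
      linarith [huc i]
    rcases hls.lt_or_eq with hlt | heq
    · simp only [hlt, if_true]
      exact key
    -- For `l = s` the glued function takes the value of the second piece at `l`.
    · subst heq
      simp only [lt_irrefl, if_false]
      have h1 := hwc i
      have hK1 : K = 1 := by simp [hK]
      rw [hK1] at key h1
      linarith [hug i, h i]

theorem upperBound_of_forall {g c : Fin n → ℝ}
    (h : ∀ η > 0, UpperBound q v θ l r g fun i => c i + η) : UpperBound q v θ l r g c := by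
  intro η hη
  filter_upwards [h (η / 2) (half_pos hη) (η / 2) (half_pos hη)] with ε ⟨u, hu, hg, hc⟩
  exact ⟨u, hu, hg, fun i => by linarith [hc i]⟩

/-! ### Averaging away from the vertex -/

/-- The coefficients are merely continuous, so exact Poisson solutions need not be differentiable in
`z`. Approximate solutions at a point form a convex set, and an exact solution at one point remains
approximate nearby, so a smooth partition of unity yields a `C¹` choice. -/
theorem exists_smooth_corrector (M : IsModel m q v qbar φ a b Q) (θ : ℝ) {V : Fin n → ℝ → ℝ}
    (hVc : ∀ i, Continuous (V i)) (hV : ∀ i z, a ≤ V i z)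
    (hpois : ∀ z ∈ Icc l r, ∃ χ : Fin n → ℝ, ∀ i,
      ∑ j, rate q z i j * (χ j - χ i) = θ * (1 - v i z / V i z)) {η : ℝ} (hη : 0 < η) :
    ∃ χ : ℝ → Fin n → ℝ, ContDiff ℝ 1 χ ∧ ∀ z ∈ Icc l r, ∀ i,
      |∑ j, rate q z i j * (χ z j - χ z i) - θ * (1 - v i z / V i z)| ≤ η := by
  set t : ℝ → Set (Fin n → ℝ) := fun z => {χ | z ∈ Icc l r → ∀ i,
    |∑ j, rate q z i j * (χ j - χ i) - θ * (1 - v i z / V i z)| ≤ η} with ht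
  have hconv : ∀ z, Convex ℝ (t z) := by
    intro z χ hχ ψ hψ s s' hs hs' hss hz i
    have h1 := hχ hz i
    have h2 := hψ hz i
    have h3 : ∑ j, rate q z i j * ((s • χ + s' • ψ) j - (s • χ + s' • ψ) i) -
        θ * (1 - v i z / V i z) =
        s * (∑ j, rate q z i j * (χ j - χ i) - θ * (1 - v i z / V i z)) +
        s' * (∑ j, rate q z i j * (ψ j - ψ i) - θ * (1 - v i z / V i z)) := by
      have e : θ * (1 - v i z / V i z) = (s + s') * (θ * (1 - v i z / V i z)) := by
        rw [hss, one_mul]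
      have e2 : ∑ j, rate q z i j * ((s • χ + s' • ψ) j - (s • χ + s' • ψ) i) =
          s * ∑ j, rate q z i j * (χ j - χ i) + s' * ∑ j, rate q z i j * (ψ j - ψ i) := by
        rw [Finset.mul_sum, Finset.mul_sum, ← Finset.sum_add_distrib]
        refine Finset.sum_congr rfl fun j _ => ?_
        simp only [Pi.add_apply, Pi.smul_apply, smul_eq_mul]
        ring
      rw [e2]
      nth_rewrite 1 [e]
      ring
    rw [h3]
    calc _ ≤ s * |∑ j, rate q z i j * (χ j - χ i) - θ * (1 - v i z / V i z)| +
          s' * |∑ j, rate q z i j * (ψ j - ψ i) - θ * (1 - v i z / V i z)| := by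
            refine (abs_add_le _ _).trans (le_of_eq ?_)
            rw [abs_mul, abs_mul, abs_of_nonneg hs, abs_of_nonneg hs']
      _ ≤ s * η + s' * η := add_le_add (mul_le_mul_of_nonneg_left h1 hs)
          (mul_le_mul_of_nonneg_left h2 hs')
      _ = η := by rw [← add_mul, hss, one_mul]
  have hloc : ∀ z, ∃ χ, ∀ᶠ y in 𝓝 z, χ ∈ t y := by
    intro z
    by_cases hz : z ∈ Icc l r
    · obtain ⟨χ, hχ⟩ := hpois z hz
      refine ⟨χ, ?_⟩
      have : ∀ i, ∀ᶠ y in 𝓝 z,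
          |∑ j, rate q y i j * (χ j - χ i) - θ * (1 - v i y / V i y)| < η := by
        intro i
        have hcont : Continuous fun y =>
            |∑ j, rate q y i j * (χ j - χ i) - θ * (1 - v i y / V i y)| := by
          have h1 : Continuous fun y => ∑ j, rate q y i j * (χ j - χ i) :=
            continuous_finsetSum _ fun j _ => (M.rate_continuous i j).mul continuous_const
          have h2 : Continuous fun y => v i y / V i y :=
            (M.v_cont i).div (hVc i) fun y => (M.a_pos.trans_le (hV i y)).ne'
          fun_prop
        refine hcont.continuousAt.eventually_lt_const ?_
        simp only [hχ i, sub_self, abs_zero]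
        exact hη
      filter_upwards [eventually_all.2 this] with y hy _ i
      exact (hy i).le
    · refine ⟨0, ?_⟩
      filter_upwards [isClosed_Icc.isOpen_compl.mem_nhds hz] with y hy hy'
      exact absurd hy' hy
  obtain ⟨g, hg⟩ := exists_contMDiffMap_forall_mem_convex_of_local_const
    (n := 1) (modelWithCornersSelf ℝ ℝ) hconv hloc
  exact ⟨g, contMDiff_iff_contDiff.1 g.contMDiff, fun z hz i => hg z hz i⟩

/-- The perturbed test function method. The function `exp (-θ (clock r - clock z))` solves the
equation with speed `V` in place of `v i`, and the corrector `ε χ` cancels the mismatch `θ (1 - v i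
/ V i)` at order one. Jumps do not change `c` and `V`, so these factor out of the generator. -/
theorem upperBound_average (M : IsModel m q v qbar φ a b Q) (hlr : l ≤ r) (θ : ℝ)
    {V : Fin n → ℝ → ℝ} (hVc : ∀ i, Continuous (V i)) (hV : ∀ i z, a ≤ V i z)
    {c : Fin n → ℝ} (hc : ∀ i, 0 ≤ c i)
    (hcls : ∀ z ∈ Icc l r, ∀ i j, rate q z i j ≠ 0 → c i = c j ∧ V i = V j)
    (hpois : ∀ z ∈ Icc l r, ∃ χ : Fin n → ℝ, ∀ i,
      ∑ j, rate q z i j * (χ j - χ i) = θ * (1 - v i z / V i z)) :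
    UpperBound q v θ l r c
      fun i => c i * Real.exp (-(θ * (clock (V i) r - clock (V i) l))) := by
  intro η₀ hη₀
  have ha := M.a_pos
  have hb := M.b_pos
  obtain ⟨η, hη, hη1, hηi⟩ : ∃ η > 0, η ≤ 1 / 2 ∧ ∀ i, (1 + 2 * η) * (1 + η) *
      (c i * Real.exp (-(θ * (clock (V i) r - clock (V i) l)) + 4 * η / a * (r - l))) ≤
      c i * Real.exp (-(θ * (clock (V i) r - clock (V i) l))) + η₀ := by
    have h1 : ∀ i, ∀ᶠ η in 𝓝[>] (0 : ℝ), (1 + 2 * η) * (1 + η) *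
        (c i * Real.exp (-(θ * (clock (V i) r - clock (V i) l)) + 4 * η / a * (r - l))) ≤
        c i * Real.exp (-(θ * (clock (V i) r - clock (V i) l))) + η₀ := by
      intro i
      have hcont : Continuous fun η : ℝ => (1 + 2 * η) * (1 + η) *
        (c i * Real.exp (-(θ * (clock (V i) r - clock (V i) l)) + 4 * η / a * (r - l))) := by
        fun_prop
      have := (hcont.tendsto 0).eventually_lt_const
        (u := c i * Real.exp (-(θ * (clock (V i) r - clock (V i) l))) + η₀) (by simp [hη₀])
      exact (this.mono fun η h => h.le).filter_mono nhdsWithin_le_nhds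
    have h2 : ∀ᶠ η in 𝓝[>] (0 : ℝ), η ≤ 1 / 2 :=
      (eventually_le_nhds (show (0 : ℝ) < 1 / 2 by norm_num)).filter_mono nhdsWithin_le_nhds
    obtain ⟨η, h3, h4, h5⟩ := ((eventually_all.2 h1).and (h2.and self_mem_nhdsWithin)).exists
    exact ⟨η, h5, h4, h3⟩
  obtain ⟨χ, hχ, hχe⟩ := M.exists_smooth_corrector θ hVc hV hpois hη
  have hχi : ∀ i, ContDiff ℝ 1 fun z => χ z i := fun i => (contDiff_pi.1 hχ) i
  have hχd : ∀ i z, HasDerivAt (fun z => χ z i) (deriv (fun z => χ z i) z) z := fun i z =>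
    ((hχi i).differentiable one_ne_zero z).hasDerivAt
  obtain ⟨B, hB0, hB⟩ : ∃ B > 0, ∀ i, ∀ z ∈ Icc l r,
      |χ z i| ≤ B ∧ |deriv (fun z => χ z i) z| ≤ B := by
    have h1 : ∀ i, ∃ B, ∀ z ∈ Icc l r, |χ z i| ≤ B ∧ |deriv (fun z => χ z i) z| ≤ B := by
      intro i
      obtain ⟨B1, hB1⟩ := isCompact_Icc.exists_bound_of_continuousOn (s := Icc l r)
        (hχi i).continuous.continuousOn
      obtain ⟨B2, hB2⟩ := isCompact_Icc.exists_bound_of_continuousOn (s := Icc l r)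
        ((hχi i).continuous_deriv le_rfl).continuousOn
      exact ⟨max B1 B2, fun z hz => ⟨(hB1 z hz).trans (le_max_left _ _),
        (hB2 z hz).trans (le_max_right _ _)⟩⟩
    choose B hB using h1
    refine ⟨1 + ∑ i, |B i|, by positivity, fun i z hz => ?_⟩
    have : B i ≤ 1 + ∑ i, |B i| := by
      have := Finset.single_le_sum (f := fun i => |B i|) (fun i _ => abs_nonneg _)
        (Finset.mem_univ i)
      have h3 := le_abs_self (B i)
      linarith
    exact ⟨(hB i z hz).1.trans this, (hB i z hz).2.trans this⟩
  have hsmall : ∀ᶠ ε in 𝓝[>] (0 : ℝ), ε * (B * (b + |θ| * (b / a + 1) + 1)) ≤ η := by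
    have hcont : Continuous fun ε : ℝ => ε * (B * (b + |θ| * (b / a + 1) + 1)) := by fun_prop
    have := (hcont.tendsto 0).eventually_lt_const (u := η) (by simpa using hη)
    exact (this.mono fun η h => h.le).filter_mono nhdsWithin_le_nhds
  filter_upwards [hsmall, self_mem_nhdsWithin] with ε hε1 hε
  replace hε : 0 < ε := hε
  have hεB : ε * B ≤ η := by
    refine le_trans ?_ hε1
    refine mul_le_mul_of_nonneg_left ?_ hε.le
    have : 0 ≤ b + |θ| * (b / a + 1) := by positivity
    nlinarith
  -- The slope `κ` produces the slack `κ * v i z * (1 + y) ≥ 2 * η`: one `η` pays for the error in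
  -- the Poisson equation, the other for the terms of order `ε`.
  set κ := 4 * η / a with hκ
  set E : Fin n → ℝ → ℝ := fun i z =>
    Real.exp (-(θ * (clock (V i) r - clock (V i) z)) + κ * (r - z)) with hE
  have hEpos : ∀ i z, 0 < E i z := fun i z => Real.exp_pos _
  have hVne : ∀ i z, V i z ≠ 0 := fun i z => (ha.trans_le (hV i z)).ne'
  have hEd : ∀ i z, HasDerivAt (E i) (E i z * (θ * (V i z)⁻¹ - κ)) z := by
    intro i z
    have h1 := hasDerivAt_clock (hVc i) (hVne i) z
    have h2 := ((((h1.const_sub (clock (V i) r)).const_mul θ).neg).add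
      (((hasDerivAt_id z).const_sub r).const_mul κ)).exp
    refine h2.congr_deriv ?_
    simp only [hE, Pi.neg_apply, Pi.add_apply, id]
    ring
  have hχb : ∀ i, ∀ z ∈ Icc l r, |ε * χ z i| ≤ η := by
    intro i z hz
    rw [abs_mul, abs_of_pos hε]
    exact (mul_le_mul_of_nonneg_left (hB i z hz).1 hε.le).trans hεB
  refine ⟨fun i z => (1 + 2 * η) * c i * (E i z * (1 + ε * χ z i)), ?_, fun i => ?_, fun i => ?_⟩
  · refine M.isSuper_of_deriv ε (fun i z hz => ?_) (fun i => ?_)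
      (u' := fun i z => (1 + 2 * η) * c i * (E i z * (θ * (V i z)⁻¹ - κ) * (1 + ε * χ z i) +
        E i z * (ε * deriv (fun z => χ z i) z))) (fun i z _ => ?_) fun i z hz => ?_
    · have := (abs_le.1 (hχb i z hz)).1
      exact mul_nonneg (mul_nonneg (by positivity) (hc i))
        (mul_nonneg (hEpos i z).le (by linarith))
    · have h1 : Continuous (E i) :=
        continuous_iff_continuousAt.2 fun z => (hEd i z).continuousAt
      have h2 := (hχi i).continuous
      fun_prop
    · exact ((hEd i z).mul (((hχd i z).const_mul ε).const_add 1)).const_mul _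
    · have hz' : z ∈ Icc l r := Ioo_subset_Icc_self hz
      have hv := (M.speed i).speed_pos z
      have hsum : ∑ j, rate q z i j * ((1 + 2 * η) * c j * (E j z * (1 + ε * χ z j)) -
          (1 + 2 * η) * c i * (E i z * (1 + ε * χ z i))) =
          (1 + 2 * η) * c i * E i z * (ε * ∑ j, rate q z i j * (χ z j - χ z i)) := by
        rw [Finset.mul_sum, Finset.mul_sum]
        refine Finset.sum_congr rfl fun j _ => ?_
        by_cases hr : rate q z i j = 0
        · simp [hr]
        · obtain ⟨h1, h2⟩ := hcls z hz' i j hr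
          have h3 : E j z = E i z := by simp only [hE, h2]
          rw [← h1, h3]
          ring
      rw [hsum]
      have hLχ := (abs_le.1 (hχe z hz' i)).2
      set L := ∑ j, rate q z i j * (χ z j - χ z i) with hL
      set D := deriv (fun z => χ z i) z with hD
      have hD' : |D| ≤ B := (hB i z hz').2
      have hy := hχb i z hz'
      set y := ε * χ z i with hy'
      have hyB : |y| ≤ ε * B := by
        rw [hy', abs_mul, abs_of_pos hε]
        exact mul_le_mul_of_nonneg_left (hB i z hz').1 hε.le
      have hmain : v i z * ((θ * (V i z)⁻¹ - κ) * (1 + y) + ε * D) ≤ θ * (1 + y) - L := by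
        have hvb := (M.speed i).upper z
        have hva := (M.speed i).lower z
        have e1 : θ * (1 - v i z / V i z) = θ - θ * (v i z * (V i z)⁻¹) := by
          rw [div_eq_mul_inv]; ring
        rw [e1] at hLχ
        have hρ : |v i z * (V i z)⁻¹ - 1| ≤ b / a + 1 := by
          have h1 : 0 ≤ v i z * (V i z)⁻¹ := mul_nonneg hv.le (inv_nonneg.2 (ha.le.trans (hV i z)))
          have h2 : v i z * (V i z)⁻¹ ≤ b / a := by
            rw [div_eq_mul_inv]
            exact mul_le_mul hvb (inv_anti₀ ha (hV i z)) (inv_nonneg.2 (ha.le.trans (hV i z))) hb.le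
          rw [abs_le]
          constructor <;> linarith [div_pos hb ha]
        have t1 : v i z * (ε * D) ≤ ε * (B * b) := by
          have h1 : v i z * (ε * D) ≤ v i z * (ε * B) :=
            mul_le_mul_of_nonneg_left (mul_le_mul_of_nonneg_left ((le_abs_self D).trans hD') hε.le)
              hv.le
          have h2 : v i z * (ε * B) ≤ b * (ε * B) := mul_le_mul_of_nonneg_right hvb (by positivity)
          linarith
        have t2 : θ * (v i z * (V i z)⁻¹ - 1) * y ≤ ε * (B * (|θ| * (b / a + 1))) := by
          have h1 : |θ * (v i z * (V i z)⁻¹ - 1) * y| ≤ |θ| * (b / a + 1) * (ε * B) := by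
            rw [abs_mul, abs_mul]
            exact mul_le_mul (mul_le_mul_of_nonneg_left hρ (abs_nonneg _)) hyB (abs_nonneg _)
              (by positivity)
          have := (le_abs_self _).trans h1
          linarith
        have t3 : 2 * η ≤ κ * v i z * (1 + y) := by
          have h1 : 1 / 2 ≤ 1 + y := by linarith [(abs_le.1 hy).1]
          have h2 : 4 * η ≤ κ * v i z := by
            have := mul_le_mul_of_nonneg_left hva (show 0 ≤ κ by positivity)
            rwa [hκ, div_mul_cancel₀ _ ha.ne'] at this
          calc 2 * η = 4 * η * (1 / 2) := by ring
            _ ≤ κ * v i z * (1 + y) := mul_le_mul h2 h1 (by norm_num) (by positivity)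
        have t4 : ε * (B * b) + ε * (B * (|θ| * (b / a + 1))) ≤ η := by
          refine le_trans ?_ hε1
          have : 0 ≤ ε * B := by positivity
          nlinarith
        have e2 : v i z * ((θ * (V i z)⁻¹ - κ) * (1 + y) + ε * D) - (θ * (1 + y) - L) =
            (L - (θ - θ * (v i z * (V i z)⁻¹))) + θ * (v i z * (V i z)⁻¹ - 1) * y +
              v i z * (ε * D) - κ * v i z * (1 + y) := by ring
        linarith
      have hcE : 0 ≤ (1 + 2 * η) * c i * E i z :=
        mul_nonneg (mul_nonneg (by positivity) (hc i)) (hEpos i z).le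
      have := mul_le_mul_of_nonneg_left hmain hcE
      have e3 : ε⁻¹ * ((1 + 2 * η) * c i * E i z * (ε * L)) = (1 + 2 * η) * c i * E i z * L := by
        field_simp
      rw [e3]
      linarith
  · have h1 := (abs_le.1 (hχb i r ⟨hlr, le_rfl⟩)).1
    have h2 : E i r = 1 := by simp [hE]
    simp only [h2, one_mul]
    -- Here `η ≤ 1 / 2` is used, in the form `(1 + 2 * η) * (1 - η) ≥ 1`.
    have h3 : 1 ≤ (1 + 2 * η) * (1 + ε * χ r i) := by nlinarith
    calc c i = c i * 1 := (mul_one _).symm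
      _ ≤ c i * ((1 + 2 * η) * (1 + ε * χ r i)) := mul_le_mul_of_nonneg_left h3 (hc i)
      _ = _ := by ring
  · have h1 := (abs_le.1 (hχb i l ⟨le_rfl, hlr⟩)).2
    refine le_trans ?_ (hηi i)
    have h2 : (1 + ε * χ l i) ≤ 1 + η := by linarith
    have h3 : 0 ≤ (1 + 2 * η) * (c i * E i l) :=
      mul_nonneg (by positivity) (mul_nonneg (hc i) (hEpos i l).le)
    calc (1 + 2 * η) * c i * (E i l * (1 + ε * χ l i)) =
        (1 + 2 * η) * (c i * E i l) * (1 + ε * χ l i) := by ring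
      _ ≤ (1 + 2 * η) * (c i * E i l) * (1 + η) := mul_le_mul_of_nonneg_left h2 h3
      _ = _ := by
        simp only [hE]
        ring

end IsModel

end FastSlow

end

noncomputable section

namespace FastSlow

/-! ### Relaxation inside the classes -/

section Relaxation

variable {ι κ : Type*} [Fintype ι] [DecidableEq κ] {a : ι → ι → ℝ} {c : ι → κ} {w : ι → ℝ}

/-- A Poincaré inequality. Any two states of a class are directly connected, so for small `γ` the
form dominates `γ` times the sum of `w j * (g j - g i) ^ 2` over the class. For centred `g` the
cross term of the expanded square vanishes. -/
theorem HasClasses.exists_gap (ha : HasClasses a c) (hpos : ∀ i, 0 < w i) :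
    ∃ γ > 0, ∀ g : ι → ℝ, (∀ k, ∑ i with c i = k, w i * g i = 0) →
      γ * ∑ i, w i * g i ^ 2 ≤ ∑ i, ∑ j, w i * a i j * (g j - g i) ^ 2 := by
  classical
  obtain ⟨γ, hγ, hle⟩ : ∃ γ > 0, ∀ i j, i ≠ j → c i = c j → γ * w j ≤ w i * a i j := by
    have h1 : ∀ i j, ∀ᶠ γ in 𝓝[>] (0 : ℝ), i ≠ j → c i = c j → γ * w j ≤ w i * a i j := by
      intro i j
      by_cases h : i ≠ j ∧ c i = c j
      · have hcont : Continuous fun γ : ℝ => γ * w j := by fun_prop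
        have := (hcont.tendsto 0).eventually_lt_const (u := w i * a i j)
          (by simpa using mul_pos (hpos i) (ha.pos i j h.1 h.2))
        exact (this.filter_mono nhdsWithin_le_nhds).mono fun γ h _ _ => h.le
      · exact Eventually.of_forall fun γ h1 h2 => absurd ⟨h1, h2⟩ h
    obtain ⟨γ, h2, h3⟩ :=
      ((eventually_all.2 fun i => eventually_all.2 (h1 i)).and self_mem_nhdsWithin).exists
    exact ⟨γ, h3, h2⟩
  refine ⟨γ, hγ, fun g hg => ?_⟩
  rw [Finset.mul_sum]
  refine Finset.sum_le_sum fun i _ => ?_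
  have e : ∑ j with c j = c i, w j * (g j - g i) ^ 2 =
      ∑ j with c j = c i, w j * g j ^ 2 - 2 * g i * ∑ j with c j = c i, w j * g j +
        g i ^ 2 * ∑ j with c j = c i, w j := by
    rw [Finset.mul_sum, Finset.mul_sum, ← Finset.sum_sub_distrib, ← Finset.sum_add_distrib]
    exact Finset.sum_congr rfl fun j _ => by ring
  rw [hg, mul_zero, sub_zero] at e
  have h1 : 0 ≤ ∑ j with c j = c i, w j * g j ^ 2 :=
    Finset.sum_nonneg fun j _ => mul_nonneg (hpos j).le (sq_nonneg _)
  have h2 : w i ≤ ∑ j with c j = c i, w j :=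
    Finset.single_le_sum (f := w) (fun j _ => (hpos j).le) (by simp)
  have h3 : w i * g i ^ 2 ≤ ∑ j with c j = c i, w j * (g j - g i) ^ 2 := by
    have := mul_le_mul_of_nonneg_left h2 (sq_nonneg (g i))
    linarith
  calc γ * (w i * g i ^ 2) ≤ γ * ∑ j with c j = c i, w j * (g j - g i) ^ 2 :=
        mul_le_mul_of_nonneg_left h3 hγ.le
    _ = ∑ j with c j = c i, γ * w j * (g j - g i) ^ 2 := by
        rw [Finset.mul_sum]
        exact Finset.sum_congr rfl fun j _ => by ring
    _ ≤ ∑ j with c j = c i, w i * a i j * (g j - g i) ^ 2 := by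
        refine Finset.sum_le_sum fun j hj => ?_
        by_cases hij : i = j
        · simp [hij]
        · exact mul_le_mul_of_nonneg_right (hle i j hij (Finset.mem_filter.1 hj).2.symm)
            (sq_nonneg _)
    _ ≤ ∑ j, w i * a i j * (g j - g i) ^ 2 :=
        Finset.sum_le_sum_of_subset_of_nonneg (Finset.filter_subset _ _) fun j _ _ =>
          mul_nonneg (mul_nonneg (hpos i).le (ha.nonneg i j)) (sq_nonneg _)

/-- The class means are conserved, so the gap applies at all times to the weighted `L²` norm. This
norm squared decays at rate `γ`, each component at rate `γ / 2`. -/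
theorem IsNull.exists_decay (hw : IsNull a w) (ha : HasClasses a c) (hpos : ∀ i, 0 < w i)
    {P : ℝ → ι → ℝ} (hP : ∀ i t, HasDerivAt (fun t => P t i) (∑ j, a i j * (P t j - P t i)) t)
    (h0 : ∀ k, ∑ i with c i = k, w i * P 0 i = 0) :
    ∃ γ > 0, ∃ C > 0, ∀ t, 0 ≤ t → ∀ i, |P t i| ≤ C * Real.exp (-(γ * t)) := by
  classical
  obtain ⟨γ, hγ, hgap⟩ := ha.exists_gap hpos
  have hmean : ∀ k t, ∑ i with c i = k, w i * P t i = 0 := by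
    intro k t
    have hd : ∀ t, HasDerivAt (fun t => ∑ i with c i = k, w i * P t i) 0 t := by
      intro t
      rw [← hw.sum_class_eq_zero ha (P t) k]
      exact HasDerivAt.fun_sum fun i _ => (hP i t).const_mul (w i)
    rw [← h0 k]
    exact is_const_of_deriv_eq_zero (fun t => (hd t).differentiableAt) (fun t => (hd t).deriv) t 0
  set E : ℝ → ℝ := fun t => ∑ i, w i * P t i ^ 2 with hE
  have hEd : ∀ t, HasDerivAt E (-∑ i, ∑ j, w i * a i j * (P t j - P t i) ^ 2) t := by
    intro t
    have h1 : HasDerivAt E (∑ i, w i * (2 * P t i * ∑ j, a i j * (P t j - P t i))) t := by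
      refine HasDerivAt.fun_sum fun i _ => ?_
      refine (((hP i t).pow 2).const_mul (w i)).congr_deriv ?_
      simp
    refine h1.congr_deriv ?_
    have h2 := hw.sum_mul_eq (P t)
    have h3 : ∑ i, w i * (2 * P t i * ∑ j, a i j * (P t j - P t i)) =
        2 * ∑ i, w i * (P t i * ∑ j, a i j * (P t j - P t i)) := by
      rw [Finset.mul_sum]
      exact Finset.sum_congr rfl fun i _ => by ring
    rw [h3, h2]
    ring
  have hE0 : ∀ t, 0 ≤ E t := fun t =>
    Finset.sum_nonneg fun i _ => mul_nonneg (hpos i).le (sq_nonneg _)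
  have hEdec : ∀ t, 0 ≤ t → E t * Real.exp (γ * t) ≤ E 0 := by
    intro t ht
    have hd : ∀ t, HasDerivAt (fun t => E t * Real.exp (γ * t))
        ((-∑ i, ∑ j, w i * a i j * (P t j - P t i) ^ 2) * Real.exp (γ * t) +
          E t * (Real.exp (γ * t) * γ)) t := fun t => by
      have := ((hasDerivAt_id t).const_mul γ).exp
      simp only [id, mul_one] at this
      exact (hEd t).mul this
    have hanti : Antitone fun t => E t * Real.exp (γ * t) := by
      refine antitone_of_deriv_nonpos (fun t => (hd t).differentiableAt) fun t => ?_
      rw [(hd t).deriv]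
      have h1 := hgap (P t) (fun k => hmean k t)
      have h2 := mul_le_mul_of_nonneg_right h1 (Real.exp_pos (γ * t)).le
      simp only [hE]
      linarith
    simpa using hanti ht
  obtain ⟨C, hC, hCle⟩ : ∃ C > 0, ∀ i, E 0 ≤ w i * C ^ 2 := by
    have h1 : ∀ i, ∀ᶠ C : ℝ in atTop, E 0 ≤ w i * C ^ 2 := fun i =>
      ((tendsto_pow_atTop two_ne_zero).const_mul_atTop (hpos i)).eventually_ge_atTop _
    obtain ⟨C, h2, h3⟩ := ((eventually_all.2 h1).and (eventually_gt_atTop 0)).exists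
    exact ⟨C, h3, h2⟩
  refine ⟨γ / 2, half_pos hγ, C, hC, fun t ht i => ?_⟩
  refine abs_le_of_sq_le_sq ?_ (by positivity)
  have h1 : w i * P t i ^ 2 ≤ E t :=
    Finset.single_le_sum (f := fun i => w i * P t i ^ 2)
      (fun j _ => mul_nonneg (hpos j).le (sq_nonneg _)) (Finset.mem_univ i)
  have h2 := hEdec t ht
  have h3 : (C * Real.exp (-(γ / 2 * t))) ^ 2 * Real.exp (γ * t) = C ^ 2 := by
    rw [mul_pow, ← Real.exp_nat_mul, mul_assoc, ← Real.exp_add]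
    have : ((2 : ℕ) : ℝ) * -(γ / 2 * t) + γ * t = 0 := by push_cast; ring
    rw [this, Real.exp_zero, mul_one]
  have he := Real.exp_pos (γ * t)
  have h4 : w i * (P t i ^ 2 * Real.exp (γ * t)) ≤ w i * C ^ 2 := by
    have := mul_le_mul_of_nonneg_right h1 he.le
    linarith [hCle i]
  have h5 := le_of_mul_le_mul_left h4 (hpos i)
  rw [← h3] at h5
  exact le_of_mul_le_mul_right h5 he

/-- The exponential of the generator. Negative times are included; they let the dependence on `z` be
separated from the integration variable in the Duhamel integral below. -/
theorem exists_semigroup (a : ι → ι → ℝ) :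
    ∃ (A : (ι → ℝ) →L[ℝ] (ι → ℝ)) (U : ℝ → (ι → ℝ) →L[ℝ] (ι → ℝ)),
      (∀ x i, A x i = ∑ j, a i j * (x j - x i)) ∧ U 0 = 1 ∧ (∀ s t x, U (s + t) x = U s (U t x)) ∧
        ∀ t, HasDerivAt U (A * U t) t := by
  let L : (ι → ℝ) →ₗ[ℝ] (ι → ℝ) :=
    { toFun := fun x i => ∑ j, a i j * (x j - x i)
      map_add' := by
        intro x y
        funext i
        simp only [Pi.add_apply, ← Finset.sum_add_distrib]
        exact Finset.sum_congr rfl fun j _ => by ring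
      map_smul' := by
        intro s x
        funext i
        simp only [Pi.smul_apply, smul_eq_mul, RingHom.id_apply, Finset.mul_sum]
        exact Finset.sum_congr rfl fun j _ => by ring }
  let A : (ι → ℝ) →L[ℝ] (ι → ℝ) := LinearMap.toContinuousLinearMap L
  refine ⟨A, fun t => NormedSpace.exp (t • A), fun x i => rfl, by simp, fun s t x => ?_,
    fun t => hasDerivAt_exp_smul_const' A t⟩
  let _ : NormedAlgebra ℚ ((ι → ℝ) →L[ℝ] (ι → ℝ)) := NormedAlgebra.restrictScalars ℚ ℝ _
  simp only
  rw [add_smul, NormedSpace.exp_add_of_commute (((Commute.refl A).smul_left s).smul_right t)]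
  rfl

/-- The solution of the linear fast equation `ε y' + L y + φ g = 0` with terminal value zero is
controlled by the exponential average `Y` of `φ`. -/
theorem IsNull.exists_relaxation (hw : IsNull a w) (ha : HasClasses a c) (hpos : ∀ i, 0 < w i)
    {g : ι → ℝ} (hg : ∀ k, ∑ i with c i = k, w i * g i = 0) :
    ∃ γ > 0, ∃ C > 0, ∀ φ : ℝ → ℝ, Continuous φ → (∀ z ≤ 0, 0 ≤ φ z) → ∀ ε > 0,
      ∃ (y : ι → ℝ → ℝ) (Y : ℝ → ℝ),
        (∀ i z, HasDerivAt (y i)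
          (-(ε⁻¹ * (∑ j, a i j * (y j z - y i z) + φ z * g i))) z) ∧
        (∀ z, HasDerivAt Y (ε⁻¹ * (γ * Y z - C * φ z)) z) ∧
        (∀ i, y i 0 = 0) ∧ Y 0 = 0 ∧ (∀ i, ∀ z ≤ 0, |y i z| ≤ Y z) ∧
        ∀ F, ∀ z ≤ 0, (∀ x ∈ Icc z 0, φ x ≤ F) → Y z ≤ C / γ * F := by
  obtain ⟨A, U, hAi, hU0, hUadd, hUd⟩ := exists_semigroup a
  have hUc : Continuous U := continuous_iff_continuousAt.2 fun t => (hUd t).continuousAt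
  have hPd : ∀ x t, HasDerivAt (fun t => U t x) (A (U t x)) t := fun x t =>
    ((hUd t).clm_apply (hasDerivAt_const t x)).congr_deriv (by simp)
  obtain ⟨γ, hγ, C, hC, hdec⟩ := hw.exists_decay ha hpos (P := fun t => U t g)
    (fun i t => (hasDerivAt_pi.1 (hPd g t) i).congr_deriv (hAi _ _)) (by simpa [hU0] using hg)
  clear hw ha hpos hg
  refine ⟨γ, hγ, C, hC, fun φ hφ hφ0 ε hε => ?_⟩
  -- Duhamel's formula is `ε⁻¹ ∫ φ x • U (ε⁻¹ (x - z)) g` over `[z, 0]`. Taking the factor `U (-(ε⁻¹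
  -- z))` out of the integral reduces its `z`-derivative to a product rule; the integral `I` plays
  -- the same role for the scalar majorant `Y`.
  set J : ℝ → (ι → ℝ) := fun z => ∫ x in z..0, φ x • U (ε⁻¹ * x) g with hJ
  have hJc : Continuous fun x => φ x • U (ε⁻¹ * x) g :=
    hφ.smul ((hUc.comp (continuous_const.mul continuous_id)).clm_apply continuous_const)
  have hJd : ∀ z, HasDerivAt J (-(φ z • U (ε⁻¹ * z) g)) z := fun z =>
    intervalIntegral.integral_hasDerivAt_left (hJc.intervalIntegrable _ _)
      (hJc.stronglyMeasurableAtFilter _ _) hJc.continuousAt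
  set I : ℝ → ℝ := fun z => ∫ x in z..0, φ x * Real.exp (-(γ * (ε⁻¹ * x))) with hI
  have hIc : Continuous fun x => φ x * Real.exp (-(γ * (ε⁻¹ * x))) := by fun_prop
  have hId : ∀ z, HasDerivAt I (-(φ z * Real.exp (-(γ * (ε⁻¹ * z))))) z := fun z =>
    intervalIntegral.integral_hasDerivAt_left (hIc.intervalIntegrable _ _)
      (hIc.stronglyMeasurableAtFilter _ _) hIc.continuousAt
  set y : ℝ → ι → ℝ := fun z => ε⁻¹ • U (-(ε⁻¹ * z)) (J z) with hy
  set Y : ℝ → ℝ := fun z => ε⁻¹ * C * (Real.exp (γ * (ε⁻¹ * z)) * I z) with hY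
  have hyd : ∀ z, HasDerivAt y (-(ε⁻¹ • (A (y z) + φ z • g))) z := by
    intro z
    have h1 : HasDerivAt (fun z : ℝ => -(ε⁻¹ * z)) (-ε⁻¹) z :=
      (((hasDerivAt_id z).const_mul ε⁻¹).neg).congr_deriv (by simp)
    have hUz : HasDerivAt (fun z => U (-(ε⁻¹ * z))) (-ε⁻¹ • (A * U (-(ε⁻¹ * z)))) z :=
      HasDerivAt.scomp (g₁ := U) (h := fun z : ℝ => -(ε⁻¹ * z)) z (hUd _) h1
    have h2 : HasDerivAt (fun z => U (-(ε⁻¹ * z)) (J z)) ((-ε⁻¹ • (A * U (-(ε⁻¹ * z)))) (J z) +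
      U (-(ε⁻¹ * z)) (-(φ z • U (ε⁻¹ * z) g))) z := hUz.clm_apply (hJd z)
    refine (h2.const_smul ε⁻¹).congr_deriv ?_
    have h3 : U (-(ε⁻¹ * z)) (U (ε⁻¹ * z) g) = g := by
      rw [← hUadd, neg_add_cancel, hU0, one_apply_eq_self]
    simp only [hy, smul_apply,
      mul_apply_eq_comp, map_neg, map_smul, h3, neg_smul, smul_add, smul_neg, neg_add]
  refine ⟨fun i z => y z i, Y, fun i z => ?_, fun z => ?_, fun i => ?_, ?_, fun i z hz => ?_,
    fun F z hz hF => ?_⟩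
  · have := hasDerivAt_pi.1 (hyd z) i
    refine this.congr_deriv ?_
    simp only [Pi.neg_apply, Pi.smul_apply, Pi.add_apply, smul_eq_mul, hAi]
  · have h1 : HasDerivAt (fun z : ℝ => γ * (ε⁻¹ * z)) (γ * ε⁻¹) z :=
      (((hasDerivAt_id z).const_mul ε⁻¹).const_mul γ).congr_deriv (by simp)
    have h2 := (h1.exp.mul (hId z)).const_mul (ε⁻¹ * C)
    refine h2.congr_deriv ?_
    have h3 : Real.exp (γ * (ε⁻¹ * z)) * Real.exp (-(γ * (ε⁻¹ * z))) = 1 := by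
      rw [← Real.exp_add, add_neg_cancel, Real.exp_zero]
    simp only [hY]
    linear_combination (-(ε⁻¹ * C * φ z)) * h3
  · simp [hy, hJ]
  · simp [hY, hI]
  -- With the factors recombined, the times `ε⁻¹ (x - z)` are nonnegative and the decay estimate
  -- applies under the integral.
  · have h1 : y z i = ε⁻¹ * ∫ x in z..0, φ x * U (ε⁻¹ * (x - z)) g i := by
      have h2 : U (-(ε⁻¹ * z)) (J z) = ∫ x in z..0, φ x • U (ε⁻¹ * (x - z)) g := by
        rw [hJ, ← ContinuousLinearMap.intervalIntegral_comp_comm _ (hJc.intervalIntegrable _ _)]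
        refine intervalIntegral.integral_congr fun x _ => ?_
        simp only [map_smul]
        rw [← hUadd]
        congr 3
        ring
      have h3 : Continuous fun x => φ x • U (ε⁻¹ * (x - z)) g :=
        hφ.smul ((hUc.comp (by fun_prop)).clm_apply continuous_const)
      have h4 := ContinuousLinearMap.intervalIntegral_comp_comm
        (ContinuousLinearMap.proj (R := ℝ) (φ := fun _ : ι => ℝ) i)
        (h3.intervalIntegrable (μ := volume) z 0)
      simp only [hy, Pi.smul_apply, smul_eq_mul, h2]
      rw [show (∫ x in z..0, φ x • U (ε⁻¹ * (x - z)) g) i =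
        ContinuousLinearMap.proj (R := ℝ) (φ := fun _ : ι => ℝ) i
          (∫ x in z..0, φ x • U (ε⁻¹ * (x - z)) g) from rfl, ← h4]
      simp
    have h5 : Y z = ε⁻¹ * ∫ x in z..0, φ x * (C * Real.exp (-(γ * (ε⁻¹ * (x - z))))) := by
      simp only [hY, hI, mul_assoc]
      rw [← intervalIntegral.integral_const_mul, ← intervalIntegral.integral_const_mul]
      congr 1
      refine intervalIntegral.integral_congr fun x _ => ?_
      have : Real.exp (-(γ * (ε⁻¹ * (x - z)))) =
          Real.exp (γ * (ε⁻¹ * z)) * Real.exp (-(γ * (ε⁻¹ * x))) := by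
        rw [← Real.exp_add]
        ring_nf
      rw [this]
      ring
    simp only
    rw [h1, h5, abs_mul, abs_of_pos (inv_pos.2 hε)]
    refine mul_le_mul_of_nonneg_left ?_ (inv_pos.2 hε).le
    rw [← Real.norm_eq_abs]
    refine intervalIntegral.norm_integral_le_of_norm_le hz ?_
      (Continuous.intervalIntegrable (by fun_prop) _ _)
    refine Eventually.of_forall fun x hx => ?_
    rw [norm_mul, Real.norm_eq_abs, Real.norm_eq_abs, abs_of_nonneg (hφ0 x hx.2)]
    exact mul_le_mul_of_nonneg_left
      (hdec _ (mul_nonneg (inv_pos.2 hε).le (sub_nonneg.2 hx.1.le)) i) (hφ0 x hx.2)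
  · have hF0 : 0 ≤ F := (hφ0 z hz).trans (hF z ⟨le_rfl, hz⟩)
    have h1 : I z ≤ ∫ x in z..0, F * Real.exp (-(γ * (ε⁻¹ * x))) := by
      refine intervalIntegral.integral_mono_on hz (hIc.intervalIntegrable _ _)
        (Continuous.intervalIntegrable (by fun_prop) _ _) fun x hx => ?_
      exact mul_le_mul_of_nonneg_right (hF x hx) (Real.exp_pos _).le
    have h2 : ∫ x in z..0, F * Real.exp (-(γ * (ε⁻¹ * x))) =
        F * (ε / γ) * (Real.exp (-(γ * (ε⁻¹ * z))) - 1) := by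
      have hd : ∀ x ∈ uIcc z 0, HasDerivAt
          (fun x => -(F * (ε / γ)) * Real.exp (-(γ * (ε⁻¹ * x))))
          (F * Real.exp (-(γ * (ε⁻¹ * x)))) x := by
        intro x _
        have h3 : HasDerivAt (fun z : ℝ => -(γ * (ε⁻¹ * z))) (-(γ * ε⁻¹)) x :=
          ((((hasDerivAt_id x).const_mul ε⁻¹).const_mul γ).neg).congr_deriv (by simp)
        refine (h3.exp.const_mul (-(F * (ε / γ)))).congr_deriv ?_
        field_simp
      rw [intervalIntegral.integral_eq_sub_of_hasDerivAt hd
        (Continuous.intervalIntegrable (by fun_prop) _ _)]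
      simp
      ring
    have h3 : Real.exp (γ * (ε⁻¹ * z)) * Real.exp (-(γ * (ε⁻¹ * z))) = 1 := by
      rw [← Real.exp_add, add_neg_cancel, Real.exp_zero]
    have h4 := Real.exp_pos (γ * (ε⁻¹ * z))
    have h5 : Real.exp (γ * (ε⁻¹ * z)) * I z ≤ F * (ε / γ) := by
      have h6 := mul_le_mul_of_nonneg_left (h1.trans_eq h2) h4.le
      have h7 : Real.exp (γ * (ε⁻¹ * z)) * (F * (ε / γ) * (Real.exp (-(γ * (ε⁻¹ * z))) - 1)) =
          F * (ε / γ) - F * (ε / γ) * Real.exp (γ * (ε⁻¹ * z)) := by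
        linear_combination (F * (ε / γ)) * h3
      have h8 : 0 ≤ F * (ε / γ) * Real.exp (γ * (ε⁻¹ * z)) := by positivity
      linarith
    calc Y z ≤ ε⁻¹ * C * (F * (ε / γ)) := mul_le_mul_of_nonneg_left h5 (by positivity)
      _ = C / γ * F := by field_simp

end Relaxation

end FastSlow

end

noncomputable section

namespace FastSlow

variable {n m : ℕ} {q : Fin n → Fin n → ℝ → ℝ} {v : Fin n → ℝ → ℝ} {qbar : Fin n → Fin n → ℝ}
  {φ : ℝ → ℝ} {a b Q ε θ l r : ℝ}

/-! ### The passage through the vertex -/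

namespace IsModel

theorem exitProb_sum (M : IsModel m q v qbar φ a b Q) :
    exitProb m q v 0 + exitProb m q v 1 = 1 := by
  have hpos : 0 < ∑ i, piLim q i * v i 0 := by
    obtain ⟨i, -⟩ := M.exists_cls 0
    exact Finset.sum_pos (fun i _ => mul_pos (M.pi_pos i) ((M.speed i).speed_pos 0))
      ⟨i, Finset.mem_univ i⟩
  rw [exitProb, exitProb, ← add_div, ← sum_univ_eq_sum_R, div_self hpos.ne']

theorem exitProb_nonneg (M : IsModel m q v qbar φ a b Q) (k : Fin 2) : 0 ≤ exitProb m q v k :=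
  div_nonneg (Finset.sum_nonneg fun i _ => (mul_pos (M.pi_pos i) ((M.speed i).speed_pos 0)).le)
    (Finset.sum_nonneg fun i _ => (mul_pos (M.pi_pos i) ((M.speed i).speed_pos 0)).le)

theorem exitProb_le_one (M : IsModel m q v qbar φ a b Q) (k : Fin 2) : exitProb m q v k ≤ 1 := by
  have h := M.exitProb_sum
  have h0 := M.exitProb_nonneg 0
  have h1 := M.exitProb_nonneg 1
  rcases (show k = 0 ∨ k = 1 by omega) with rfl | rfl <;> linarith

/-- The chain of classes has two states, equal flows in both directions by the balance of `π`, and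
weights given by the class sums of `π i * v i 0`. The indicator of `k` minus its stationary
probability is an eigenvector, with eigenvalue `-κ`; hence adding `κ * s i` centres the drift on
each class. -/
theorem exists_class_drift (M : IsModel m q v qbar φ a b Q) (k : Fin 2) {s : Fin n → ℝ}
    (hs : ∀ i, s i = (if cls m i = k then 1 else 0) - exitProb m q v k) :
    ∃ κ > 0, ∀ k', ∑ i with cls m i = k', piLim q i * v i 0 *
      ((∑ j with cls m j ≠ cls m i, qbar i j * (s j - s i)) / v i 0 + κ * s i) = 0 := by
  set W : Fin 2 → ℝ := fun k => ∑ i ∈ R m k, piLim q i * v i 0 with hW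
  set K : Fin 2 → ℝ := fun k => ∑ i ∈ R m k, piLim q i * ∑ j with cls m j ≠ cls m i, qbar i j
    with hK
  have hWpos : ∀ k, 0 < W k := by
    intro k
    obtain ⟨i, hi⟩ := M.exists_cls k
    exact Finset.sum_pos (fun i _ => mul_pos (M.pi_pos i) ((M.speed i).speed_pos 0))
      ⟨i, by simp [R, hi]⟩
  have hKpos : 0 < K 0 := by
    obtain ⟨i, hi⟩ := M.exists_cls 0
    obtain ⟨j, hj⟩ := M.exists_cls 1
    refine Finset.sum_pos (fun i hi => mul_pos (M.pi_pos i) (Finset.sum_pos (fun j hj => ?_) ?_))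
      ⟨i, by simp [R, hi]⟩
    · refine M.qbar_pos i j ?_
      rintro rfl
      exact (Finset.mem_filter.1 hj).2 rfl
    · refine ⟨j, ?_⟩
      have : cls m i = 0 := (Finset.mem_filter.1 hi).2
      simp [hj, this]
  -- This is the cross balance satisfied by `π`.
  have hKeq : K 1 = K 0 := by
    have h := M.tendsto_muNeg.2.2.2
    unfold CrossBalance at h
    have hc : (R m 0 : Finset (Fin n))ᶜ = R m 1 := by
      ext i
      simp only [R, Finset.mem_compl, Finset.mem_filter, Finset.mem_univ, true_and]
      omega
    have h0 : K 0 = ∑ j ∈ R m 0, ∑ i ∈ (R m 0)ᶜ, piLim q j * qbar j i := by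
      refine Finset.sum_congr rfl fun j hj => ?_
      rw [Finset.mul_sum]
      refine Finset.sum_congr ?_ fun _ _ => rfl
      have : cls m j = 0 := (Finset.mem_filter.1 hj).2
      ext i
      simp [R, this]
    have h1 : K 1 = ∑ j ∈ R m 0, ∑ i ∈ (R m 0)ᶜ, piLim q i * qbar i j := by
      rw [Finset.sum_comm, hc]
      refine Finset.sum_congr rfl fun j hj => ?_
      rw [Finset.mul_sum]
      refine Finset.sum_congr ?_ fun _ _ => rfl
      have : cls m j = 1 := (Finset.mem_filter.1 hj).2
      ext i
      simp only [R, this, Finset.mem_filter, Finset.mem_univ, true_and]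
      omega
    simp only [Finset.sum_sub_distrib] at h
    linarith
  have hp : exitProb m q v k = W k / (W 0 + W 1) := by
    rw [exitProb, sum_univ_eq_sum_R m]
  have hW0 := hWpos 0
  have hW1 := hWpos 1
  -- The sum of the two rates `K / W 0` and `K / W 1` of the chain of classes.
  refine ⟨K 0 * (W 0 + W 1) / (W 0 * W 1), by positivity, fun k' => ?_⟩
  have hterm : ∀ (τ σ : ℝ), (∀ i ∈ R m k', s i = τ ∧ ∀ j, cls m j ≠ cls m i → s j - s i = σ) →
      ∀ κ : ℝ, ∑ i with cls m i = k', piLim q i * v i 0 *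
        ((∑ j with cls m j ≠ cls m i, qbar i j * (s j - s i)) / v i 0 + κ * s i) =
        σ * K k' + κ * τ * W k' := by
    intro τ σ h κ
    simp only [hK, hW, Finset.mul_sum, ← Finset.sum_add_distrib]
    refine Finset.sum_congr rfl fun i hi => ?_
    obtain ⟨h1, h2⟩ := h i hi
    have hv := ((M.speed i).speed_pos 0).ne'
    have h3 : ∑ j with cls m j ≠ cls m i, qbar i j * (s j - s i) =
        σ * ∑ j with cls m j ≠ cls m i, qbar i j := by
      rw [Finset.mul_sum]
      refine Finset.sum_congr rfl fun j hj => ?_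
      rw [h2 j (Finset.mem_filter.1 hj).2, mul_comm]
    rw [h3, h1, ← Finset.mul_sum, ← Finset.mul_sum]
    field_simp
  by_cases hk : k' = k
  · rw [hterm (1 - exitProb m q v k) (-1) fun i hi => ?_, hp, hk]
    · rcases (show k = 0 ∨ k = 1 by omega) with rfl | rfl
      · field_simp
        ring
      · rw [hKeq]
        field_simp
        ring
    · have hi' : cls m i = k := hk ▸ (Finset.mem_filter.1 hi).2
      refine ⟨by simp [hs, hi'], fun j hj => ?_⟩
      rw [hi'] at hj
      simp only [hs, hi', hj, if_true, if_false]
      ring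
  · rw [hterm (-exitProb m q v k) 1 fun i hi => ?_, hp]
    · rcases (show k = 0 ∧ k' = 1 ∨ k = 1 ∧ k' = 0 by omega) with ⟨rfl, rfl⟩ | ⟨rfl, rfl⟩
      · rw [hKeq]
        field_simp
        ring
      · field_simp
        ring
    · have hi' : cls m i = k' := (Finset.mem_filter.1 hi).2
      refine ⟨by simp [hs, hi', hk], fun j hj => ?_⟩
      rw [hi'] at hj
      have : cls m j = k := by omega
      simp [hs, hi', hk, this]

/-- The error in the rates between classes must be small relative to `φ z`, because those rates are
themselves of that order; inside the classes a plain `η` suffices. -/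
theorem eventually_rates (M : IsModel m q v qbar φ a b Q) {η : ℝ} (hη : 0 < η) :
    ∀ᶠ z in 𝓝[<] (0 : ℝ), (∀ i j, |rate q z i j / v i z - rate q 0 i j / v i 0| ≤ η) ∧
      (∀ i j, cls m i ≠ cls m j →
        |rate q z i j / v i z - φ z * (qbar i j / v i 0)| ≤ η * φ z) ∧ φ z ≤ η := by
  have hv := fun i z => ((M.speed i).speed_pos z).ne'
  refine Eventually.and ?_ (Eventually.and ?_ ?_)
  · refine eventually_all.2 fun i => eventually_all.2 fun j => ?_
    have hc : Continuous fun z => |rate q z i j / v i z - rate q 0 i j / v i 0| :=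
      (((M.rate_continuous i j).div (M.v_cont i) (hv i)).sub continuous_const).abs
    have := (hc.tendsto 0).eventually_lt_const (u := η) (by simpa using hη)
    exact (this.filter_mono nhdsWithin_le_nhds).mono fun z h => h.le
  · refine eventually_all.2 fun i => eventually_all.2 fun j => ?_
    by_cases hij : cls m i ≠ cls m j
    · have h1 := (M.tendsto_rate_div hij).div
        (((M.v_cont i).tendsto 0).mono_left nhdsWithin_le_nhds) (hv i 0)
      have h2 := (h1.sub_const (qbar i j / v i 0)).abs.eventually_lt_const (u := η)
        (by simpa using hη)
      filter_upwards [h2, self_mem_nhdsWithin] with z hz hz0 _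
      have hφ := M.φ_pos z hz0
      have e : rate q z i j / v i z - φ z * (qbar i j / v i 0) =
          φ z * (rate q z i j / φ z / v i z - qbar i j / v i 0) := by
        field_simp
      rw [e, abs_mul, abs_of_pos hφ, mul_comm]
      exact mul_le_mul_of_nonneg_right hz.le hφ.le
    · exact Eventually.of_forall fun z h => absurd h hij
  · have := (M.φ_cont.tendsto 0).eventually_lt_const (u := η) (by simpa [M.φ_zero] using hη)
    exact (this.filter_mono nhdsWithin_le_nhds).mono fun z h => h.le

/-- For the process started at distance `δ` from the vertex, the probability of leaving the vertex
through the edge `k` is asymptotically at most `exitProb k`, up to an error vanishing with `δ`. -/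
theorem upperBound_vertex (M : IsModel m q v qbar φ a b Q) (θ : ℝ) (k : Fin 2) {η : ℝ}
    (hη : 0 < η) : ∀ᶠ δ in 𝓝[>] (0 : ℝ), UpperBound q v θ (-δ) 0
      (fun i => if cls m i = k then 1 else 0) fun _ => exitProb m q v k + η := by
  set p := exitProb m q v k with hp
  have hp0 : 0 ≤ p := M.exitProb_nonneg k
  have hp1 : p ≤ 1 := M.exitProb_le_one k
  set s : Fin n → ℝ := fun i => (if cls m i = k then 1 else 0) - p with hs
  have hsp : ∀ i, -p ≤ s i ∧ s i ≤ 1 := by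
    intro i
    simp only [hs]
    split_ifs <;> constructor <;> linarith
  obtain ⟨κ, hκ, hdrift⟩ := M.exists_class_drift k (s := s) fun i => rfl
  set g : Fin n → ℝ := fun i =>
    (∑ j with cls m j ≠ cls m i, qbar i j * (s j - s i)) / v i 0 + κ * s i with hg
  have hv := fun i z => (M.speed i).speed_pos z
  have hnull : IsNull (fun i j => rate q 0 i j / v i 0) fun i => piLim q i * v i 0 := by
    intro j
    refine Eq.trans ?_ (M.pi_null j)
    refine Finset.sum_congr rfl fun i _ => ?_
    have h1 := (hv i 0).ne'
    have h2 := (hv j 0).ne'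
    field_simp
  have hclass : HasClasses (fun i j => rate q 0 i j / v i 0) (cls m) := by
    have h := M.hasClasses_nonneg le_rfl
    exact ⟨fun i j => div_nonneg (h.nonneg i j) (hv i 0).le,
      fun i j h1 h2 => div_pos (h.pos i j h1 h2) (hv i 0), fun i j h1 => by simp [h.zero i j h1]⟩
  obtain ⟨γ, hγ, C, hC, hrelax⟩ := hnull.exists_relaxation hclass
    (fun i => mul_pos (M.pi_pos i) (hv i 0)) (g := g) hdrift
  set ρ := |θ| / a with hρ
  have hρ0 : 0 ≤ ρ := div_nonneg (abs_nonneg _) M.a_pos.le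
  obtain ⟨η₁, hη₁, hsmall⟩ : ∃ η₁ > 0, Real.exp (ρ * η₁) * (p + (1 + 2 * n * η₁ / γ) * η₁ +
      η₁ * (1 + η₁) + (κ * η₁ + n * η₁ + 2 * n * η₁ / γ * C) / κ) ≤ p + η := by
    have hc : Continuous fun η₁ : ℝ => Real.exp (ρ * η₁) * (p + (1 + 2 * n * η₁ / γ) * η₁ +
      η₁ * (1 + η₁) + (κ * η₁ + n * η₁ + 2 * n * η₁ / γ * C) / κ) := by fun_prop
    have := (hc.tendsto 0).eventually_lt_const (u := p + η) (by simpa using hη)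
    obtain ⟨η₁, h1, h2⟩ := ((this.filter_mono nhdsWithin_le_nhds).and
      (self_mem_nhdsWithin (s := Ioi (0 : ℝ)))).exists
    exact ⟨η₁, h2, h1.le⟩
  -- `B` is chosen so that the decay of `Y` absorbs the error of freezing the rates at the vertex,
  -- and `A` so that the terms proportional to `φ` are absorbed, including `B * C` created by `B`
  -- itself.
  set B := 2 * n * η₁ / γ with hB
  set A := (κ * η₁ + n * η₁ + B * C) / κ with hA
  have hB0 : 0 ≤ B := by positivity
  have hA0 : 0 ≤ A := by positivity
  have hAκ : A * κ = κ * η₁ + n * η₁ + B * C := div_mul_cancel₀ _ hκ.ne'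
  have hBγ : B * γ = 2 * n * η₁ := div_mul_cancel₀ _ hγ.ne'
  -- With `φ ≤ F` on `[-δ, 0]` the majorant `Y` of the corrector stays below `η₁`, uniformly in `ε`.
  set F := min η₁ (η₁ * (γ / C)) with hF
  have hF0 : 0 < F := lt_min hη₁ (by positivity)
  have hF1 : C / γ * F ≤ η₁ := by
    calc C / γ * F ≤ C / γ * (η₁ * (γ / C)) :=
          mul_le_mul_of_nonneg_left (min_le_right _ _) (by positivity)
      _ = η₁ := by field_simp
  obtain ⟨δ₀, hδ₀, hrates⟩ := mem_nhdsLT_iff_exists_Ioo_subset.1 (M.eventually_rates hF0)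
  replace hδ₀ : δ₀ < 0 := hδ₀
  have hδpos : (0 : ℝ) < min (-δ₀) η₁ := lt_min (neg_pos.2 hδ₀) hη₁
  filter_upwards [Ioo_mem_nhdsGT hδpos] with δ hδ
  have hδ0 : 0 < δ := hδ.1
  have hδ1 : δ < -δ₀ := hδ.2.trans_le (min_le_left _ _)
  have hδ2 : δ ≤ η₁ := (hδ.2.trans_le (min_le_right _ _)).le
  have hrates' : ∀ z, -δ ≤ z → z < 0 →
      (∀ i j, |rate q z i j / v i z - rate q 0 i j / v i 0| ≤ F) ∧
      (∀ i j, cls m i ≠ cls m j →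
        |rate q z i j / v i z - φ z * (qbar i j / v i 0)| ≤ F * φ z) ∧ φ z ≤ F :=
    fun z h1 h2 => hrates ⟨by linarith, h2⟩
  have hφ0 : ∀ z ≤ 0, 0 ≤ φ z := fun z hz => by
    rcases hz.lt_or_eq with h | rfl
    · exact (M.φ_pos z h).le
    · exact M.φ_zero.ge
  have hφF : ∀ z, -δ ≤ z → z ≤ 0 → φ z ≤ F := fun z h1 h2 => by
    rcases h2.lt_or_eq with h | rfl
    · exact (hrates' z h1 h).2.2
    · exact M.φ_zero.trans_le hF0.le
  have hInt : 0 < ∫ x in (-δ)..0, φ x :=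
    intervalIntegral.intervalIntegral_pos_of_pos_on (M.φ_cont.intervalIntegrable _ _)
      (fun x hx => M.φ_pos x hx.2) (by linarith)
  intro η₂ hη₂
  -- Loss of memory: for fixed `δ` the integral of `φ` is positive, so the initial class is
  -- forgotten as `ε` vanishes, at whatever rate `φ` degenerates.
  have hψlim : ∀ᶠ ε in 𝓝[>] (0 : ℝ), Real.exp (-(ε⁻¹ * (κ * ∫ x in (-δ)..0, φ x))) ≤ η₁ := by
    have h1 := (tendsto_inv_nhdsGT_zero (𝕜 := ℝ)).atTop_mul_const (mul_pos hκ hInt)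
    exact (Real.tendsto_exp_neg_atTop_nhds_zero.comp h1).eventually_le_const hη₁
  filter_upwards [hψlim, self_mem_nhdsWithin] with ε hψδ hε
  replace hε : 0 < ε := hε
  obtain ⟨y, Y, hyd, hYd, hy0, hY0, hyY, hYF⟩ := hrelax φ M.φ_cont hφ0 ε hε
  set ψ : ℝ → ℝ := fun z => Real.exp (-(ε⁻¹ * (κ * ∫ x in z..0, φ x))) with hψ
  have hψd : ∀ z, HasDerivAt ψ (ψ z * (ε⁻¹ * (κ * φ z))) z := by
    intro z
    have h1 : HasDerivAt (fun z => ∫ x in z..0, φ x) (-φ z) z :=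
      intervalIntegral.integral_hasDerivAt_left (M.φ_cont.intervalIntegrable _ _)
        (M.φ_cont.stronglyMeasurableAtFilter _ _) M.φ_cont.continuousAt
    refine (((h1.const_mul κ).const_mul ε⁻¹).neg.exp).congr_deriv ?_
    simp only [hψ, Pi.neg_apply]
    ring
  have hψpos : ∀ z, 0 < ψ z := fun z => Real.exp_pos _
  have hψ1 : ∀ z ≤ 0, ψ z ≤ 1 := by
    intro z hz
    have h1 : 0 ≤ ∫ x in z..0, φ x :=
      intervalIntegral.integral_nonneg hz fun x hx => hφ0 x hx.2
    rw [hψ, Real.exp_le_one_iff]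
    have : 0 ≤ ε⁻¹ * (κ * ∫ x in z..0, φ x) := by positivity
    linarith
  have hY1 : ∀ z, -δ ≤ z → z ≤ 0 → Y z ≤ η₁ := fun z h1 h2 =>
    (hYF F z h2 fun x hx => hφF x (h1.trans hx.1) hx.2).trans hF1
  have hYnn : ∀ i : Fin n, ∀ z ≤ 0, 0 ≤ Y z := fun i z hz => (abs_nonneg _).trans (hyY i z hz)
  -- The main part is `p + ψ * (s i + y i)`. It equals the indicator of the class `k` at `0`, where
  -- `ψ = 1` and `y = 0`, and is close to `p` at `-δ`. The terms with `A` and `B` make the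
  -- inequality strict enough to absorb errors, and `(1 + B) * η₁` keeps the function nonnegative.
  set f : Fin n → ℝ → ℝ := fun i z =>
    p + (1 + B) * η₁ + ψ z * (s i + y i z) + A * (1 - ψ z) - B * (ψ z * Y z) with hf
  set f' : Fin n → ℝ → ℝ := fun i z => ε⁻¹ * (ψ z * (κ * φ z * (s i + y i z) -
    (∑ j, rate q 0 i j / v i 0 * (y j z - y i z) + φ z * g i) - A * κ * φ z -
    B * (κ * φ z * Y z) - B * (γ * Y z - C * φ z))) with hf'
  have hfd : ∀ i z, HasDerivAt (f i) (f' i z) z := by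
    intro i z
    have h1 := (((((hψd z).mul ((hyd i z).const_add (s i))).const_add (p + (1 + B) * η₁)).add
      (((hψd z).const_sub 1).const_mul A)).sub (((hψd z).mul (hYd z)).const_mul B))
    refine h1.congr_deriv ?_
    simp only [hf']
    ring
  have hfnn : ∀ i z, z ∈ Icc (-δ) 0 → 0 ≤ f i z := by
    intro i z hz
    have h1 := hY1 z hz.1 hz.2
    have h2 := (abs_le.1 (hyY i z hz.2)).1
    have h3 := hψpos z
    have h4 := hψ1 z hz.2
    have h5 := (hsp i).1
    have h6 : 0 ≤ A * (1 - ψ z) := mul_nonneg hA0 (by linarith)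
    have h7 : ψ z * (s i + y i z) ≥ -p - η₁ := by
      have : ψ z * (s i + y i z) ≥ ψ z * (-(p + η₁)) :=
        mul_le_mul_of_nonneg_left (by linarith) h3.le
      have h8 : ψ z * (p + η₁) ≤ 1 * (p + η₁) := mul_le_mul_of_nonneg_right h4 (by linarith)
      linarith
    have h9 : B * (ψ z * Y z) ≤ B * η₁ := by
      refine mul_le_mul_of_nonneg_left ?_ hB0
      have := mul_le_mul h4 h1 (hYnn i z hz.2) zero_le_one
      linarith
    simp only [hf]
    linarith
  have hfineq : ∀ i z, z ∈ Ioo (-δ) 0 →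
      v i z * f' i z ≤ -(ε⁻¹ * ∑ j, rate q z i j * (f j z - f i z)) := by
    intro i z hz
    obtain ⟨hr1, hr2, -⟩ := hrates' z hz.1.le hz.2
    have hFη : F ≤ η₁ := min_le_left _ _
    have hφz := (M.φ_pos z hz.2)
    have hYz := hYnn i z hz.2.le
    have hsum : ∑ j, rate q z i j * (f j z - f i z) = v i z * (ψ z *
        (∑ j, rate q z i j / v i z * (s j - s i) +
          ∑ j, rate q z i j / v i z * (y j z - y i z))) := by
      rw [← Finset.sum_add_distrib, Finset.mul_sum, Finset.mul_sum]
      refine Finset.sum_congr rfl fun j _ => ?_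
      have := (hv i z).ne'
      simp only [hf]
      field_simp
      ring
    have hS : ∑ j, rate q z i j / v i z * (s j - s i) ≤ φ z * (g i - κ * s i) + n * η₁ * φ z := by
      have h1 : φ z * (g i - κ * s i) = ∑ j, if cls m j ≠ cls m i then
          φ z * (qbar i j / v i 0) * (s j - s i) else 0 := by
        rw [← Finset.sum_filter]
        simp only [hg, add_sub_cancel_right]
        rw [Finset.sum_div, Finset.mul_sum]
        exact Finset.sum_congr rfl fun j _ => by ring
      have h2 : (n : ℝ) * η₁ * φ z = ∑ _j : Fin n, η₁ * φ z := by
        simp [mul_assoc]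
      rw [h1, h2, ← Finset.sum_add_distrib]
      refine Finset.sum_le_sum fun j _ => ?_
      by_cases hij : cls m j ≠ cls m i
      · rw [if_pos hij]
        have h3 := hr2 i j (Ne.symm hij)
        have h4 : |s j - s i| ≤ 1 := by
          simp only [hs, sub_sub_sub_cancel_right]
          split_ifs <;> norm_num
        have h5 : (rate q z i j / v i z - φ z * (qbar i j / v i 0)) * (s j - s i) ≤
            η₁ * φ z := by
          refine (le_abs_self _).trans ?_
          rw [abs_mul]
          have h6 := mul_le_mul h3 h4 (abs_nonneg _) (mul_nonneg hF0.le hφz.le)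
          have h7 := mul_le_mul_of_nonneg_right hFη hφz.le
          linarith
        linarith
      · rw [if_neg hij]
        have : s j = s i := by
          rw [not_not] at hij
          simp only [hs, hij]
        rw [this, sub_self, mul_zero]
        positivity
    -- The corrector was built with the rates frozen at the vertex; replacing these by the actual
    -- ones costs a small multiple of `Y`.
    have hR : ∑ j, rate q z i j / v i z * (y j z - y i z) ≤
        ∑ j, rate q 0 i j / v i 0 * (y j z - y i z) + 2 * n * η₁ * Y z := by
      have h2 : 2 * (n : ℝ) * η₁ * Y z = ∑ _j : Fin n, η₁ * (2 * Y z) := by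
        simp only [Finset.sum_const, Finset.card_univ, Fintype.card_fin, nsmul_eq_mul]
        ring
      rw [h2, ← Finset.sum_add_distrib]
      refine Finset.sum_le_sum fun j _ => ?_
      have h3 := (hr1 i j).trans hFη
      have h4 : |y j z - y i z| ≤ 2 * Y z :=
        (abs_sub _ _).trans (by linarith [hyY i z hz.2.le, hyY j z hz.2.le])
      have h5 : (rate q z i j / v i z - rate q 0 i j / v i 0) * (y j z - y i z) ≤
          η₁ * (2 * Y z) := by
        refine (le_abs_self _).trans ?_
        rw [abs_mul]
        exact mul_le_mul h3 h4 (abs_nonneg _) hη₁.le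
      linarith
    have hyη : y i z ≤ η₁ := (le_abs_self _).trans ((hyY i z hz.2.le).trans (hY1 z hz.1.le hz.2.le))
    set T := κ * φ z * (s i + y i z) -
      (∑ j, rate q 0 i j / v i 0 * (y j z - y i z) + φ z * g i) - A * κ * φ z -
      B * (κ * φ z * Y z) - B * (γ * Y z - C * φ z) with hT
    -- The main terms cancel, the class drift against `g - κ * s` and the frozen generator against
    -- the equation of `y`. What remains is bounded by small multiples of `φ` and of `Y`, which `A`
    -- and `B` were chosen to cover.
    have hmain : T + (∑ j, rate q z i j / v i z * (s j - s i) +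
          ∑ j, rate q z i j / v i z * (y j z - y i z)) ≤ 0 := by
      have h1 : κ * φ z * y i z ≤ κ * φ z * η₁ := mul_le_mul_of_nonneg_left hyη (by positivity)
      have h2 : 0 ≤ B * (κ * φ z * Y z) := by positivity
      have h3 : A * κ * φ z = (κ * η₁ + n * η₁ + B * C) * φ z := by rw [hAκ]
      have h4 : B * γ * Y z = 2 * n * η₁ * Y z := by rw [hBγ]
      rw [hT]
      linarith
    have h1 : 0 ≤ ε⁻¹ * (v i z * ψ z) :=
      mul_nonneg (inv_pos.2 hε).le (mul_nonneg (hv i z).le (hψpos z).le)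
    have h2 := mul_nonpos_of_nonneg_of_nonpos h1 hmain
    rw [hsum]
    simp only [hf', ← hT]
    linarith
  -- The exponential factor takes care of the discount `θ`; as `δ ≤ η₁` it costs at most `exp (ρ *
  -- η₁)`.
  refine ⟨fun i z => Real.exp (ρ * (0 - z)) * f i z, ?_, fun i => ?_, fun i => ?_⟩
  · have hed : ∀ z, HasDerivAt (fun z => Real.exp (ρ * (0 - z)))
        (-(ρ * Real.exp (ρ * (0 - z)))) z := fun z => by
      refine (((hasDerivAt_id z).const_sub 0).const_mul ρ).exp.congr_deriv ?_
      simp only [id]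
      ring
    have hd : ∀ i z, HasDerivAt (fun z => Real.exp (ρ * (0 - z)) * f i z)
        (-(ρ * Real.exp (ρ * (0 - z))) * f i z + Real.exp (ρ * (0 - z)) * f' i z) z :=
      fun i z => (hed z).mul (hfd i z)
    refine M.isSuper_of_deriv ε (fun i z hz => mul_nonneg (Real.exp_pos _).le (hfnn i z hz))
      (fun i => continuous_iff_continuousAt.2 fun z => (hd i z).continuousAt)
      (fun i z _ => hd i z) fun i z hz => ?_
    have h1 := hfineq i z hz
    have h2 := hfnn i z (Ioo_subset_Icc_self hz)
    have hsum : ∑ j, rate q z i j * (Real.exp (ρ * (0 - z)) * f j z -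
        Real.exp (ρ * (0 - z)) * f i z) =
        Real.exp (ρ * (0 - z)) * ∑ j, rate q z i j * (f j z - f i z) := by
      rw [Finset.mul_sum]
      exact Finset.sum_congr rfl fun j _ => by ring
    rw [hsum]
    have h3 : -(ρ * v i z) ≤ θ := by
      have h4 := mul_le_mul_of_nonneg_left ((M.speed i).lower z) hρ0
      rw [hρ, div_mul_cancel₀ _ M.a_pos.ne'] at h4
      linarith [neg_abs_le θ]
    have h4 := mul_le_mul_of_nonneg_right h3 h2
    have h5 : v i z * f' i z - ρ * v i z * f i z ≤
        θ * f i z - ε⁻¹ * ∑ j, rate q z i j * (f j z - f i z) := by linarith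
    have h6 := mul_le_mul_of_nonneg_left h5 (Real.exp_pos (ρ * (0 - z))).le
    linarith
  · have h1 : ψ 0 = 1 := by simp [hψ]
    have h2 : 0 ≤ (1 + B) * η₁ := by positivity
    simp only [hf, hs, h1, hy0, hY0, sub_self, mul_zero, Real.exp_zero, one_mul]
    split_ifs <;> linarith
  · have h1 := hY1 (-δ) le_rfl (by linarith)
    have h2 := (le_abs_self _).trans (hyY i (-δ) (by linarith))
    have h3 := hψpos (-δ)
    have h4 : ψ (-δ) ≤ η₁ := hψδ
    have h5 : f i (-δ) ≤ p + (1 + B) * η₁ + η₁ * (1 + η₁) + A := by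
      have h6 : ψ (-δ) * (s i + y i (-δ)) ≤ η₁ * (1 + η₁) := by
        calc ψ (-δ) * (s i + y i (-δ)) ≤ ψ (-δ) * (1 + η₁) :=
              mul_le_mul_of_nonneg_left (by linarith [(hsp i).2]) h3.le
          _ ≤ η₁ * (1 + η₁) := mul_le_mul_of_nonneg_right h4 (by linarith)
      have h7 : 0 ≤ B * (ψ (-δ) * Y (-δ)) :=
        mul_nonneg hB0 (mul_nonneg h3.le (hYnn i (-δ) (by linarith)))
      have h8 : 0 ≤ A * ψ (-δ) := mul_nonneg hA0 h3.le
      simp only [hf]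
      linarith
    have h6 : Real.exp (ρ * (0 - -δ)) ≤ Real.exp (ρ * η₁) :=
      Real.exp_le_exp.2 (mul_le_mul_of_nonneg_left (by linarith) hρ0)
    have h7 := mul_le_mul h6 h5 (hfnn i (-δ) ⟨le_rfl, by linarith⟩) (Real.exp_pos _).le
    linarith

end IsModel

end FastSlow

end

noncomputable section

namespace FastSlow

variable {n m : ℕ} {q : Fin n → Fin n → ℝ → ℝ} {v : Fin n → ℝ → ℝ} {qbar : Fin n → Fin n → ℝ}
  {φ : ℝ → ℝ} {a b Q ε θ l r : ℝ} {g c c' : Fin n → ℝ}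

/-! ### Passage to a level -/

theorem UpperBound.mono (h : UpperBound q v θ l r g c) (hc : ∀ i, c i ≤ c' i) :
    UpperBound q v θ l r g c' := fun η hη =>
  (h η hη).mono fun _ ⟨u, h1, h2, h3⟩ => ⟨u, h1, h2, fun i => (h3 i).trans (by linarith [hc i])⟩

theorem UpperBound.const_mul (h : UpperBound q v θ l r g c) {K : ℝ} (hK : 0 < K) :
    UpperBound q v θ l r (fun i => K * g i) fun i => K * c i := by
  intro η hη
  refine (h (η / K) (div_pos hη hK)).mono fun ε ⟨u, h1, h2, h3⟩ =>
    ⟨_, IsModel.isSuper_const_mul hK.le h1, fun i => mul_le_mul_of_nonneg_left (h2 i) hK.le,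
      fun i => ?_⟩
  have := mul_le_mul_of_nonneg_left (h3 i) hK.le
  rwa [mul_add, mul_div_cancel₀ _ hK.ne'] at this

theorem IsSpeed.clock_sub_congr {V W : ℝ → ℝ} (hV : IsSpeed V a b) (hW : IsSpeed W a b)
    (hlr : l ≤ r) (h : ∀ z ∈ Icc l r, V z = W z) :
    clock V r - clock V l = clock W r - clock W l := by
  rw [hV.clock_sub, hW.clock_sub]
  refine intervalIntegral.integral_congr fun z hz => ?_
  rw [uIcc_of_le hlr] at hz
  simp only [h z hz]

theorem IsSpeed.of_continuous {V : ℝ → ℝ} (h0 : 0 < a) (hV : Continuous V)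
    (h : ∀ z, a ≤ V z ∧ V z ≤ b) : IsSpeed V a b :=
  ⟨h0, fun z => (h z).1, fun z => (h z).2, hV.measurable, fun _ => hV.continuousWithinAt⟩

namespace IsModel

theorem continuous_avgSpeed_min (M : IsModel m q v qbar φ a b Q) (k : Fin 2) (hr : r < 0) :
    Continuous fun z => avgSpeed m q v k (min z r) := by
  have : (fun z => avgSpeed m q v k (min z r)) =
      (fun z => ∑ i, v i z * mu m q z i) ∘ fun z => min z r := by
    funext z
    exact avgSpeed_of_neg k ((min_le_right _ _).trans_lt hr)
  rw [this]
  exact M.continuous_avg_neg.comp (by fun_prop)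

theorem continuous_avgSpeed_max (M : IsModel m q v qbar φ a b Q) (k : Fin 2) :
    Continuous fun z => avgSpeed m q v k (max z 0) := by
  have : (fun z => avgSpeed m q v k (max z 0)) =
      (fun z => (piBar m q k)⁻¹ * ∑ i ∈ R m k, v i z * mu m q z i) ∘ fun z => max z 0 := by
    funext z
    exact avgSpeed_of_nonneg k (le_max_right _ _)
  rw [this]
  exact (M.continuous_avg_nonneg k).comp (by fun_prop)

/-- All states form one class here. The Poisson equation is solvable because the averaged speed is
the `μ z`-mean of the speeds. Composition with `min z r` keeps the speed continuous on the whole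
line. -/
theorem upperBound_neg (M : IsModel m q v qbar φ a b Q) (θ : ℝ) (k : Fin 2) (hlr : l ≤ r)
    (hr : r < 0) {c : ℝ} (hc : 0 ≤ c) :
    UpperBound q v θ l r (fun _ => c) fun _ =>
      c * Real.exp (-(θ * (clock (avgSpeed m q v k) r - clock (avgSpeed m q v k) l))) := by
  have hS := M.avgSpeed_isSpeed k
  set V : ℝ → ℝ := fun z => avgSpeed m q v k (min z r) with hV
  have hVS : IsSpeed V a b := IsSpeed.of_continuous M.a_pos (M.continuous_avgSpeed_min k hr)
    fun z => ⟨hS.lower _, hS.upper _⟩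
  have hVz : ∀ z ∈ Icc l r, V z = avgSpeed m q v k z := fun z hz => by
    simp only [hV, min_eq_left hz.2]
  rw [← hVS.clock_sub_congr hS hlr hVz]
  refine M.upperBound_average hlr θ (V := fun _ => V)
    (fun _ => M.continuous_avgSpeed_min k hr) (fun _ z => hS.lower _) (fun _ => hc)
    (fun _ _ _ _ _ => ⟨rfl, rfl⟩) fun z hz => ?_
  have hz0 : z < 0 := hz.2.trans_lt hr
  have hinv := isInvariant_iff.1 (M.mu_invariant z)
  refine hinv.2.2.exists_poisson (M.hasClasses_neg hz0) (fun i => M.mu_pos z i) fun _ => ?_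
  have hne := (hVS.speed_pos z).ne'
  have h1 : ∑ i, v i z * mu m q z i = V z := by rw [hVz z hz, avgSpeed_of_neg k hz0]
  have h2 : ∑ i, mu m q z i * (θ * (1 - v i z / V z)) =
      θ * ∑ i, mu m q z i - θ * (V z)⁻¹ * ∑ i, v i z * mu m q z i := by
    rw [Finset.mul_sum, Finset.mul_sum, ← Finset.sum_sub_distrib]
    exact Finset.sum_congr rfl fun i _ => by ring
  simp only [Finset.filter_true]
  rw [h2, h1, hinv.2.1]
  field_simp
  ring

/-- The classes do not communicate, so each is averaged with its own speed and the weight `f` may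
depend on the class. The left end `0` is admitted because the averaged speeds are continuous on `[0,
∞)`. -/
theorem upperBound_nonneg (M : IsModel m q v qbar φ a b Q) (θ : ℝ) (hl : 0 ≤ l) (hlr : l ≤ r)
    {f : Fin 2 → ℝ} (hf : ∀ k, 0 ≤ f k) :
    UpperBound q v θ l r (fun i => f (cls m i)) fun i => f (cls m i) * Real.exp (-(θ *
      (clock (avgSpeed m q v (cls m i)) r - clock (avgSpeed m q v (cls m i)) l))) := by
  have hS := fun k => M.avgSpeed_isSpeed k
  set V : Fin 2 → ℝ → ℝ := fun k z => avgSpeed m q v k (max z 0) with hV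
  have hVS : ∀ k, IsSpeed (V k) a b := fun k =>
    IsSpeed.of_continuous M.a_pos (M.continuous_avgSpeed_max k)
      fun z => ⟨(hS k).lower _, (hS k).upper _⟩
  have hVz : ∀ k, ∀ z ∈ Icc l r, V k z = avgSpeed m q v k z := fun k z hz => by
    simp only [hV, max_eq_left (hl.trans hz.1)]
  have hcl := fun k => (hVS k).clock_sub_congr (hS k) hlr (hVz k)
  simp only [← hcl]
  refine M.upperBound_average hlr θ (V := fun i => V (cls m i))
    (fun _ => M.continuous_avgSpeed_max _) (fun _ z => (hS _).lower _) (fun i => hf _)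
    (fun z hz i j hij => ?_) fun z hz => ?_
  · have : cls m i = cls m j := by
      by_contra h
      exact hij ((M.hasClasses_nonneg (hl.trans hz.1)).zero i j h)
    rw [this]
    exact ⟨rfl, rfl⟩
  have hz0 : 0 ≤ z := hl.trans hz.1
  have hinv := isInvariant_iff.1 (M.mu_invariant z)
  refine hinv.2.2.exists_poisson (M.hasClasses_nonneg hz0) (fun i => M.mu_pos z i) fun k => ?_
  have hne := ((hVS k).speed_pos z).ne'
  have hp := (M.piBar_pos k).ne'
  have h1 : V k z = (piBar m q k)⁻¹ * ∑ i with cls m i = k, v i z * mu m q z i := by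
    rw [hVz k z hz, avgSpeed_of_nonneg k hz0, R]
  have h3 : ∑ i with cls m i = k, v i z * mu m q z i = piBar m q k * V k z := by
    rw [h1, mul_inv_cancel_left₀ hp]
  have h4 : ∑ i with cls m i = k, mu m q z i = piBar m q k := (M.mu_spec_nonneg hz0).2 k
  have h2 : ∑ i with cls m i = k, mu m q z i * (θ * (1 - v i z / V (cls m i) z)) =
      θ * ∑ i with cls m i = k, mu m q z i -
        θ * (V k z)⁻¹ * ∑ i with cls m i = k, v i z * mu m q z i := by
    rw [Finset.mul_sum, Finset.mul_sum, ← Finset.sum_sub_distrib]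
    refine Finset.sum_congr rfl fun i hi => ?_
    rw [(Finset.mem_filter.1 hi).2]
    ring
  rw [h2, h3, h4]
  field_simp
  ring

/-- Gluing over `[l, -δ]`, `[-δ, 0]` and `[0, r]`. The tolerance `η₁` is fixed first, then `δ`, and
only then `ε`; the time spent in `[-δ, 0]` disappears as `δ` does because the clock is continuous.
-/
theorem upperBound_through (M : IsModel m q v qbar φ a b Q) (θ : ℝ) (k : Fin 2) (hl : l < 0)
    (hr : 0 ≤ r) :
    UpperBound q v θ l r (fun i => if cls m i = k then 1 else 0) fun _ =>
      exitProb m q v k *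
        Real.exp (-(θ * (clock (avgSpeed m q v k) r - clock (avgSpeed m q v k) l))) := by
  refine upperBound_of_forall fun η hη => ?_
  set T := clock (avgSpeed m q v k) with hT
  have hTc : Continuous T := (M.avgSpeed_isSpeed k).clock_continuous
  set p := exitProb m q v k with hp
  have hp0 : 0 ≤ p := M.exitProb_nonneg k
  obtain ⟨η₁, hη₁, hle⟩ : ∃ η₁ > 0,
      Real.exp (-(θ * (T r - T 0))) * (p + η₁) * Real.exp (-(θ * (T 0 - T l))) <
        p * Real.exp (-(θ * (T r - T l))) + η := by
    have hc : Continuous fun η₁ : ℝ =>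
      Real.exp (-(θ * (T r - T 0))) * (p + η₁) * Real.exp (-(θ * (T 0 - T l))) := by fun_prop
    have h0 : Real.exp (-(θ * (T r - T 0))) * (p + 0) * Real.exp (-(θ * (T 0 - T l))) =
        p * Real.exp (-(θ * (T r - T l))) := by
      have : -(θ * (T r - T l)) = -(θ * (T r - T 0)) + -(θ * (T 0 - T l)) := by ring
      rw [this, Real.exp_add]
      ring
    have := (hc.tendsto 0).eventually_lt_const (u := p * Real.exp (-(θ * (T r - T l))) + η)
      (by simp only [h0]; linarith)
    obtain ⟨η₁, h1, h2⟩ := ((this.filter_mono nhdsWithin_le_nhds).and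
      (self_mem_nhdsWithin (s := Ioi (0 : ℝ)))).exists
    exact ⟨η₁, h2, h1⟩
  have hδ : ∀ᶠ δ in 𝓝[>] (0 : ℝ),
      Real.exp (-(θ * (T r - T 0))) * (p + η₁) * Real.exp (-(θ * (T (-δ) - T l))) <
        p * Real.exp (-(θ * (T r - T l))) + η := by
    have hc : Continuous fun δ : ℝ =>
      Real.exp (-(θ * (T r - T 0))) * (p + η₁) * Real.exp (-(θ * (T (-δ) - T l))) := by fun_prop
    exact ((hc.tendsto 0).eventually_lt_const (by simpa using hle)).filter_mono
      nhdsWithin_le_nhds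
  have hδl : ∀ᶠ δ in 𝓝[>] (0 : ℝ), δ ∈ Ioo 0 (-l) := Ioo_mem_nhdsGT (neg_pos.2 hl)
  obtain ⟨δ, h1, h2, h3⟩ := (hδ.and ((M.upperBound_vertex θ k hη₁).and hδl)).exists
  replace h3 : 0 < δ ∧ δ < -l := h3
  have hK := Real.exp_pos (-(θ * (T r - T 0)))
  have hA := M.upperBound_neg θ k (l := l) (r := -δ) (by linarith) (by linarith)
    (mul_nonneg hK.le (add_nonneg hp0 hη₁.le))
  have hC := M.upperBound_nonneg θ le_rfl hr (f := fun k' => if k' = k then 1 else 0)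
    fun k' => by split_ifs <;> norm_num
  have hBC := M.upperBound_concat (by linarith) hr (h2.const_mul hK) hC fun i => by
    by_cases hi : cls m i = k
    · simp only [hi, if_true]
      linarith
    · simp [hi]
  exact (M.upperBound_concat (by linarith) (by linarith) hA hBC fun i => le_rfl).mono
    fun i => h1.le

end IsModel

end FastSlow

end

noncomputable section

namespace FastSlow

variable {n m : ℕ} {q : Fin n → Fin n → ℝ → ℝ} {v : Fin n → ℝ → ℝ} {qbar : Fin n → Fin n → ℝ}
  {φ : ℝ → ℝ} {a b Q ε θ l r p T : ℝ} {g c : Fin n → ℝ} {x : Fin n × ℝ}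

/-! ### Passage probabilities and passage times -/

/-- An asymptotic bound for the exponential moments of the passage time of the level `r`, restricted
to the event that the fast variable is in the set with indicator `g` at this time. -/
def PassageBound (q : Fin n → Fin n → ℝ → ℝ) (v : Fin n → ℝ → ℝ) (x : Fin n × ℝ) (r : ℝ)
    (g : Fin n → ℝ) (p T : ℝ) : Prop :=
  ∀ θ, ∀ η > 0, ∀ᶠ ε in 𝓝[>] (0 : ℝ), ∃ u, IsSuper q v ε θ x.2 r u ∧ (∀ i, g i ≤ u i r) ∧
    u x.1 x.2 ≤ p * Real.exp (-(θ * T)) + η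

theorem PassageBound.of_upperBound {c : ℝ → Fin n → ℝ}
    (h : ∀ θ, UpperBound q v θ x.2 r g (c θ)) (hc : ∀ θ, c θ x.1 = p * Real.exp (-(θ * T))) :
    PassageBound q v x r g p T := fun θ η hη =>
  (h θ η hη).mono fun _ ⟨u, h1, h2, h3⟩ => ⟨u, h1, h2, (hc θ) ▸ h3 x.1⟩

namespace IsModel

theorem passage_unique (M : IsModel m q v qbar φ a b Q) (hε : 0 < ε) {ω : Noise}
    (hω : GoodNoise ω) {τ τ' : ℝ≥0} (h : (X q v ε x ω τ).2 = r) (h' : (X q v ε x ω τ').2 = r) :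
    τ = τ' := by
  have key : ∀ {τ τ' : ℝ≥0}, (X q v ε x ω τ).2 = r → (X q v ε x ω τ').2 = r → τ ≤ τ' →
      τ' ≤ τ := by
    intro τ τ' h h' hle
    have h1 := (M.adv_X hε hω x hle).lower
    simp only [h, h', sub_self] at h1
    have h2 : (τ' : ℝ) - τ ≤ 0 := nonpos_of_mul_nonpos_right h1 M.a_pos
    exact NNReal.coe_le_coe.1 (by linarith)
  rcases le_total τ τ' with hle | hle
  · exact le_antisymm hle (key h h' hle)
  · exact le_antisymm (key h' h hle) hle

/-- The case `θ = 0` of the passage bound, with Markov's inequality. No measurability of `B ε` is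
required. -/
theorem passage_prob_le (M : IsModel m q v qbar φ a b Q) (hg : ∀ i, 0 ≤ g i) (hxr : x.2 ≤ r)
    (h : PassageBound q v x r g p T) (hp : 0 ≤ p) {B : ℝ → Set Noise}
    (hB : ∀ ε > 0, ∀ ω ∈ B ε, GoodNoise ω → ∀ τ, (X q v ε x ω τ).2 = r →
      1 ≤ g (X q v ε x ω τ).1) {η : ℝ} (hη : 0 < η) :
    ∀ᶠ ε in 𝓝[>] (0 : ℝ), noiseMeasure.real (B ε) ≤ p + η := by
  filter_upwards [h 0 η hη, self_mem_nhdsWithin] with ε ⟨u, hu, hgu, hux⟩ hε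
  replace hε : 0 < ε := hε
  obtain ⟨N, hN, hInt, hNω⟩ := M.exists_reward_bound hε hu hg hgu x le_rfl hxr
  have h1 : noiseMeasure (B ε) ≤ ENNReal.ofReal (p + η) := by
    calc noiseMeasure (B ε) ≤ noiseMeasure {ω | 1 ≤ N ω} := by
          refine measure_mono_ae (ae_goodNoise.mono fun ω hω hωB => ?_)
          obtain ⟨τ, hτ, hle⟩ := hNω ω hω
          refine le_trans ?_ hle
          have := hB ε hε ω hωB hω τ hτ
          simpa using this
      _ ≤ ∫⁻ ω, N ω ∂noiseMeasure := by
          simpa using mul_meas_ge_le_lintegral hN 1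
      _ ≤ ENNReal.ofReal (u x.1 x.2) := hInt
      _ ≤ ENNReal.ofReal (p + η) := ENNReal.ofReal_le_ofReal (by simpa using hux)
  exact ENNReal.toReal_le_of_le_ofReal (by linarith) h1

/-- The bounds for `θ = 1` and `θ = -1`, weighted by `exp T` and `exp (-T)`, give an asymptotic
upper bound `2 * p` for the expectation of `2 * cosh (τ - T)` on `B ε`. The minimum value `2` on `B
ε` already accounts for all of this in the limit, so a deviation by `ρ`, which adds at least `2 *
cosh ρ - 2`, has vanishing probability. -/
theorem passage_time_tendsto (M : IsModel m q v qbar φ a b Q) (hg : ∀ i, 0 ≤ g i) (hxr : x.2 ≤ r)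
    (h : PassageBound q v x r g p T) (hp : 0 ≤ p) {B : ℝ → Set Noise}
    (hBm : ∀ ε > 0, MeasurableSet (B ε))
    (hB : ∀ ε > 0, ∀ ω ∈ B ε, GoodNoise ω → ∀ τ, (X q v ε x ω τ).2 = r →
      1 ≤ g (X q v ε x ω τ).1)
    (hlim : Tendsto (fun ε => noiseMeasure.real (B ε)) (𝓝[>] 0) (𝓝 p)) {ρ : ℝ} (hρ : 0 < ρ) :
    Tendsto (fun ε => noiseMeasure.real {ω | GoodNoise ω ∧ ω ∈ B ε ∧
      ∃ τ : ℝ≥0, (X q v ε x ω τ).2 = r ∧ ρ ≤ |(τ : ℝ) - T|}) (𝓝[>] 0) (𝓝 0) := by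
  set A : ℝ → Set Noise := fun ε => {ω | GoodNoise ω ∧ ω ∈ B ε ∧
      ∃ τ : ℝ≥0, (X q v ε x ω τ).2 = r ∧ ρ ≤ |(τ : ℝ) - T|} with hA
  set d := 2 * Real.cosh ρ - 2 with hd
  have hd0 : 0 < d := by
    have := Real.one_lt_cosh.2 hρ.ne'
    linarith
  set K := Real.exp T + Real.exp (-T) with hK
  have hK0 : 0 < K := by positivity
  have key : ∀ η > 0, ∀ᶠ ε in 𝓝[>] (0 : ℝ), noiseMeasure.real (A ε) * d ≤ η * (K + 2) := by
    intro η hη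
    filter_upwards [h 1 η hη, h (-1) η hη, hlim.eventually_const_lt (show p - η < p by linarith),
      self_mem_nhdsWithin] with ε ⟨u, hu, hgu, hux⟩ ⟨w, hw, hgw, hwx⟩ hBε hε
    replace hε : 0 < ε := hε
    obtain ⟨N₁, hN₁, hInt₁, hNω₁⟩ := M.exists_reward_bound hε hu hg hgu x le_rfl hxr
    obtain ⟨N₂, hN₂, hInt₂, hNω₂⟩ := M.exists_reward_bound hε hw hg hgw x le_rfl hxr
    set N : Noise → ℝ≥0∞ := fun ω =>
      ENNReal.ofReal (Real.exp T) * N₁ ω + ENNReal.ofReal (Real.exp (-T)) * N₂ ω with hN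
    have hNm : Measurable N := (hN₁.const_mul _).add (hN₂.const_mul _)
    -- The minimum `2` is subtracted before Markov's inequality. Truncated subtraction loses
    -- nothing, since `f ≤ N` almost everywhere.
    set f : Noise → ℝ≥0∞ := (B ε).indicator fun _ => 2 with hf
    have hfm : Measurable f := measurable_const.indicator (hBm ε hε)
    have hτ : ∀ ω, GoodNoise ω → ω ∈ B ε → ∃ τ : ℝ≥0, (X q v ε x ω τ).2 = r ∧
        ENNReal.ofReal (2 * Real.cosh (τ - T)) ≤ N ω := by
      intro ω hω hωB
      obtain ⟨τ, h1, h2⟩ := hNω₁ ω hω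
      obtain ⟨τ', h3, h4⟩ := hNω₂ ω hω
      rw [M.passage_unique hε hω h3 h1] at h4
      have h5 := hB ε hε ω hωB hω τ h1
      refine ⟨τ, h1, ?_⟩
      have e : 2 * Real.cosh ((τ : ℝ) - T) = Real.exp T * Real.exp (-(1 * (τ : ℝ))) +
          Real.exp (-T) * Real.exp (-(-1 * (τ : ℝ))) := by
        rw [Real.cosh_eq, ← Real.exp_add, ← Real.exp_add]
        ring_nf
      rw [e, ENNReal.ofReal_add (by positivity) (by positivity),
        ENNReal.ofReal_mul (Real.exp_pos _).le, ENNReal.ofReal_mul (Real.exp_pos _).le]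
      refine add_le_add (mul_le_mul_right (le_trans (ENNReal.ofReal_le_ofReal ?_) h2) _)
        (mul_le_mul_right (le_trans (ENNReal.ofReal_le_ofReal ?_) h4) _)
      · exact le_mul_of_one_le_right (Real.exp_pos _).le h5
      · exact le_mul_of_one_le_right (Real.exp_pos _).le h5
    have hfN : ∀ᵐ ω ∂noiseMeasure, f ω ≤ N ω := by
      filter_upwards [ae_goodNoise] with ω hω
      by_cases hωB : ω ∈ B ε
      · obtain ⟨τ, -, h2⟩ := hτ ω hω hωB
        rw [hf, indicator_of_mem hωB]
        refine le_trans ?_ h2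
        rw [← ENNReal.ofReal_ofNat]
        exact ENNReal.ofReal_le_ofReal (by linarith [Real.one_le_cosh ((τ : ℝ) - T)])
      · simp [hf, indicator_of_notMem hωB]
    have hAN : A ε ⊆ {ω | ENNReal.ofReal d ≤ N ω - f ω} := by
      rintro ω ⟨hω, hωB, τ, h1, h2⟩
      obtain ⟨τ', h3, h4⟩ := hτ ω hω hωB
      rw [M.passage_unique hε hω h3 h1] at h4
      have h5 : Real.cosh ρ ≤ Real.cosh ((τ : ℝ) - T) := by
        rw [Real.cosh_le_cosh, abs_of_pos hρ]
        exact h2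
      change ENNReal.ofReal d ≤ N ω - f ω
      rw [hf, indicator_of_mem hωB]
      refine ENNReal.le_sub_of_add_le_right ENNReal.ofNat_ne_top (le_trans ?_ h4)
      rw [← ENNReal.ofReal_ofNat, ← ENNReal.ofReal_add hd0.le (by norm_num)]
      exact ENNReal.ofReal_le_ofReal (by linarith)
    have hsum : ENNReal.ofReal d * noiseMeasure (A ε) + 2 * noiseMeasure (B ε) ≤
        ENNReal.ofReal (2 * p + η * K) := by
      calc ENNReal.ofReal d * noiseMeasure (A ε) + 2 * noiseMeasure (B ε)
          ≤ ∫⁻ ω, (N ω - f ω) ∂noiseMeasure + ∫⁻ ω, f ω ∂noiseMeasure := by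
            refine add_le_add ?_ ?_
            · exact (mul_le_mul_right (measure_mono hAN) _).trans
                (mul_meas_ge_le_lintegral (hNm.sub hfm) _)
            · rw [hf, lintegral_indicator_const (hBm ε hε)]
        _ = ∫⁻ ω, N ω ∂noiseMeasure := by
            rw [← lintegral_add_right _ hfm]
            refine lintegral_congr_ae (hfN.mono fun ω hω => ?_)
            exact tsub_add_cancel_of_le hω
        _ = ENNReal.ofReal (Real.exp T) * ∫⁻ ω, N₁ ω ∂noiseMeasure +
            ENNReal.ofReal (Real.exp (-T)) * ∫⁻ ω, N₂ ω ∂noiseMeasure := by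
            rw [hN, lintegral_add_left (hN₁.const_mul _), lintegral_const_mul _ hN₁,
              lintegral_const_mul _ hN₂]
        _ ≤ ENNReal.ofReal (Real.exp T) * ENNReal.ofReal (p * Real.exp (-(1 * T)) + η) +
            ENNReal.ofReal (Real.exp (-T)) * ENNReal.ofReal (p * Real.exp (-(-1 * T)) + η) := by
            gcongr
            · exact hInt₁.trans (ENNReal.ofReal_le_ofReal hux)
            · exact hInt₂.trans (ENNReal.ofReal_le_ofReal hwx)
        _ = ENNReal.ofReal (2 * p + η * K) := by
            rw [← ENNReal.ofReal_mul (Real.exp_pos _).le, ← ENNReal.ofReal_mul (Real.exp_pos _).le,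
              ← ENNReal.ofReal_add (by positivity) (by positivity)]
            congr 1
            have e1 : Real.exp T * Real.exp (-T) = 1 := by
              rw [← Real.exp_add, add_neg_cancel, Real.exp_zero]
            have e2 : -(-1 * T) = T := by ring
            rw [e2, one_mul, hK]
            linear_combination 2 * p * e1
    have hreal := ENNReal.toReal_le_of_le_ofReal (by positivity) hsum
    rw [ENNReal.toReal_add (by finiteness) (by finiteness), ENNReal.toReal_mul, ENNReal.toReal_mul,
      ENNReal.toReal_ofReal hd0.le, ENNReal.toReal_ofNat] at hreal
    change d * noiseMeasure.real (A ε) + 2 * noiseMeasure.real (B ε) ≤ _ at hreal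
    linarith
  rw [Metric.tendsto_nhds]
  intro η hη
  have hη' : 0 < η * d / (2 * (K + 2)) := by positivity
  filter_upwards [key _ hη'] with ε hε
  rw [Real.dist_eq, sub_zero, abs_of_nonneg measureReal_nonneg]
  have e : η * d / (2 * (K + 2)) * (K + 2) = η / 2 * d := by field_simp
  rw [e] at hε
  have := le_of_mul_le_mul_right hε hd0
  linarith

end IsModel

end FastSlow

end

noncomputable section

namespace FastSlow

variable {n m : ℕ} {q : Fin n → Fin n → ℝ → ℝ} {v : Fin n → ℝ → ℝ} {qbar : Fin n → Fin n → ℝ}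
  {φ : ℝ → ℝ} {a b Q ε θ l r p T : ℝ} {g c : Fin n → ℝ} {x : Fin n × ℝ}

/-! ### Weak convergence -/

theorem dist_branch_le (k : Fin 2) (z z' : ℝ) : dist (branch k z) (branch k z') ≤ |z - z'| := by
  rw [Subtype.dist_eq, dist_pi_le_iff (abs_nonneg _)]
  intro j
  simp only [branch]
  split_ifs
  · rw [Real.dist_eq]
    simpa using abs_min_sub_min_le_max z 0 z' 0
  · rw [Real.dist_eq]
    simpa using abs_max_sub_max_le_max z 0 z' 0
  · simp

/-- The topology is that of uniform convergence on compact sets, and a compact set of times is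
contained in some `[0, t₀]`. -/
theorem exists_dist_lt_of_path_close (F : PathSpace →ᵇ ℝ) (y : PathSpace) {η : ℝ} (hη : 0 < η) :
    ∃ (t₀ : ℝ≥0) (ρ : ℝ), 0 < ρ ∧ ∀ f : PathSpace, (∀ t ≤ t₀, dist (y t) (f t) < ρ) →
      dist (F f) (F y) < η := by
  have h1 : {f | dist (F f) (F y) < η} ∈ 𝓝 y :=
    F.continuous.continuousAt.eventually (Metric.ball_mem_nhds (F y) hη)
  obtain ⟨⟨K, V⟩, ⟨hK, hV⟩, hsub⟩ :=
    (nhds_basis_uniformity' ContinuousMap.hasBasis_compactConvergenceUniformity).mem_iff.1 h1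
  obtain ⟨ρ, hρ, hρV⟩ := Metric.mem_uniformity_dist.1 hV
  obtain ⟨t₀, ht₀⟩ := hK.bddAbove
  exact ⟨t₀, ρ, hρ, fun f hf => hsub fun t ht => hρV (hf t (ht₀ ht))⟩

/-- The limiting path along `I₀ ∪ I_{k+1}` from the point with coordinate `z`. -/
def branchPath (m : ℕ) (q : Fin n → Fin n → ℝ → ℝ) (v : Fin n → ℝ → ℝ) (k : Fin 2) (z : ℝ) :
    PathSpace :=
  toPath fun t => branch k (motion (avgSpeed m q v k) z t)

namespace IsModel

theorem branchPath_apply (M : IsModel m q v qbar φ a b Q) (k : Fin 2) (z : ℝ) (t : ℝ≥0) :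
    branchPath m q v k z t = branch k (motion (avgSpeed m q v k) z t) := by
  have hc : Continuous fun t : ℝ≥0 => branch k (motion (avgSpeed m q v k) z t) :=
    (continuous_branch k).comp
      ((M.avgSpeed_isSpeed k).continuous_motion.comp (by fun_prop : Continuous fun t : ℝ≥0 => (z, t)))
  rw [branchPath, toPath, dif_pos hc]
  rfl

/-- Monotone trajectories with bounded speeds are controlled by the passage times of a grid. The
averaged motion and the process pass the last grid level below the current position at nearly the
same time, and neither moves far afterwards. -/
theorem abs_sub_motion_le (M : IsModel m q v qbar φ a b Q) (hε : 0 < ε) {ω : Noise}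
    (hω : GoodNoise ω) (k : Fin 2) {ρ : ℝ} (hρ : 0 < ρ) {J : ℕ}
    (hJ : ∀ j ≤ J, ∀ τ : ℝ≥0, (X q v ε x ω τ).2 = x.2 + j * ρ →
      |(τ : ℝ) - (clock (avgSpeed m q v k) (x.2 + j * ρ) - clock (avgSpeed m q v k) x.2)| ≤ ρ)
    {t : ℝ≥0} (ht : b * t ≤ J * ρ) :
    |motion (avgSpeed m q v k) x.2 t - (X q v ε x ω t).2| ≤ ρ * (1 + b / a + b) := by
  have ha := M.a_pos
  have hb := M.b_pos
  have hS := M.avgSpeed_isSpeed k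
  set T := clock (avgSpeed m q v k) with hT
  set z := (X q v ε x ω t).2 with hz
  have hadv := M.adv_X hε hω x (zero_le : 0 ≤ t)
  rw [M.X_zero hε hω] at hadv
  have h1 : x.2 ≤ z := hadv.mono
  have h2 : z - x.2 ≤ b * t := by simpa using hadv.upper
  set j := ⌊(z - x.2) / ρ⌋₊ with hj
  have hd0 : 0 ≤ (z - x.2) / ρ := div_nonneg (by linarith) hρ.le
  have hj1 : j * ρ ≤ z - x.2 := (le_div_iff₀ hρ).1 (Nat.floor_le hd0)
  have hj2 : z - x.2 < (j + 1) * ρ := (div_lt_iff₀ hρ).1 (Nat.lt_floor_add_one _)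
  have hjJ : j ≤ J := by
    have : (j : ℝ) * ρ ≤ J * ρ := by linarith
    exact_mod_cast le_of_mul_le_mul_right this hρ
  have hjρ : 0 ≤ (j : ℝ) * ρ := by positivity
  obtain ⟨τ, hτt, hτ⟩ := intermediate_value_Icc (zero_le : 0 ≤ t)
    (M.continuous_X_snd hε hω x).continuousOn
    (show x.2 + j * ρ ∈ Icc (X q v ε x ω 0).2 (X q v ε x ω t).2 by
      rw [M.X_zero hε hω]
      exact ⟨by linarith, by linarith⟩)
  have hτ' : (X q v ε x ω τ).2 = x.2 + j * ρ := hτ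
  have h3 := hJ j hjJ τ hτ'
  have hadv' := (M.adv_X hε hω x hτt.2).lower
  simp only [hτ', ← hz] at hadv'
  have h4 : (t : ℝ) - τ ≤ ρ / a := by
    rw [le_div_iff₀ ha]
    linarith
  have h4' : (τ : ℝ) ≤ t := hτt.2
  set Tj := T (x.2 + j * ρ) - T x.2 with hTj
  have hTj0 : 0 ≤ Tj := sub_nonneg.2 (hS.clock_strictMono.monotone (by linarith))
  have h5 : motion (avgSpeed m q v k) x.2 Tj = x.2 + j * ρ := hS.motion_clock_sub (by linarith)
  have h6 : |motion (avgSpeed m q v k) x.2 t - motion (avgSpeed m q v k) x.2 Tj| ≤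
      b * |(t : ℝ) - Tj| := by
    rcases le_total (t : ℝ) Tj with hle | hle
    · rw [abs_sub_comm, abs_of_nonneg (sub_nonneg.2 (hS.motion_mono _ t.coe_nonneg hle)), abs_sub_comm,
        abs_of_nonneg (sub_nonneg.2 hle)]
      exact hS.motion_sub_le _ t.coe_nonneg hle
    · rw [abs_of_nonneg (sub_nonneg.2 (hS.motion_mono _ hTj0 hle)),
        abs_of_nonneg (sub_nonneg.2 hle)]
      exact hS.motion_sub_le _ hTj0 hle
  have h7 : |(t : ℝ) - Tj| ≤ ρ / a + ρ := by
    have h8 : (t : ℝ) - Tj = (t - τ) + (τ - Tj) := by ring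
    rw [h8]
    refine (abs_add_le _ _).trans (add_le_add ?_ h3)
    rwa [abs_of_nonneg (sub_nonneg.2 h4')]
  have h8 : |x.2 + j * ρ - z| ≤ ρ := by
    rw [abs_le]
    constructor <;> linarith
  have h9 := mul_le_mul_of_nonneg_left h7 hb.le
  rw [h5] at h6
  calc |motion (avgSpeed m q v k) x.2 t - z|
      ≤ |motion (avgSpeed m q v k) x.2 t - (x.2 + j * ρ)| + |x.2 + j * ρ - z| :=
        abs_sub_le _ _ _
    _ ≤ b * (ρ / a + ρ) + ρ := by linarith
    _ = ρ * (1 + b / a + b) := by ring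

theorem cls_X_eq (M : IsModel m q v qbar φ a b Q) (hε : 0 < ε) {ω : Noise} (hω : GoodNoise ω)
    {s t : ℝ≥0} (hs : 0 ≤ (X q v ε x ω s).2) (ht : 0 ≤ (X q v ε x ω t).2) :
    cls m (X q v ε x ω s).1 = cls m (X q v ε x ω t).1 := by
  rcases le_total s t with hst | hst
  · exact ((M.adv_X hε hω x hst).cls_eq hs).symm
  · exact (M.adv_X hε hω x hst).cls_eq ht

theorem measurableSet_cls_X (M : IsModel m q v qbar φ a b Q) (hε : 0 < ε) (x : Fin n × ℝ)
    (t : ℝ≥0) (k : Fin 2) : MeasurableSet {ω | cls m (X q v ε x ω t).1 = k} := by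
  have h1 : Measurable fun ω => cls m (X q v ε x ω t).1 :=
    (measurable_of_countable (cls m)).comp (measurable_fst.comp (M.X_measurable hε x t))
  exact h1 (measurableSet_singleton k)

/-- The upper bounds `w 0` and `w 1` add up to one, as do the probabilities, so both bounds are
attained in the limit. -/
theorem exit_class_tendsto (M : IsModel m q v qbar φ a b Q) {w : Fin 2 → ℝ} (hw : ∀ k, 0 ≤ w k)
    (hw1 : w 0 + w 1 = 1) {T : Fin 2 → ℝ} (hxr : x.2 ≤ r) (hr : 0 ≤ r)
    (h : ∀ k, PassageBound q v x r (fun i => if cls m i = k then 1 else 0) (w k) (T k)) {t₁ : ℝ≥0}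
    (ht₁ : ∀ {ε : ℝ} {ω : Noise}, 0 < ε → GoodNoise ω → 0 ≤ (X q v ε x ω t₁).2) (k : Fin 2) :
    Tendsto (fun ε => noiseMeasure.real {ω | cls m (X q v ε x ω t₁).1 = k}) (𝓝[>] 0)
      (𝓝 (w k)) := by
  have hup : ∀ k, ∀ η > 0, ∀ᶠ ε in 𝓝[>] (0 : ℝ),
      noiseMeasure.real {ω | cls m (X q v ε x ω t₁).1 = k} ≤ w k + η := by
    intro k η hη
    refine M.passage_prob_le (fun i => ?_) hxr (h k) (hw k)
      (B := fun ε => {ω | cls m (X q v ε x ω t₁).1 = k}) (fun ε hε ω hωB hω τ hτ => ?_) hη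
    · split_ifs <;> norm_num
    · have h1 := M.cls_X_eq (x := x) hε hω (hτ.symm ▸ hr : 0 ≤ (X q v ε x ω τ).2) (ht₁ hε hω)
      have h2 : cls m (X q v ε x ω t₁).1 = k := hωB
      rw [h1, h2, if_pos rfl]
  have hsum : ∀ ε > 0, noiseMeasure.real {ω | cls m (X q v ε x ω t₁).1 = 0} +
      noiseMeasure.real {ω | cls m (X q v ε x ω t₁).1 = 1} = 1 := by
    intro ε hε
    have h1 := M.measurableSet_cls_X hε x t₁ 0
    have h2 : {ω | cls m (X q v ε x ω t₁).1 = 1} = {ω | cls m (X q v ε x ω t₁).1 = 0}ᶜ := by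
      ext ω
      change _ = _ ↔ ¬ (_ = _)
      omega
    rw [h2, probReal_compl_eq_one_sub h1]
    ring
  rw [Metric.tendsto_nhds]
  intro η hη
  filter_upwards [hup 0 (η / 2) (half_pos hη), hup 1 (η / 2) (half_pos hη),
    self_mem_nhdsWithin] with ε h0 h1 hε
  have h2 := hsum ε hε
  rw [Real.dist_eq, abs_lt]
  rcases (show k = 0 ∨ k = 1 by omega) with rfl | rfl <;> constructor <;> linarith

/-- Outside a set of vanishing probability the trajectory is uniformly close to the limiting path of
the class occupied at the fixed time `t₁`, and the law of this class converges to `w`. Only finitely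
many levels matter for a given test functional and tolerance. -/
theorem convergesWeakly (M : IsModel m q v qbar φ a b Q) {w : Fin 2 → ℝ} (hw : ∀ k, 0 ≤ w k)
    (hw1 : w 0 + w 1 = 1)
    (hpos : ∀ k r, x.2 ≤ r → 0 ≤ r →
      PassageBound q v x r (fun i => if cls m i = k then 1 else 0) (w k)
        (clock (avgSpeed m q v k) r - clock (avgSpeed m q v k) x.2))
    (hneg : ∀ k r, x.2 ≤ r → r < 0 → PassageBound q v x r (fun _ => 1) 1
        (clock (avgSpeed m q v k) r - clock (avgSpeed m q v k) x.2)) :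
    ConvergesWeakly (projectedLaw m q v x)
      (∑ k, ENNReal.ofReal (w k) • branchLaw m q v k x.2) := by
  obtain ⟨t₁, ht₁⟩ := M.exists_X_nonneg x
  set B : Fin 2 → ℝ → Set Noise := fun k ε => {ω | cls m (X q v ε x ω t₁).1 = k} with hB
  have hBm : ∀ k, ∀ ε > 0, MeasurableSet (B k ε) := fun k ε hε => M.measurableSet_cls_X hε x t₁ k
  have hBlim : ∀ k, Tendsto (fun ε => noiseMeasure.real (B k ε)) (𝓝[>] 0) (𝓝 (w k)) :=
    M.exit_class_tendsto hw hw1 (le_max_left x.2 0) (le_max_right x.2 0)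
      (fun k => hpos k _ (le_max_left _ _) (le_max_right _ _)) ht₁
  set bad : Fin 2 → ℝ → ℝ → ℝ → Set Noise := fun k r ρ ε => {ω | GoodNoise ω ∧ ω ∈ B k ε ∧
      ∃ τ : ℝ≥0, (X q v ε x ω τ).2 = r ∧
        ρ ≤ |(τ : ℝ) - (clock (avgSpeed m q v k) r - clock (avgSpeed m q v k) x.2)|} with hbad
  have hbadlim : ∀ k r, x.2 ≤ r → ∀ ρ > 0,
      Tendsto (fun ε => noiseMeasure.real (bad k r ρ ε)) (𝓝[>] 0) (𝓝 0) := by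
    intro k r hxr ρ hρ
    rcases lt_or_ge r 0 with hr | hr
    -- Below the vertex the class at passage does not determine the edge taken later, so the time is
    -- controlled on the whole space and the event is restricted afterwards.
    · have h1 := M.passage_time_tendsto (fun _ => zero_le_one) hxr (hneg k r hxr hr) zero_le_one
        (B := fun _ => univ) (fun _ _ => MeasurableSet.univ) (fun _ _ _ _ _ _ _ => le_rfl)
        (by simp) hρ
      refine tendsto_of_tendsto_of_tendsto_of_le_of_le tendsto_const_nhds h1
        (fun ε => measureReal_nonneg) fun ε => measureReal_mono ?_
      rintro ω ⟨h1, -, h2⟩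
      exact ⟨h1, mem_univ _, h2⟩
    · refine M.passage_time_tendsto (fun i => ?_) hxr (hpos k r hxr hr) (hw k) (hBm k)
        (fun ε hε ω hωB hω τ hτ => ?_) (hBlim k) hρ
      · split_ifs <;> norm_num
      · have h1 := M.cls_X_eq (x := x) hε hω (hτ.symm ▸ hr : 0 ≤ (X q v ε x ω τ).2) (ht₁ hε hω)
        have h2 : cls m (X q v ε x ω t₁).1 = k := hωB
        rw [h1, h2, if_pos rfl]
  refine ⟨fun ε hε => Measure.isProbabilityMeasure_map (M.aemeasurable_path hε x), ?_,
    fun F => ?_⟩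
  · constructor
    have h1 : ∀ k, (branchLaw m q v k x.2) univ = 1 := fun k => by
      rw [branchLaw]
      exact measure_univ
    simp only [Measure.coe_finsetSum, Finset.sum_apply, Measure.smul_apply, smul_eq_mul, h1,
      mul_one]
    rw [Fin.sum_univ_two, ← ENNReal.ofReal_add (hw 0) (hw 1), hw1, ENNReal.ofReal_one]
  set y : Fin 2 → PathSpace := fun k => branchPath m q v k x.2 with hy
  have hlimit : ∫ f, F f ∂(∑ k, ENNReal.ofReal (w k) • branchLaw m q v k x.2) =
      ∑ k, w k * F (y k) := by
    have hi : ∀ k, Integrable F (ENNReal.ofReal (w k) • branchLaw m q v k x.2) := fun k => by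
      have : IsFiniteMeasure (branchLaw m q v k x.2) := by
        unfold branchLaw
        infer_instance
      exact (F.integrable _).smul_measure ENNReal.ofReal_ne_top
    rw [integral_finsetSum_measure fun k _ => hi k]
    refine Finset.sum_congr rfl fun k _ => ?_
    rw [integral_smul_measure, ENNReal.toReal_ofReal (hw k), smul_eq_mul, branchLaw,
      integral_dirac' _ _ F.continuous.measurable.stronglyMeasurable]
    rfl
  rw [hlimit]
  have hB2 : Tendsto (fun ε => ∑ k, noiseMeasure.real (B k ε) * F (y k)) (𝓝[>] 0)
      (𝓝 (∑ k, w k * F (y k))) :=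
    tendsto_finsetSum _ fun k _ => (hBlim k).mul_const _
  suffices hdiff : Tendsto (fun ε => ∫ f, F f ∂(projectedLaw m q v x ε) -
      ∑ k, noiseMeasure.real (B k ε) * F (y k)) (𝓝[>] 0) (𝓝 0) by
    simpa using hdiff.add hB2
  rw [Metric.tendsto_nhds]
  intro η hη
  have hclose := fun k => exists_dist_lt_of_path_close F (y k) (half_pos (half_pos hη))
  choose t₀ ρ₀ hρ₀ hclose using hclose
  have hKpos : 0 < 1 + b / a + b := by
    have := div_pos M.b_pos M.a_pos
    linarith [M.b_pos]
  -- The mesh of the grid, and at the same time the tolerance for the passage times: the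
  -- trajectories then differ by at most `ρ₀ k / 2`.
  set ρ : Fin 2 → ℝ := fun k => ρ₀ k / 2 / (1 + b / a + b) with hρdef
  have hρ : ∀ k, 0 < ρ k := fun k => div_pos (half_pos (hρ₀ k)) hKpos
  have hJ : ∀ k, ∃ J : ℕ, b * t₀ k ≤ J * ρ k := by
    intro k
    obtain ⟨J, hJ⟩ := exists_nat_ge (b * t₀ k / ρ k)
    exact ⟨J, (div_le_iff₀ (hρ k)).1 hJ⟩
  choose J hJ using hJ
  set D : ℝ → Set Noise := fun ε =>
    ⋃ k, ⋃ j ∈ Finset.range (J k + 1), bad k (x.2 + j * ρ k) (ρ k) ε with hD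
  have hDlim : Tendsto (fun ε => noiseMeasure.real (D ε)) (𝓝[>] 0) (𝓝 0) := by
    have h1 : Tendsto (fun ε => ∑ k, ∑ j ∈ Finset.range (J k + 1),
        noiseMeasure.real (bad k (x.2 + j * ρ k) (ρ k) ε)) (𝓝[>] 0) (𝓝 0) := by
      have h0 : ∑ k : Fin 2, ∑ j ∈ Finset.range (J k + 1), (0 : ℝ) = 0 := by simp
      refine (congrArg 𝓝 h0) ▸ tendsto_finsetSum _ fun k _ => tendsto_finsetSum _ fun j _ =>
        hbadlim k _ ?_ _ (hρ k)
      have := hρ k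
      linarith [show 0 ≤ (j : ℝ) * ρ k by positivity]
    refine tendsto_of_tendsto_of_tendsto_of_le_of_le tendsto_const_nhds h1
      (fun ε => measureReal_nonneg) fun ε => ?_
    refine (measureReal_iUnion_fintype_le _).trans (Finset.sum_le_sum fun k _ => ?_)
    exact measureReal_biUnion_finset_le _ _
  have hDη : ∀ᶠ ε in 𝓝[>] (0 : ℝ), 2 * ‖F‖ * noiseMeasure.real (D ε) < η / 2 := by
    have := hDlim.const_mul (2 * ‖F‖)
    rw [mul_zero] at this
    exact this.eventually_lt_const (half_pos hη)
  filter_upwards [hDη, self_mem_nhdsWithin] with ε hDε hε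
  replace hε : 0 < ε := hε
  set path : Noise → PathSpace := fun ω => toPath fun t => h m (X q v ε x ω t) with hpath
  have hpathm : AEMeasurable path noiseMeasure := M.aemeasurable_path hε x
  have hFi : Integrable (fun ω => F (path ω)) noiseMeasure := by
    have : IsProbabilityMeasure (noiseMeasure.map path) := Measure.isProbabilityMeasure_map hpathm
    exact (F.integrable (noiseMeasure.map path)).comp_aemeasurable hpathm
  have hGe : ∀ ω, F (y (cls m (X q v ε x ω t₁).1)) =
      ∑ k, (B k ε).indicator (fun _ => F (y k)) ω := by
    intro ω
    rw [Finset.sum_eq_single (cls m (X q v ε x ω t₁).1)]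
    · rw [indicator_of_mem]
      exact rfl
    · intro k _ hk
      rw [indicator_of_notMem]
      exact fun h => hk (Eq.symm h)
    · simp
  have hGi : ∀ k, Integrable ((B k ε).indicator fun _ => F (y k)) noiseMeasure := fun k =>
    (integrable_const _).indicator (hBm k ε hε)
  have hG : ∫ ω, F (y (cls m (X q v ε x ω t₁).1)) ∂noiseMeasure =
      ∑ k, noiseMeasure.real (B k ε) * F (y k) := by
    simp only [hGe]
    rw [integral_finsetSum _ fun k _ => hGi k]
    refine Finset.sum_congr rfl fun k _ => ?_
    rw [integral_indicator_const _ (hBm k ε hε), smul_eq_mul]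
  have hGI : Integrable (fun ω => F (y (cls m (X q v ε x ω t₁).1))) noiseMeasure := by
    simp only [hGe]
    exact integrable_finsetSum _ fun k _ => hGi k
  have hF : ∫ f, F f ∂(projectedLaw m q v x ε) = ∫ ω, F (path ω) ∂noiseMeasure :=
    integral_map hpathm F.continuous.measurable.aestronglyMeasurable
  rw [hF, ← hG, ← integral_sub hFi hGI, dist_zero_right]
  -- The bad set involves an uncountable quantifier over times, so a measurable hull of the same
  -- measure replaces it in the integral.
  set D' := toMeasurable noiseMeasure (D ε) with hD'
  have hD'm : MeasurableSet D' := measurableSet_toMeasurable _ _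
  have hbound : ∀ᵐ ω ∂noiseMeasure, ‖F (path ω) - F (y (cls m (X q v ε x ω t₁).1))‖ ≤
      η / 2 / 2 + D'.indicator (fun _ => 2 * ‖F‖) ω := by
    filter_upwards [ae_goodNoise] with ω hω
    by_cases hωD : ω ∈ D ε
    · rw [indicator_of_mem (subset_toMeasurable _ _ hωD)]
      have h1 := norm_sub_le (F (path ω)) (F (y (cls m (X q v ε x ω t₁).1)))
      have h2 := F.norm_coe_le_norm (path ω)
      have h3 := F.norm_coe_le_norm (y (cls m (X q v ε x ω t₁).1))
      linarith
    · have h0 : 0 ≤ D'.indicator (fun _ => 2 * ‖F‖) ω :=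
        indicator_nonneg (fun _ _ => by positivity) ω
      set k := cls m (X q v ε x ω t₁).1 with hk
      have hlt := hclose k (path ω) fun t ht => ?_
      · rw [dist_eq_norm] at hlt
        linarith
      · have hp : path ω t = branch k (X q v ε x ω t).2 := by
          rw [hpath]
          simp only [toPath]
          rw [dif_pos (M.continuous_h_X hε hω x)]
          exact M.h_X_eq hε hω x (ht₁ hε hω) t
        rw [hp, hy]
        simp only
        rw [M.branchPath_apply]
        refine (dist_branch_le k _ _).trans_lt ?_
        have h1 := M.abs_sub_motion_le (x := x) hε hω k (hρ k) (J := J k) (fun j hj τ hτ => ?_)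
          (t := t) ((mul_le_mul_of_nonneg_left (NNReal.coe_le_coe.2 ht) M.b_pos.le).trans (hJ k))
        · refine h1.trans_lt ?_
          rw [hρdef]
          simp only
          rw [div_mul_cancel₀ _ hKpos.ne']
          exact half_lt_self (hρ₀ k)
        · by_contra hcon
          refine hωD (mem_iUnion.2 ⟨k, mem_iUnion₂.2 ⟨j, Finset.mem_range.2 (by omega), ?_⟩⟩)
          exact ⟨hω, rfl, τ, hτ, (not_le.1 hcon).le⟩
  have hbi : Integrable (fun ω => η / 2 / 2 + D'.indicator (fun _ => 2 * ‖F‖) ω) noiseMeasure :=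
    (integrable_const _).add ((integrable_const _).indicator hD'm)
  refine (norm_integral_le_of_norm_le hbi hbound).trans_lt ?_
  rw [integral_add (integrable_const _) ((integrable_const _).indicator hD'm),
    integral_indicator_const _ hD'm, integral_const, probReal_univ, one_smul, smul_eq_mul]
  have : noiseMeasure.real D' = noiseMeasure.real (D ε) := by
    rw [Measure.real, measure_toMeasurable, Measure.real]
  rw [this]
  linarith

end IsModel

end FastSlow

end

/-! ### Convergence from each starting point, and reduction to the normalized model -/

noncomputable section

namespace FastSlow

variable {n m : ℕ} {q : Fin n → Fin n → ℝ → ℝ} {v : Fin n → ℝ → ℝ} {qbar : Fin n → Fin n → ℝ}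
  {φ : ℝ → ℝ} {a b Q : ℝ} {x : Fin n × ℝ}

namespace IsModel

theorem convergesWeakly_neg (M : IsModel m q v qbar φ a b Q) (hx : x.2 < 0) :
    ConvergesWeakly (projectedLaw m q v x)
      (∑ k, ENNReal.ofReal (exitProb m q v k) • branchLaw m q v k x.2) := by
  refine M.convergesWeakly M.exitProb_nonneg M.exitProb_sum (fun k r _ hr => ?_)
    fun k r hxr hr => ?_
  · exact PassageBound.of_upperBound (fun θ => M.upperBound_through θ k hx hr) fun θ => rfl
  · exact PassageBound.of_upperBound (fun θ => M.upperBound_neg θ k hxr hr zero_le_one)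
      fun θ => rfl

/-- From here on the class never changes, so all limiting mass sits on the class of the starting
state. This includes a start exactly over the vertex, where no splitting occurs. -/
theorem convergesWeakly_nonneg (M : IsModel m q v qbar φ a b Q) (hx : 0 ≤ x.2) :
    ConvergesWeakly (projectedLaw m q v x) (branchLaw m q v (cls m x.1) x.2) := by
  have h := M.convergesWeakly (x := x) (w := fun k => if cls m x.1 = k then 1 else 0)
    (fun k => by split_ifs <;> norm_num) ?_ (fun k r hxr hr => ?_)
    fun k r hxr hr => absurd (hx.trans hxr) (not_le.2 hr)
  · rw [Finset.sum_eq_single (cls m x.1)] at h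
    · simpa using h
    · intro k _ hk
      simp [hk.symm]
    · simp
  · rcases (show cls m x.1 = 0 ∨ cls m x.1 = 1 by omega) with h | h <;> simp [h]
  · refine PassageBound.of_upperBound (fun θ => M.upperBound_nonneg θ hx hxr
      (f := fun k' => if k' = k then 1 else 0) fun k' => by split_ifs <;> norm_num) fun θ => ?_
    by_cases hk : cls m x.1 = k
    · simp [hk]
    · simp [hk]

end IsModel

theorem limitLaw_of_neg (hx : x.2 < 0) : limitLaw m q v (h m x) =
    ∑ k, ENNReal.ofReal (exitProb m q v k) • branchLaw m q v k x.2 := by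
  simp [limitLaw, h, branch, hx.le]

theorem limitLaw_of_pos (hx : 0 < x.2) :
    limitLaw m q v (h m x) = branchLaw m q v (cls m x.1) x.2 := by
  rcases (show cls m x.1 = 0 ∨ cls m x.1 = 1 by omega) with hc | hc
  · simp [limitLaw, h, branch, hx, hx.le, hc]
  · simp [limitLaw, h, branch, hx, hx.le, hc]

theorem exists_forall_le_of_const_near_infty {f : ℝ → ℝ} {C : ℝ} (hC : 0 < C) (hf : Continuous f)
    (hl : ∀ z ≤ -C, f z = f (-C)) (hr : ∀ z, C ≤ z → f z = f C) :
    ∃ w₁ w₂, ∀ z, f w₁ ≤ f z ∧ f z ≤ f w₂ := by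
  have hne : (Icc (-C) C).Nonempty := ⟨0, by constructor <;> linarith⟩
  obtain ⟨w₁, -, h₁⟩ := isCompact_Icc.exists_isMinOn hne hf.continuousOn
  obtain ⟨w₂, -, h₂⟩ := isCompact_Icc.exists_isMaxOn hne hf.continuousOn
  have hw : ∀ z ∈ Icc (-C) C, f w₁ ≤ f z ∧ f z ≤ f w₂ := fun z hz => ⟨h₁ hz, h₂ hz⟩
  refine ⟨w₁, w₂, fun z => ?_⟩
  rcases le_total z (-C) with h | h
  · rw [hl z h]
    exact hw _ ⟨le_rfl, by linarith⟩
  · rcases le_total z C with h' | h'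
    · exact hw z ⟨h, h'⟩
    · rw [hr z h']
      exact hw _ ⟨by linarith, le_rfl⟩

/-- The function `φ` of the hypotheses need not be continuous. It is replaced by a rate between two
states of different classes, divided by its constant `qbar`: this is continuous, vanishes at `0`,
and differs from `φ` by a factor tending to one. -/
theorem exists_isModel (hm : 0 < m) (hmn : m < n)
    (hq_nonneg : ∀ i j, i ≠ j → ∀ z, 0 ≤ q i j z)
    (hq_cont : ∀ i j, i ≠ j → Continuous (q i j))
    (hq_neg : ∀ i j, i ≠ j → ∀ z, z < 0 → 0 < q i j z)
    (hq_pos : ∀ i j, i ≠ j → ∀ z, 0 ≤ z → (0 < q i j z ↔ cls m i = cls m j))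
    {φ : ℝ → ℝ} {β : Fin n → Fin n → ℝ → ℝ} (hqbar : ∀ i j, i ≠ j → 0 < qbar i j)
    (hφ : ∀ z, z < 0 → 0 < φ z) (hβ : ∀ i j, i ≠ j → Tendsto (β i j) (𝓝[<] 0) (𝓝 0))
    (hdegen : ∀ i j, i ≠ j → ∀ z, z < 0 → q i j z - q i j 0 = qbar i j * φ z * (1 + β i j z))
    (hv_cont : ∀ i, Continuous (v i)) (hv_pos : ∀ i z, 0 < v i z) {C : ℝ} (hC : 0 < C)
    (hql : ∀ i j, i ≠ j → ∀ z, z ≤ -C → q i j z = q i j (-C))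
    (hqr : ∀ i j, i ≠ j → ∀ z, C ≤ z → q i j z = q i j C)
    (hvl : ∀ i z, z ≤ -C → v i z = v i (-C)) (hvr : ∀ i z, C ≤ z → v i z = v i C) :
    ∃ ψ a b Q, IsModel m q v qbar ψ a b Q := by
  set i₀ : Fin n := ⟨0, by omega⟩ with hi₀
  set j₀ : Fin n := ⟨m, hmn⟩ with hj₀
  have hc0 : cls m i₀ = 0 := by simp [cls, hi₀, hm]
  have hc1 : cls m j₀ = 1 := by simp [cls, hj₀]
  have hne : i₀ ≠ j₀ := by
    intro h
    rw [h, hc1] at hc0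
    exact absurd hc0 (by decide)
  have hq0 : q i₀ j₀ 0 = 0 := by
    refine le_antisymm (not_lt.1 fun h => ?_) (hq_nonneg _ _ hne 0)
    have := (hq_pos _ _ hne 0 le_rfl).1 h
    rw [hc0, hc1] at this
    exact absurd this (by decide)
  have hb0 := hqbar _ _ hne
  obtain ⟨a, ha, hav⟩ : ∃ a > 0, ∀ i z, a ≤ v i z := by
    have h1 : ∀ i, ∀ᶠ a in 𝓝[>] (0 : ℝ), ∀ z, a ≤ v i z := by
      intro i
      obtain ⟨w, _, hw⟩ :=
        exists_forall_le_of_const_near_infty hC (hv_cont i) (hvl i) (hvr i)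
      exact ((eventually_le_nhds (hv_pos i w)).filter_mono nhdsWithin_le_nhds).mono
        fun a ha z => ha.trans (hw z).1
    obtain ⟨a, h2, h3⟩ := ((eventually_all.2 h1).and self_mem_nhdsWithin).exists
    exact ⟨a, h3, h2⟩
  obtain ⟨b, hbv⟩ : ∃ b, ∀ i z, v i z ≤ b := by
    have h1 : ∀ i, ∀ᶠ b : ℝ in atTop, ∀ z, v i z ≤ b := by
      intro i
      obtain ⟨_, w, hw⟩ :=
        exists_forall_le_of_const_near_infty hC (hv_cont i) (hvl i) (hvr i)
      exact (eventually_ge_atTop (v i w)).mono fun b hb z => (hw z).2.trans hb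
    exact (eventually_all.2 h1).exists
  obtain ⟨Q, hQ, hQq⟩ : ∃ Q > 0, ∀ i z, exitRate q i z ≤ Q := by
    have h1 : ∀ i, ∀ᶠ Q : ℝ in atTop, ∀ z, exitRate q i z ≤ Q := by
      intro i
      have hc : Continuous (exitRate q i) := continuous_finsetSum _ fun j hj =>
        hq_cont i j (Finset.ne_of_mem_erase hj).symm
      obtain ⟨_, w, hw⟩ := exists_forall_le_of_const_near_infty hC hc
        (fun z hz => Finset.sum_congr rfl fun j hj =>
          hql i j (Finset.ne_of_mem_erase hj).symm z hz)
        (fun z hz => Finset.sum_congr rfl fun j hj =>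
          hqr i j (Finset.ne_of_mem_erase hj).symm z hz)
      exact (eventually_ge_atTop (exitRate q i w)).mono fun b hb z => (hw z).2.trans hb
    obtain ⟨Q, h2, h3⟩ := ((eventually_all.2 h1).and (eventually_gt_atTop 0)).exists
    exact ⟨Q, h3, h2⟩
  refine ⟨fun z => q i₀ j₀ (min z 0) / qbar i₀ j₀, a, b, Q, hm, hmn, hq_nonneg, hq_cont, hq_neg,
    hq_pos, hqbar, ?_, fun z hz => ?_, ?_, fun i j hij => ?_,
    fun i => IsSpeed.of_continuous ha (hv_cont i) fun z => ⟨hav i z, hbv i z⟩, hv_cont, hQ, hQq⟩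
  · exact ((hq_cont _ _ hne).comp (by fun_prop)).div_const _
  · rw [min_eq_left hz.le]
    exact div_pos (hq_neg _ _ hne z hz) hb0
  · simp [hq0]
  -- Relative to the new normalization the common factor `φ` cancels and only the corrections `β`
  -- remain.
  · have h1 : Tendsto (fun z => qbar i j * ((1 + β i j z) / (1 + β i₀ j₀ z))) (𝓝[<] 0)
        (𝓝 (qbar i j * ((1 + 0) / (1 + 0)))) :=
      (((hβ i j hij).const_add 1).div ((hβ _ _ hne).const_add 1) (by norm_num)).const_mul _
    rw [add_zero, div_one, mul_one] at h1
    refine h1.congr' ?_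
    filter_upwards [self_mem_nhdsWithin] with z hz
    replace hz : z < 0 := hz
    have h2 := hdegen _ _ hne z hz
    have h3 := hq_neg _ _ hne z hz
    rw [hq0, sub_zero] at h2
    have h4 : (1 + β i₀ j₀ z) ≠ 0 := by
      intro h
      rw [h2, h, mul_zero] at h3
      exact lt_irrefl _ h3
    have hφz := (hφ z hz).ne'
    rw [min_eq_left hz.le, h2, hdegen i j hij z hz]
    have := hb0.ne'
    field_simp

end FastSlow

end

open FastSlow in
theorem mainTheorem1 (n m : ℕ) (hm : 0 < m) (hmn : m < n)
    (q : Fin n → Fin n → ℝ → ℝ) (v : Fin n → ℝ → ℝ)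
    -- transition rates: continuous, positive for `z < 0`, two ergodic classes for `z ≥ 0`
    (hq_nonneg : ∀ i j, i ≠ j → ∀ z, 0 ≤ q i j z)
    (hq_cont : ∀ i j, i ≠ j → Continuous (q i j))
    (hq_neg : ∀ i j, i ≠ j → ∀ z, z < 0 → 0 < q i j z)
    (hq_pos : ∀ i j, i ≠ j → ∀ z, 0 ≤ z → (0 < q i j z ↔ cls m i = cls m j))
    -- common rate of degeneration as `z ↑ 0`
    (hq_degen : ∃ (qbar : Fin n → Fin n → ℝ) (φ : ℝ → ℝ) (β : Fin n → Fin n → ℝ → ℝ),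
      (∀ i j, i ≠ j → 0 < qbar i j) ∧ (∀ z, z < 0 → 0 < φ z) ∧
      Tendsto φ (𝓝[<] 0) (𝓝 0) ∧ (∀ i j, i ≠ j → Tendsto (β i j) (𝓝[<] 0) (𝓝 0)) ∧
      ∀ i j, i ≠ j → ∀ z, z < 0 → q i j z - q i j 0 = qbar i j * φ z * (1 + β i j z))
    -- velocities: Lipschitz and positive
    (hv_lip : ∀ i, ∃ K : ℝ≥0, LipschitzWith K (v i))
    (hv_pos : ∀ i z, 0 < v i z)
    -- coefficients are constant near infinity
    (h_infty : ∃ (C : ℝ) (ql qr : Fin n → Fin n → ℝ) (vinf : ℝ), 0 < C ∧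
      (∀ i j, i ≠ j → ∀ z, z ≤ -C → q i j z = ql i j) ∧
      (∀ i j, i ≠ j → ∀ z, C ≤ z → q i j z = qr i j) ∧
      ∀ i z, C ≤ |z| → v i z = vinf) :
    -- the invariant distributions `μ(z)`, their limit `π` and the motions are well defined
    (∀ z, IsInvariant q z (mu m q z)) ∧
    (∀ z, 0 ≤ z → ∀ k, ∑ i ∈ R m k, mu m q z i = piBar m q k) ∧
    (∀ z μ, IsInvariant q z μ → (0 ≤ z → ∀ k, ∑ i ∈ R m k, μ i = piBar m q k) → μ = mu m q z) ∧
    (∀ i, Continuous fun z => mu m q z i) ∧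
    (∀ i, Tendsto (fun z => mu m q z i) (𝓝[<] 0) (𝓝 (piLim q i))) ∧
    (∀ i z, IsMotion (v i) z (motion (v i) z)) ∧
    (∀ k z, IsMotion (avgSpeed m q v k) z (motion (avgSpeed m q v k) z)) ∧
    -- the projected process has continuous trajectories
    (∀ (x : Fin n × ℝ) (ε : ℝ), 0 < ε →
      ∀ᵐ ω ∂noiseMeasure, Continuous fun t => h m (X q v ε x ω t)) ∧
    -- convergence to the limiting process
    (∀ x : Fin n × ℝ, x.2 ≠ 0 →
      ConvergesWeakly (projectedLaw m q v x) (limitLaw m q v (h m x))) ∧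
    -- a start exactly over the vertex, from the class `k`: the process proceeds to the edge of `k`
    (∀ x : Fin n × ℝ, x.2 = 0 →
      ConvergesWeakly (projectedLaw m q v x) (branchLaw m q v (cls m x.1) 0)) := by
  obtain ⟨qbar, φ, β, hqbar, hφ, -, hβ, hdegen⟩ := hq_degen
  obtain ⟨C, ql, qr, vinf, hC, hql, hqr, hvinf⟩ := h_infty
  have hv_cont : ∀ i, Continuous (v i) := fun i => (hv_lip i).choose_spec.continuous
  have habs : |-C| = C := by rw [abs_neg, abs_of_pos hC]
  obtain ⟨ψ, a, b, Q, M⟩ := exists_isModel hm hmn hq_nonneg hq_cont hq_neg hq_pos hqbar hφ hβ hdegen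
    hv_cont hv_pos hC (fun i j hij z hz => by rw [hql i j hij z hz, hql i j hij (-C) le_rfl])
    (fun i j hij z hz => by rw [hqr i j hij z hz, hqr i j hij C le_rfl])
    (fun i z hz => by
      rw [hvinf i z (by rw [abs_of_nonpos (by linarith)]; linarith), hvinf i (-C) habs.ge])
    (fun i z hz => by
      rw [hvinf i z (hz.trans (le_abs_self z)), hvinf i C (le_abs_self C)])
  refine ⟨M.mu_invariant, fun z hz => (M.mu_spec_nonneg hz).2, M.mu_unique, M.mu_apply_continuous,
    tendsto_pi_nhds.1 M.tendsto_mu_left, fun i => (M.speed i).motion_isMotion,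
    fun k => (M.avgSpeed_isSpeed k).motion_isMotion,
    fun x ε hε => ae_goodNoise.mono fun ω hω => M.continuous_h_X hε hω x, fun x hx => ?_,
    fun x hx => ?_⟩
  · rcases hx.lt_or_gt with h | h
    · rw [limitLaw_of_neg h]
      exact M.convergesWeakly_neg h
    · rw [limitLaw_of_pos h]
      exact M.convergesWeakly_nonneg h.le
  · have := M.convergesWeakly_nonneg hx.ge
    rwa [hx] at this
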